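/- Let $\mathbb B=\{x\in\mathbb R^3:\|x\|\le 1\}$, let $\varpi_\alpha(x)=(1-\|x\|^2)^\alpha$ for $\alpha>-1$, and for a complex-valued function or a $\mathbb C^3$-valued field $\phi\in L^2_{\varpi_\alpha}(\mathbb B)$ and $c>0$ let $$\mathscr F_c^{(\alpha)}[\phi](x)=\int_{\mathbb B}e^{-ic\langle x,\tau\rangle}\phi(\tau)\,\varpi_\alpha(\tau)\,d\tau .$$ Let $Y_\ell^n$ ($n\ge 0$, $1\le \ell\le 2n+1$) be real homogeneous harmonic polynomials on $\mathbb R^3$ of degree $n$ that are orthonormal in $L^2(\mathbb S^2)$; such systems exist, and what follows holds for each of them. With $r=\|x\|$, $\hat x=x/r$ put $$\mathbf Y_\ell^{n,1}=\hat x\,Y_\ell^n(\hat x),\qquad \mathbf Y_\ell^{n,2}=r\nabla[Y_\ell^n(\hat x)],\qquad \mathbf Y_\ell^{n,3}=x\times\nabla[Y_\ell^n(\hat x)].$$ For a field $E$ let $E_\ell^{n,1}(r)=\int_{\mathbb S^2}E(r\omega)\cdot\mathbf Y_\ell^{n,1}(\omega)\,d\sigma(\omega)$ and, for $j=2,3$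 and $n\ge1$, $E_\ell^{n,j}(r)=\frac1{n(n+1)}\int_{\mathbb S^2}E(r\omega)\cdot\mathbf Y_\ell^{n,j}(\omega)\,d\sigma(\omega)$ (and $E^{0,j}_1=0$). Divergence, curl and $x\times\nabla$ of non-smooth objects are taken in the sense of distributions on the open set under consideration. (1) Let $E\in L^2(\mathbb R^3)^3$ with $\nabla\cdot E=0$ in $\mathbb R^3$, or $E\in L^2_{\varpi_\alpha}(\mathbb B)^3$ with $\alpha>-1$ (the case $\alpha=0$ being $L^2(\mathbb B)^3$) and $\nabla\cdot E=0$ in the open unit ball. Then $$E=\sum_{n=1}^\infty\sum_{\ell=1}^{2n+1}\Big[(x\times\nabla)\big(E_\ell^{n,3}(r)Y_\ell^n(\hat x)\big)-\frac1{n(n+1)}\nabla\times(x\times\nabla)\big(rE_\ell^{n,1}(r)Y_\ell^n(\hat x)\big)\Big]$$ with convergence of the partial sums over $n$ in $L^2(\mathbb R^3)^3$, respectively $L^2_{\varpi_\alpha}(\mathbb B)^3$; for each $(\ell,n)$ the first term in the bracket equals $E_\ell^{n,3}\mathbf Y_\ell^{n,3}$ and the second, with its sign and factor, equals $E_\ell^{n,1}\mathbf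 Y_\ell^{n,1}+E_\ell^{n,2}\mathbf Y_\ell^{n,2}$. Now let $c>0$ and $\alpha>-1$. (2) Let $n\ge 1$, $1\le\ell\le 2n+1$ and let $e_3$ be a radial function such that $e_3(r)\mathbf Y_\ell^{n,3}\in L^2_{\varpi_\alpha}(\mathbb B)^3$. Then $e_3\mathbf Y_\ell^{n,3}=(x\times\nabla)(e_3(r)Y_\ell^n(\hat x))$ in the open ball, its transform is differentiable, and $\nabla\cdot\mathscr F_c^{(\alpha)}[e_3\mathbf Y_\ell^{n,3}]=0$. (3) Let $n\ge1$, $1\le\ell\le2n+1$ and let $e_1,e_2$ be radial functions such that $W=e_1\mathbf Y_\ell^{n,1}+e_2\mathbf Y_\ell^{n,2}\in L^2_{\varpi_\alpha}(\mathbb B)^3$ and $W=-\frac1{n(n+1)}\nabla\times(x\times\nabla)(r e_1(r)Y_\ell^n(\hat x))$ in the open ball. Then $\mathscr F_c^{(\alpha)}[W]$ is differentiable, and $\nabla\cdot\mathscr F_c^{(\alpha)}[W]=0$ on $\mathbb B$ if and only if $e_1=0=e_2$ almost everywhere on $(0,1)$. (4) Let $E\in L^2_{\varpi_\alpha}(\mathbb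 B)^3$, $E\ne0$, satisfy $\mathscr F_c^{(\alpha)}[E]=\mu E$ in $\mathbb B$ for some $\mu\in\mathbb C$ and $\nabla\cdot E=0$ in the open ball. Then $E_\ell^{n,1}=0=E_\ell^{n,2}$ almost everywhere on $(0,1)$ for all $n\ge0$ and all $\ell$; $E=\sum_{n\ge1}\sum_\ell E_\ell^{n,3}\mathbf Y_\ell^{n,3}$ in $L^2_{\varpi_\alpha}(\mathbb B)^3$; and there is a smooth function $\phi$ on $\mathbb R^3$ such that $\phi=\sum_{n\ge1}\sum_\ell E_\ell^{n,3}(r)Y_\ell^n(\hat x)$ in $L^2_{\varpi_\alpha}(\mathbb B)$, $E=x\times\nabla\phi$ almost everywhere in $\mathbb B$, $\phi\neq0$, and $\mathscr F_c^{(\alpha)}[\phi]=\mu\phi$ in $\mathbb B$. (5) Conversely, every $\phi\in L^2_{\varpi_\alpha}(\mathbb B)$, $\phi\ne0$, with $\mathscr F_c^{(\alpha)}[\phi]=\mu\phi$ in $\mathbb B$ agrees almost everywhere in $\mathbb B$ with a smooth function $\phi'$ on $\mathbb R^3$ for which $x\times\nabla\phi'$ is divergence free and, unless it vanishes almost everywhere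 in $\mathbb B$, is an eigenfunction of $\mathscr F_c^{(\alpha)}$ in $L^2_{\varpi_\alpha}(\mathbb B)^3$ with the same eigenvalue $\mu$. -/

import Mathlib

open MeasureTheory Filter Topology
open scoped ContDiff

/-- Euclidean space `ℝ³`. -/
abbrev R3 := EuclideanSpace ℝ (Fin 3)

/-- `ℂ³`, where the vector fields take their values. -/
abbrev C3 := EuclideanSpace ℂ (Fin 3)

/-- The closed unit ball `𝔹` of `ℝ³`. -/
def unitBall : Set R3 := Metric.closedBall 0 1

noncomputable section

/-! ### Differential operators -/

/-- The partial derivative `∂ᵢ f` at `x`. -/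
def pd (i : Fin 3) (f : R3 → ℂ) (x : R3) : ℂ :=
  fderiv ℝ f x (EuclideanSpace.single i 1)

/-- The gradient `∇ f`. -/
def grad (f : R3 → ℂ) (x : R3) : C3 :=
  !₂[pd 0 f x, pd 1 f x, pd 2 f x]

/-- The operator `x × ∇`. -/
def xGrad (f : R3 → ℂ) (x : R3) : C3 :=
  !₂[(x 1 : ℂ) * pd 2 f x - (x 2 : ℂ) * pd 1 f x,
     (x 2 : ℂ) * pd 0 f x - (x 0 : ℂ) * pd 2 f x,
     (x 0 : ℂ) * pd 1 f x - (x 1 : ℂ) * pd 0 f x]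

/-- The divergence `∇ · G`. -/
def divergence (G : R3 → C3) (x : R3) : ℂ :=
  ∑ i, pd i (fun y => G y i) x

/-- The curl `∇ × G`. -/
def curl (G : R3 → C3) (x : R3) : C3 :=
  !₂[pd 1 (fun y => G y 2) x - pd 2 (fun y => G y 1) x,
     pd 2 (fun y => G y 0) x - pd 0 (fun y => G y 2) x,
     pd 0 (fun y => G y 1) x - pd 1 (fun y => G y 0) x]

/-- The bilinear product `a · b = ∑ᵢ aᵢ bᵢ` (no complex conjugation). -/
def dot (a b : C3) : ℂ := ∑ i, a i * b i

/-! ### The same operators in the sense of distributions on an open set `Ω` -/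

/-- Smooth functions with compact support in `Ω`. -/
def IsTest {V : Type*} [NormedAddCommGroup V] [NormedSpace ℝ V]
    (Ω : Set R3) (ψ : R3 → V) : Prop :=
  ContDiff ℝ ∞ ψ ∧ HasCompactSupport ψ ∧ tsupport ψ ⊆ Ω

/-- `∇ · E = 0` in `Ω`. -/
def WeakDivFree (Ω : Set R3) (E : R3 → C3) : Prop :=
  LocallyIntegrableOn E Ω ∧
    ∀ ψ : R3 → ℂ, IsTest Ω ψ → ∫ x in Ω, dot (E x) (grad ψ x) = 0

/-- `(x × ∇) g = G` in `Ω` (each component of `x × ∇` is formally antisymmetric). -/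
def HasWeakXGrad (Ω : Set R3) (g : R3 → ℂ) (G : R3 → C3) : Prop :=
  LocallyIntegrableOn g Ω ∧ LocallyIntegrableOn G Ω ∧
    ∀ ψ : R3 → ℂ, IsTest Ω ψ → ∀ i,
      ∫ x in Ω, G x i * ψ x = -∫ x in Ω, g x * xGrad ψ x i

/-- `∇ × G = H` in `Ω`. -/
def HasWeakCurl (Ω : Set R3) (G H : R3 → C3) : Prop :=
  LocallyIntegrableOn G Ω ∧ LocallyIntegrableOn H Ω ∧
    ∀ Ψ : R3 → C3, IsTest Ω Ψ →
      ∫ x in Ω, dot (H x) (Ψ x) = ∫ x in Ω, dot (G x) (curl Ψ x)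

/-- `∇ × (x × ∇) g = H` in `Ω`. -/
def HasWeakCurlXGrad (Ω : Set R3) (g : R3 → ℂ) (H : R3 → C3) : Prop :=
  ∃ G : R3 → C3, HasWeakXGrad Ω g G ∧ HasWeakCurl Ω G H

/-! ### Scalar and vector spherical harmonics -/

/-- The surface measure on the unit sphere. -/
def sphereMeasure : Measure (Metric.sphere (0 : R3) 1) := (volume : Measure R3).toSphere

/-- `Y n ℓ` (with `ℓ` running over `2 n + 1` values) are real homogeneous harmonic polynomials of
degree `n` that are orthonormal in `L²` of the unit sphere. -/
structure IsSphericalHarmonicSystem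
    (Y : (n : ℕ) → Fin (2 * n + 1) → MvPolynomial (Fin 3) ℝ) : Prop where
  homogeneous : ∀ n ℓ, (Y n ℓ).IsHomogeneous n
  harmonic : ∀ n ℓ, ∑ i, MvPolynomial.pderiv i (MvPolynomial.pderiv i (Y n ℓ)) = 0
  orthonormal : ∀ (n : ℕ) (ℓ : Fin (2 * n + 1)) (m : ℕ) (k : Fin (2 * m + 1)),
    ∫ s : Metric.sphere (0 : R3) 1,
        MvPolynomial.eval (fun i => s.1 i) (Y n ℓ) * MvPolynomial.eval (fun i => s.1 i) (Y m k)
          ∂sphereMeasure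
      = if (⟨n, ℓ⟩ : Σ n : ℕ, Fin (2 * n + 1)) = ⟨m, k⟩ then 1 else 0

/-- `p (x / ‖x‖)`: the restriction of `p` to the sphere, extended to be constant along rays. -/
def angular (p : MvPolynomial (Fin 3) ℝ) (x : R3) : ℂ :=
  ((MvPolynomial.eval (fun i => x i / ‖x‖) p : ℝ) : ℂ)

/-- The vector spherical harmonic of the first kind, `x̂ Y(x̂)`. -/
def vsh1 (p : MvPolynomial (Fin 3) ℝ) (x : R3) : C3 :=
  angular p x • !₂[((x 0 / ‖x‖ : ℝ) : ℂ), ((x 1 / ‖x‖ : ℝ) : ℂ), ((x 2 / ‖x‖ : ℝ) : ℂ)]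

/-- The vector spherical harmonic of the second kind, `r ∇ [Y(x̂)]`. -/
def vsh2 (p : MvPolynomial (Fin 3) ℝ) (x : R3) : C3 :=
  (‖x‖ : ℂ) • grad (angular p) x

/-- The vector spherical harmonic of the third kind, `x × ∇ [Y(x̂)]`. -/
def vsh3 (p : MvPolynomial (Fin 3) ℝ) (x : R3) : C3 :=
  xGrad (angular p) x

/-- The radial coefficient of `E` at the vector spherical harmonic field `Z`, whose square has
integral `N` over the unit sphere: `N⁻¹ ∫_{S²} E(r s) · Z(s) dσ(s)`. -/
def radialCoeff (N : ℂ) (Z E : R3 → C3) (r : ℝ) : ℂ :=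
  N⁻¹ * ∫ s : Metric.sphere (0 : R3) 1, dot (E (r • s.1)) (Z s.1) ∂sphereMeasure

/-- `E_ℓ^{n,1}(r)`, where `p = Y_ℓ^n`. -/
def coeff1 (p : MvPolynomial (Fin 3) ℝ) (E : R3 → C3) : ℝ → ℂ :=
  radialCoeff 1 (vsh1 p) E

/-- `E_ℓ^{n,2}(r)`, where `p = Y_ℓ^n`; it is `0` for `n = 0`, where `vsh2 p` vanishes. -/
def coeff2 (n : ℕ) (p : MvPolynomial (Fin 3) ℝ) (E : R3 → C3) : ℝ → ℂ :=
  radialCoeff (n * (n + 1)) (vsh2 p) E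

/-- `E_ℓ^{n,3}(r)`, where `p = Y_ℓ^n`; it is `0` for `n = 0`, where `vsh3 p` vanishes. -/
def coeff3 (n : ℕ) (p : MvPolynomial (Fin 3) ℝ) (E : R3 → C3) : ℝ → ℂ :=
  radialCoeff (n * (n + 1)) (vsh3 p) E

/-- `e(r) Y(x̂)`. -/
def scalarMode (p : MvPolynomial (Fin 3) ℝ) (e : ℝ → ℂ) (x : R3) : ℂ :=
  e ‖x‖ * angular p x

/-- `e₃(r) Y^{n,3}(x̂)`. -/
def toroidalMode (p : MvPolynomial (Fin 3) ℝ) (e₃ : ℝ → ℂ) (x : R3) : C3 :=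
  e₃ ‖x‖ • vsh3 p x

/-- `e₁(r) Y^{n,1}(x̂) + e₂(r) Y^{n,2}(x̂)`. -/
def poloidalMode (p : MvPolynomial (Fin 3) ℝ) (e₁ e₂ : ℝ → ℂ) (x : R3) : C3 :=
  e₁ ‖x‖ • vsh1 p x + e₂ ‖x‖ • vsh2 p x

/-- The scalar potential `-(1 / (n (n + 1))) r e₁(r) Y(x̂)`. -/
def poloidalPotential (n : ℕ) (p : MvPolynomial (Fin 3) ℝ) (e₁ : ℝ → ℂ) : R3 → ℂ :=
  scalarMode p (fun r => -(1 / ((n : ℂ) * (n + 1))) * r * e₁ r)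

/-! ### The finite Fourier transform -/

/-- The measure `(1 - ‖x‖²)^α dx` on the unit ball (for `α = 0`: Lebesgue measure on the ball). -/
def ballMeasure (α : ℝ) : Measure R3 :=
  (volume.restrict unitBall).withDensity (fun x => ENNReal.ofReal ((1 - ‖x‖ ^ 2) ^ α))

/-- The finite Fourier transform
`∫_𝔹 exp(-i c ⟨x, τ⟩) φ(τ) (1 - ‖τ‖²)^α dτ` of a scalar function or a vector field `φ`. -/
def finiteFourier {V : Type*} [NormedAddCommGroup V] [NormedSpace ℂ V]
    (c α : ℝ) (φ : R3 → V) (x : R3) : V :=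
  ∫ τ in unitBall,
    (Complex.exp (-(Complex.I * c * (inner ℝ x τ : ℝ))) * (((1 - ‖τ‖ ^ 2) ^ α : ℝ) : ℂ)) • φ τ

/-- `φ` is an eigenfunction, for the eigenvalue `μ`, of the finite Fourier transform on the
weighted `L²` space of the unit ball. -/
structure IsEigenfunction {V : Type*} [NormedAddCommGroup V] [NormedSpace ℂ V]
    (c α : ℝ) (μ : ℂ) (φ : R3 → V) : Prop where
  memLp : MemLp φ 2 (ballMeasure α)
  ne_zero : ¬ ∀ᵐ x ∂volume.restrict unitBall, φ x = 0
  eigen : ∀ᵐ x ∂volume.restrict unitBall, finiteFourier c α φ x = μ • φ x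

end

/-! The operator `x × ∇` differentiates along spheres. It commutes with dilations, kills radial
functions and is antisymmetric on every sphere, hence for every rotation invariant measure and
without boundary terms. The sum of the squares of its components acts on solid harmonics of degree
`n` as `-n(n+1)`. This gives the orthogonality of the three families of vector spherical harmonics,
with squared norms `1`, `n(n+1)`, `n(n+1)`.

Completeness starts from a dimension count. The map `q ↦ Δ(|x|² q)` is injective on homogeneous
polynomials, so the solid harmonics of degree `n` have dimension `2n+1`, every admissible system
spans them, and every polynomial is a sum of terms `|x|^{2k}` times a harmonic. With
Stone–Weierstrass the scalar harmonics are total on the sphere. `hodge_identity` writes a constant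
vector times a harmonic through the three kinds of fields, so these are total too
(`ae_eq_zero_of_integral_dot_vsh`). Slicing by spheres (`IsPolar`) and dominated convergence in `r`
give the `L²` expansion (`IsPolar.vsh_expansion`).

For divergence-free `E`, testing with `β(r) Y(x̂)` yields the weak equation `(r² E¹)' = n(n+1) r
E²`. This is exactly the condition under which the poloidal mode is the weak curl of the toroidal
mode with profile `-r E¹ / (n(n+1))` (`hasWeakCurl_mode`). In degree 0 the test profiles need not
vanish at the origin, and `E¹ = 0` follows.

Two facts about the transform `F` carry the rest. First, `∇ · F[W] = -ic F[x · W]`, and `F` is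
injective because its derivatives at the origin are the moments. So `F[W]` is divergence free on the
ball only if `x · W = 0`; this kills the radial coefficient, and then the potential and the whole
poloidal mode. Toroidal modes satisfy `x · W = 0` identically. A divergence-free eigenfield has
`F[E] = μ E` divergence free, so it is purely toroidal.

Second, `F` commutes with `x × ∇`, since the kernel is invariant under simultaneous rotation of both
variables. As `n(n+1) ≥ 1`, convergence of the toroidal series forces convergence of the scalar
series, which gives `φ₀` with `E = x × ∇ φ₀` weakly. Injectivity gives `μ ≠ 0`, so `ψ = μ⁻¹ F[φ₀]`
is smooth and `E = x × ∇ ψ`. Now `ψ - φ₀` is killed by `x × ∇`, while `ψ` and `φ₀` are both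
orthogonal to radial functions, because `F` is symmetric and preserves these. Hence `ψ = φ₀` almost
everywhere, and `ψ` is the eigenpotential (`exists_eigenpotential`). The converse is the commutation
read in the other direction. -/

noncomputable section

section
/-! ### Polynomials on `ℝ³` -/

open MvPolynomial in
/-- The polynomial `x₀² + x₁² + x₂²`. -/
def normSqPoly : MvPolynomial (Fin 3) ℝ := X 0 ^ 2 + X 1 ^ 2 + X 2 ^ 2

/-- The Laplacian on polynomials. -/
def lapPoly (p : MvPolynomial (Fin 3) ℝ) : MvPolynomial (Fin 3) ℝ :=
  ∑ i, MvPolynomial.pderiv i (MvPolynomial.pderiv i p)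

open MvPolynomial in
/-- The `i`-th component of `x × ∇` on polynomials. -/
def rotPoly (i : Fin 3) (p : MvPolynomial (Fin 3) ℝ) : MvPolynomial (Fin 3) ℝ :=
  X (i + 1) * pderiv (i + 2) p - X (i + 2) * pderiv (i + 1) p

section
open MvPolynomial

theorem pderiv_pderiv_comm (i j : Fin 3) (p : MvPolynomial (Fin 3) ℝ) :
    pderiv i (pderiv j p) = pderiv j (pderiv i p) := by
  induction p using MvPolynomial.induction_on with
  | C a => simp
  | add p q hp hq => simp [hp, hq]
  | mul_X p k h =>
    have h1 : ∀ a b : Fin 3, pderiv a (pderiv b (X k : MvPolynomial (Fin 3) ℝ)) = 0 := by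
      intro a b
      rw [pderiv_X, Pi.single_apply]
      split_ifs <;> simp
    simp only [Derivation.leibniz, smul_eq_mul, map_add, h, h1]
    ring

theorem rotPoly_add (i : Fin 3) (p q : MvPolynomial (Fin 3) ℝ) :
    rotPoly i (p + q) = rotPoly i p + rotPoly i q := by
  simp only [rotPoly, map_add]; ring

theorem rotPoly_mul (i : Fin 3) (p q : MvPolynomial (Fin 3) ℝ) :
    rotPoly i (p * q) = rotPoly i p * q + p * rotPoly i q := by
  simp only [rotPoly, Derivation.leibniz, smul_eq_mul]; ring

theorem euler_three {p : MvPolynomial (Fin 3) ℝ} {n : ℕ} (hp : p.IsHomogeneous n) :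
    X 0 * pderiv 0 p + X 1 * pderiv 1 p + X 2 * pderiv 2 p = (n : MvPolynomial (Fin 3) ℝ) * p := by
  have := hp.sum_X_mul_pderiv
  simpa [Fin.sum_univ_three] using this

theorem euler_three_pderiv {p : MvPolynomial (Fin 3) ℝ} {n : ℕ} (hp : p.IsHomogeneous n)
    (i : Fin 3) :
    X 0 * pderiv 0 (pderiv i p) + X 1 * pderiv 1 (pderiv i p) + X 2 * pderiv 2 (pderiv i p) =
      ((n : MvPolynomial (Fin 3) ℝ) - 1) * pderiv i p := by
  have h := congrArg (pderiv i) (euler_three hp)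
  simp only [map_add, Derivation.leibniz, smul_eq_mul, pderiv_X, Derivation.map_natCast,
    mul_zero, add_zero] at h
  rw [pderiv_pderiv_comm i 0, pderiv_pderiv_comm i 1, pderiv_pderiv_comm i 2] at h
  fin_cases i <;> simp at h ⊢ <;> linear_combination h

/-- The operator identity `(x × ∇)² = |x|² Δ - D (D + 1)`, where the Euler operator `D` acts as `n`.
On solid harmonics only the eigenvalue `-n(n+1)` remains. -/
theorem sum_rotPoly_rotPoly {p : MvPolynomial (Fin 3) ℝ} {n : ℕ} (hp : p.IsHomogeneous n) :
    ∑ i, rotPoly i (rotPoly i p) =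
      normSqPoly * lapPoly p - (n * (n + 1) : MvPolynomial (Fin 3) ℝ) * p := by
  have e := euler_three hp
  have e0 := euler_three_pderiv hp 0
  have e1 := euler_three_pderiv hp 1
  have e2 := euler_three_pderiv hp 2
  have c10 := pderiv_pderiv_comm 1 0 p
  have c20 := pderiv_pderiv_comm 2 0 p
  have c21 := pderiv_pderiv_comm 2 1 p
  simp only [Fin.sum_univ_three, rotPoly, lapPoly, normSqPoly, Fin.isValue, zero_add,
    show (1 : Fin 3) + 1 = 2 from rfl, show (1 : Fin 3) + 2 = 0 from rfl,
    show (2 : Fin 3) + 1 = 0 from rfl, show (2 : Fin 3) + 2 = 1 from rfl, map_sub,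
    Derivation.leibniz, smul_eq_mul, pderiv_X, Pi.single_apply]
  simp
  simp only [c10, c20, c21] at *
  linear_combination (-1 - (n:MvPolynomial (Fin 3) ℝ)) * e - X 0 * e0 - X 1 * e1 - X 2 * e2

/-- Symmetry of second derivatives gives `(x × ∇) · ∇ = 0`; this separates surface gradients from
surface curls in `vshPoly_two_three`. -/
theorem sum_rotPoly_pderiv (p : MvPolynomial (Fin 3) ℝ) :
    ∑ i, rotPoly i (pderiv i p) = 0 := by
  have c10 := pderiv_pderiv_comm 1 0 p
  have c20 := pderiv_pderiv_comm 2 0 p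
  have c21 := pderiv_pderiv_comm 2 1 p
  simp only [Fin.sum_univ_three, rotPoly, Fin.isValue, zero_add,
    show (1 : Fin 3) + 1 = 2 from rfl, show (1 : Fin 3) + 2 = 0 from rfl,
    show (2 : Fin 3) + 1 = 0 from rfl, show (2 : Fin 3) + 2 = 1 from rfl, c10, c20, c21]
  ring

/-- The constant field `eᵢ`, multiplied by a solid harmonic, is on the sphere the sum of a radial
field, a surface gradient and a surface curl. -/
theorem hodge_identity {p : MvPolynomial (Fin 3) ℝ} {n : ℕ} (hp : p.IsHomogeneous n)
    (hl : lapPoly p = 0) (i j : Fin 3) :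
    (if i = j then (n * (n + 1) : MvPolynomial (Fin 3) ℝ) * p else 0) +
      pderiv j (pderiv i p - (n : MvPolynomial (Fin 3) ℝ) * (X i * p)) + rotPoly j (rotPoly i p) =
    X j * (((n : MvPolynomial (Fin 3) ℝ) - 1) * pderiv i p) +
      (1 - normSqPoly) * pderiv i (pderiv j p) := by
  have e := euler_three hp
  have e0 := euler_three_pderiv hp 0
  have e1 := euler_three_pderiv hp 1
  have e2 := euler_three_pderiv hp 2
  have c10 := pderiv_pderiv_comm 1 0 p
  have c20 := pderiv_pderiv_comm 2 0 p
  have c21 := pderiv_pderiv_comm 2 1 p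
  simp only [lapPoly, Fin.sum_univ_three] at hl
  fin_cases i <;> fin_cases j <;>
  simp only [rotPoly, normSqPoly, Fin.isValue, zero_add, Fin.zero_eta, Fin.mk_one, Fin.reduceFinMk,
    show (1 : Fin 3) + 1 = 2 from rfl, show (1 : Fin 3) + 2 = 0 from rfl,
    show (2 : Fin 3) + 1 = 0 from rfl, show (2 : Fin 3) + 2 = 1 from rfl, map_sub,
    Derivation.leibniz, smul_eq_mul, pderiv_X, Pi.single_apply, Derivation.map_natCast] <;>
  simp <;> simp only [c10, c20, c21] at *
  -- All nine cases share the pattern `-xᵢ xⱼ hl + xⱼ eᵢ + xᵢ eⱼ`; on the diagonal `|x|² hl - n e -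
  -- ∑ xₖ eₖ` is added.
  · linear_combination (X 0 ^ 2 + X 1 ^ 2 + X 2 ^ 2) * hl - (n : MvPolynomial (Fin 3) ℝ) * e - X 0 * e0 - X 1 * e1 - X 2 * e2 - X 0 * X 0 * hl + X 0 * e0 + X 0 * e0
  · linear_combination - X 0 * X 1 * hl + X 1 * e0 + X 0 * e1
  · linear_combination - X 0 * X 2 * hl + X 2 * e0 + X 0 * e2
  · linear_combination - X 1 * X 0 * hl + X 0 * e1 + X 1 * e0
  · linear_combination (X 0 ^ 2 + X 1 ^ 2 + X 2 ^ 2) * hl - (n : MvPolynomial (Fin 3) ℝ) * e - X 0 * e0 - X 1 * e1 - X 2 * e2 - X 1 * X 1 * hl + X 1 * e1 + X 1 * e1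
  · linear_combination - X 1 * X 2 * hl + X 2 * e1 + X 1 * e2
  · linear_combination - X 2 * X 0 * hl + X 0 * e2 + X 2 * e0
  · linear_combination - X 2 * X 1 * hl + X 1 * e2 + X 2 * e1
  · linear_combination (X 0 ^ 2 + X 1 ^ 2 + X 2 ^ 2) * hl - (n : MvPolynomial (Fin 3) ℝ) * e - X 0 * e0 - X 1 * e1 - X 2 * e2 - X 2 * X 2 * hl + X 2 * e2 + X 2 * e2
end

end

/-! ### Solid harmonics: the splitting `p = h + |x|² q` and the dimension `2n + 1` -/

section
section
open MvPolynomial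

theorem isHomogeneous_normSqPoly : normSqPoly.IsHomogeneous 2 :=
  ((isHomogeneous_X_pow _ _).add (isHomogeneous_X_pow _ _)).add (isHomogeneous_X_pow _ _)

theorem normSqPoly_ne_zero : normSqPoly ≠ 0 := by
  intro h
  have := congrArg (eval ![1, 0, 0]) h
  simp [normSqPoly] at this

theorem pderiv_eq_zero_of_isHomogeneous_zero {p : MvPolynomial (Fin 3) ℝ}
    (hp : p.IsHomogeneous 0) (i : Fin 3) : pderiv i p = 0 := by
  rw [← totalDegree_zero_iff_isHomogeneous, totalDegree_eq_zero_iff_eq_C] at hp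
  rw [hp, pderiv_C]

theorem isHomogeneous_lapPoly {p : MvPolynomial (Fin 3) ℝ} {n : ℕ} (hp : p.IsHomogeneous n) :
    (lapPoly p).IsHomogeneous (n - 2) :=
  IsHomogeneous.sum _ _ _ fun i _ => by
    rw [show n - 2 = n - 1 - 1 by omega]
    exact hp.pderiv.pderiv

theorem lapPoly_eq_zero_of_lt_two {p : MvPolynomial (Fin 3) ℝ} {n : ℕ} (hp : p.IsHomogeneous n)
    (hn : n < 2) : lapPoly p = 0 :=
  Finset.sum_eq_zero fun i _ =>
    pderiv_eq_zero_of_isHomogeneous_zero (by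
      have := hp.pderiv (i := i)
      rwa [show n - 1 = 0 by omega] at this) i

theorem lapPoly_add (p q : MvPolynomial (Fin 3) ℝ) : lapPoly (p + q) = lapPoly p + lapPoly q := by
  simp [lapPoly, Finset.sum_add_distrib]

theorem lapPoly_C_mul (a : ℝ) (p : MvPolynomial (Fin 3) ℝ) :
    lapPoly (C a * p) = C a * lapPoly p := by
  simp [lapPoly, Finset.mul_sum, Derivation.leibniz]

theorem lapPoly_normSqPoly_mul {p : MvPolynomial (Fin 3) ℝ} {n : ℕ} (hp : p.IsHomogeneous n) :
    lapPoly (normSqPoly * p) =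
      normSqPoly * lapPoly p + (4 * n + 6 : MvPolynomial (Fin 3) ℝ) * p := by
  have e := euler_three hp
  simp only [lapPoly, Fin.sum_univ_three, normSqPoly, Derivation.leibniz, Derivation.leibniz_pow,
    smul_eq_mul, map_add, pderiv_X, map_nsmul]
  simp
  linear_combination 4 * e

theorem lapPoly_normSqPoly_pow_mul {p : MvPolynomial (Fin 3) ℝ} {n : ℕ} (hp : p.IsHomogeneous n)
    (j : ℕ) :
    lapPoly (normSqPoly ^ (j + 1) * p) = normSqPoly ^ j * (normSqPoly * lapPoly p +
      (2 * (j + 1) * (2 * n + 2 * j + 3) : MvPolynomial (Fin 3) ℝ) * p) := by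
  induction j with
  | zero =>
    simp only [zero_add, pow_one, lapPoly_normSqPoly_mul hp]
    push_cast; ring
  | succ j ih =>
    rw [pow_succ' _ (j + 1), mul_assoc, lapPoly_normSqPoly_mul
      ((isHomogeneous_normSqPoly.pow (j + 1)).mul hp), ih]
    push_cast; ring

/-- The formula for `Δ(|x|^{2(j+1)} p)` turns the hypothesis into `|x|² Δp = -c p` with `c > 0`. So
`|x|²` divides `p`, and one descends in the degree. -/
theorem eq_zero_of_lapPoly_normSqPoly_pow_mul {n : ℕ} {p : MvPolynomial (Fin 3) ℝ}
    (hp : p.IsHomogeneous n) (j : ℕ) (h : lapPoly (normSqPoly ^ (j + 1) * p) = 0) : p = 0 := by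
  induction n using Nat.strong_induction_on generalizing p j with
  | _ n ih =>
    rw [lapPoly_normSqPoly_pow_mul hp] at h
    have h' := (mul_eq_zero.1 h).resolve_left (pow_ne_zero _ normSqPoly_ne_zero)
    set c : ℝ := 2 * (j + 1) * (2 * n + 2 * j + 3) with hc
    have hc0 : c ≠ 0 := by positivity
    have hC : (2 * (j + 1) * (2 * n + 2 * j + 3) : MvPolynomial (Fin 3) ℝ) = C c := by
      have h2 : C (2 : ℝ) = (2 : MvPolynomial (Fin 3) ℝ) := map_ofNat C 2
      have h3 : C (3 : ℝ) = (3 : MvPolynomial (Fin 3) ℝ) := map_ofNat C 3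
      simp [hc, h2, h3]
    rw [hC] at h'
    have hinv : C (c⁻¹) * C c = (1 : MvPolynomial (Fin 3) ℝ) := by
      rw [← C_mul, inv_mul_cancel₀ hc0, C_1]
    have hpq : p = normSqPoly * (C (-c⁻¹) * lapPoly p) := by
      rw [C_neg]
      linear_combination C c⁻¹ * h' - p * hinv
    rcases lt_or_ge n 2 with hn | hn
    · rw [lapPoly_eq_zero_of_lt_two hp hn] at hpq
      simpa using hpq
    -- The quotient `q = -c⁻¹ Δp` satisfies the same hypothesis with one more factor `|x|²`, which
    -- is why `j` is general in the induction.
    · have := ih (n - 2) (by omega) (p := C (-c⁻¹) * lapPoly p)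
        ((isHomogeneous_lapPoly hp).C_mul _) (j + 1) (by
          rw [pow_succ, mul_assoc, ← hpq, lapPoly_normSqPoly_pow_mul hp, h, ])
      rw [this] at hpq
      simpa using hpq

theorem finrank_homogeneousSubmodule (n : ℕ) :
    Module.finrank ℝ (homogeneousSubmodule (Fin 3) ℝ n) = (n + 2).choose 2 := by
  have h : homogeneousSubmodule (Fin 3) ℝ n =
      restrictSupport ℝ ((Finset.finsuppAntidiag Finset.univ n : Finset (Fin 3 →₀ ℕ)) :
        Set (Fin 3 →₀ ℕ)) := by
    rw [homogeneousSubmodule_eq_finsupp_supported]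
    have : {d : Fin 3 →₀ ℕ | d.degree = n} =
      ((Finset.finsuppAntidiag Finset.univ n : Finset (Fin 3 →₀ ℕ)) : Set (Fin 3 →₀ ℕ)) := by
      ext d
      simp [Finsupp.degree_eq_sum]
    rw [this]; rfl
  rw [h, Module.finrank_eq_card_basis (basisRestrictSupport ℝ _), ← Nat.card_eq_fintype_card,
    Nat.card_coe_set_eq, Set.ncard_coe_finset, Finset.card_finsuppAntidiag_nat_eq_choose]
  simp only [Finset.card_univ, Fintype.card_fin]
  rw [show 3 + n - 1 = n + 2 by omega]
  exact Nat.choose_symm_add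

instance (n : ℕ) : FiniteDimensional ℝ (homogeneousSubmodule (Fin 3) ℝ n) :=
  Module.Finite.iff_fg.2 (homogeneousSubmodule_fg (Fin 3) ℝ n)

/-- The Laplacian from homogeneous polynomials of degree `n + 2` to those of degree `n`. -/
def lapHom (n : ℕ) : homogeneousSubmodule (Fin 3) ℝ (n + 2) →ₗ[ℝ]
    homogeneousSubmodule (Fin 3) ℝ n where
  toFun p := ⟨lapPoly p, isHomogeneous_lapPoly p.2⟩
  map_add' p q := Subtype.ext (lapPoly_add _ _)
  map_smul' a p := Subtype.ext (by simp [smul_eq_C_mul, lapPoly_C_mul])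

/-- Multiplication by `x₀² + x₁² + x₂²` on homogeneous polynomials of degree `n`. -/
def mulNormSq (n : ℕ) : homogeneousSubmodule (Fin 3) ℝ n →ₗ[ℝ]
    homogeneousSubmodule (Fin 3) ℝ (n + 2) where
  toFun p := ⟨normSqPoly * p, by
    rw [add_comm]; exact isHomogeneous_normSqPoly.mul p.2⟩
  map_add' p q := Subtype.ext (by simp [mul_add])
  map_smul' a p := Subtype.ext (by simp)

/-- An injective endomorphism of a finite-dimensional space is onto. Both the surjectivity of the
Laplacian and the splitting off of a harmonic part come from this composite. -/
theorem surjective_lapHom_comp_mulNormSq (n : ℕ) :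
    Function.Surjective (lapHom n ∘ₗ mulNormSq n) := by
  apply LinearMap.surjective_of_injective
  rw [← LinearMap.ker_eq_bot, LinearMap.ker_eq_bot']
  intro p hp
  have := congrArg Subtype.val hp
  exact Subtype.ext (eq_zero_of_lapPoly_normSqPoly_pow_mul p.2 0 (by simpa [lapHom, mulNormSq]))

/-- The space of solid harmonics of degree `n`. -/
def solidHarmonic (n : ℕ) : Submodule ℝ (MvPolynomial (Fin 3) ℝ) where
  carrier := {p | p.IsHomogeneous n ∧ lapPoly p = 0}
  add_mem' hp hq := ⟨hp.1.add hq.1, by rw [lapPoly_add, hp.2, hq.2, add_zero]⟩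
  zero_mem' := ⟨isHomogeneous_zero _ _ _, by simp [lapPoly]⟩
  smul_mem' a p hp := ⟨by rw [smul_eq_C_mul]; exact hp.1.C_mul _, by
    rw [smul_eq_C_mul, lapPoly_C_mul, hp.2, mul_zero]⟩

theorem exists_solidHarmonic_add_normSqPoly_mul {n : ℕ} {p : MvPolynomial (Fin 3) ℝ}
    (hp : p.IsHomogeneous (n + 2)) :
    ∃ h ∈ solidHarmonic (n + 2), ∃ q : MvPolynomial (Fin 3) ℝ,
      q.IsHomogeneous n ∧ p = h + normSqPoly * q := by
  obtain ⟨q, hq⟩ := surjective_lapHom_comp_mulNormSq n (lapHom n ⟨p, hp⟩)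
  have hq' : lapPoly (normSqPoly * q) = lapPoly p := congrArg Subtype.val hq
  refine ⟨p - normSqPoly * q, ⟨hp.sub (mulNormSq n q).2, ?_⟩, q, q.2, by ring⟩
  have := lapPoly_add (p - normSqPoly * q) (normSqPoly * q)
  rw [sub_add_cancel, hq'] at this
  linear_combination -this

/-- Rank–nullity for the surjective Laplacian: for `n ≥ 2` the dimension is `C(n+2, 2) - C(n, 2)`.
Because of this count, an orthonormal system with `2n+1` members in each degree is automatically
complete. -/
theorem finrank_solidHarmonic (n : ℕ) : Module.finrank ℝ (solidHarmonic n) = 2 * n + 1 := by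
  rcases lt_or_ge n 2 with hn | hn
  · have : solidHarmonic n = homogeneousSubmodule (Fin 3) ℝ n :=
      le_antisymm (fun p hp => hp.1) fun p hp => ⟨hp, lapPoly_eq_zero_of_lt_two hp hn⟩
    rw [this, finrank_homogeneousSubmodule]
    interval_cases n <;> rfl
  · obtain ⟨m, rfl⟩ := Nat.exists_eq_add_of_le' hn
    have hs : Function.Surjective (lapHom m) :=
      Function.Surjective.of_comp (surjective_lapHom_comp_mulNormSq m)
    have hr := (lapHom m).finrank_range_add_finrank_ker
    rw [LinearMap.range_eq_top.2 hs, finrank_top, finrank_homogeneousSubmodule,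
      finrank_homogeneousSubmodule] at hr
    have hk : Module.finrank ℝ (LinearMap.ker (lapHom m)) =
        Module.finrank ℝ (solidHarmonic (m + 2)) := by
      have : solidHarmonic (m + 2) =
          (LinearMap.ker (lapHom m)).map (homogeneousSubmodule (Fin 3) ℝ (m + 2)).subtype := by
        ext p
        constructor
        · rintro ⟨h1, h2⟩
          exact ⟨⟨p, h1⟩, Subtype.ext h2, rfl⟩
        · rintro ⟨q, hq, rfl⟩
          exact ⟨q.2, congrArg Subtype.val hq⟩
      rw [this, Submodule.finrank_map_subtype_eq]
    rw [← hk]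
    have e1 : (m + 4).choose 2 = (m + 3).choose 1 + (m + 3).choose 2 := Nat.choose_succ_succ _ _
    have e2 : (m + 3).choose 2 = (m + 2).choose 1 + (m + 2).choose 2 := Nat.choose_succ_succ _ _
    rw [Nat.choose_one_right] at e1 e2
    rw [show m + 2 + 2 = m + 4 by ring] at hr
    omega

instance (n : ℕ) : FiniteDimensional ℝ (solidHarmonic n) :=
  FiniteDimensional.of_finrank_pos (by rw [finrank_solidHarmonic]; omega)

end

end

section
/-! ### Polynomial functions and the vector spherical harmonics on the sphere -/

/-- The complex-valued function defined by a real polynomial. -/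
def evC (p : MvPolynomial (Fin 3) ℝ) (x : R3) : ℂ :=
  ((MvPolynomial.eval (fun i => x i) p : ℝ) : ℂ)

/-- The vector field with polynomial components. -/
def evV (P : Fin 3 → MvPolynomial (Fin 3) ℝ) (x : R3) : C3 :=
  WithLp.toLp 2 fun i => evC (P i) x

@[simp] theorem evV_apply (P : Fin 3 → MvPolynomial (Fin 3) ℝ) (x : R3) (i : Fin 3) :
    evV P x i = evC (P i) x := rfl

@[simp] theorem evC_add (p q : MvPolynomial (Fin 3) ℝ) (x : R3) :
    evC (p + q) x = evC p x + evC q x := by simp [evC]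

@[simp] theorem evC_sub (p q : MvPolynomial (Fin 3) ℝ) (x : R3) :
    evC (p - q) x = evC p x - evC q x := by simp [evC]

@[simp] theorem evC_mul (p q : MvPolynomial (Fin 3) ℝ) (x : R3) :
    evC (p * q) x = evC p x * evC q x := by simp [evC]

@[simp] theorem evC_neg (p : MvPolynomial (Fin 3) ℝ) (x : R3) : evC (-p) x = -evC p x := by
  simp [evC]

@[simp] theorem evC_C (a : ℝ) (x : R3) : evC (MvPolynomial.C a) x = a := by simp [evC]

@[simp] theorem evC_X (i : Fin 3) (x : R3) : evC (MvPolynomial.X i) x = x i := by simp [evC]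

@[simp] theorem evC_natCast (n : ℕ) (x : R3) : evC (n : MvPolynomial (Fin 3) ℝ) x = n := by
  simp [evC]

@[simp] theorem evC_one (x : R3) : evC 1 x = 1 := by simp [evC]

@[simp] theorem evC_zero (x : R3) : evC 0 x = 0 := by simp [evC]

theorem evC_sum {ι : Type*} (s : Finset ι) (P : ι → MvPolynomial (Fin 3) ℝ) (x : R3) :
    evC (∑ i ∈ s, P i) x = ∑ i ∈ s, evC (P i) x := by simp [evC]

theorem evC_normSqPoly (x : R3) : evC normSqPoly x = (‖x‖ : ℂ) ^ 2 := by
  rw [← Complex.ofReal_pow, EuclideanSpace.norm_sq_eq]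
  simp [normSqPoly, evC, Fin.sum_univ_three]

theorem evC_normSqPoly_sphere (s : Metric.sphere (0 : R3) 1) : evC normSqPoly s.1 = 1 := by
  simp [evC_normSqPoly]

theorem star_evC (p : MvPolynomial (Fin 3) ℝ) (x : R3) : (starRingEnd ℂ) (evC p x) = evC p x :=
  Complex.conj_ofReal _

theorem norm_sphere (s : Metric.sphere (0 : R3) 1) : ‖s.1‖ = 1 := by simp

theorem sum_sq_sphere (s : Metric.sphere (0 : R3) 1) :
    (s.1 0 : ℂ) ^ 2 + (s.1 1 : ℂ) ^ 2 + (s.1 2 : ℂ) ^ 2 = 1 := by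
  have := evC_normSqPoly_sphere s
  simpa [normSqPoly, pow_two] using this

theorem hasFDerivAt_evC (p : MvPolynomial (Fin 3) ℝ) (x : R3) :
    ∃ f' : R3 →L[ℝ] ℂ, HasFDerivAt (evC p) f' x ∧
      ∀ i, f' (EuclideanSpace.single i 1) = evC (MvPolynomial.pderiv i p) x := by
  induction p using MvPolynomial.induction_on with
  | C a =>
    refine ⟨0, ?_, fun i => by simp⟩
    have : evC (MvPolynomial.C a) = fun _ => (a : ℂ) := by ext; simp
    rw [this]; exact hasFDerivAt_const _ _
  | add p q hp hq =>
    obtain ⟨f, hf, hf'⟩ := hp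
    obtain ⟨g, hg, hg'⟩ := hq
    refine ⟨f + g, ?_, fun i => by simp [hf', hg']⟩
    have : evC (p + q) = fun x => evC p x + evC q x := by ext; simp
    rw [this]; exact hf.add hg
  | mul_X p k hp =>
    obtain ⟨f, hf, hf'⟩ := hp
    have hX : HasFDerivAt (fun x : R3 => ((x k : ℝ) : ℂ))
        (Complex.ofRealCLM ∘L (EuclideanSpace.proj k : R3 →L[ℝ] ℝ)) x :=
      (Complex.ofRealCLM ∘L (EuclideanSpace.proj k : R3 →L[ℝ] ℝ)).hasFDerivAt
    refine ⟨evC p x • (Complex.ofRealCLM ∘L (EuclideanSpace.proj k : R3 →L[ℝ] ℝ)) +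
      ((x k : ℝ) : ℂ) • f, ?_, fun i => ?_⟩
    · have : evC (p * MvPolynomial.X k) = fun x => evC p x * ((x k : ℝ) : ℂ) := by ext; simp
      rw [this]; exact hf.mul hX
    · simp only [add_apply, smul_apply, hf',
        smul_eq_mul, Derivation.leibniz, MvPolynomial.pderiv_X, evC_add, evC_mul, evC_X,
        ContinuousLinearMap.comp_apply, Complex.ofRealCLM_apply]
      rcases eq_or_ne k i with rfl | h
      · simp
      · simp [h]

theorem differentiable_evC (p : MvPolynomial (Fin 3) ℝ) : Differentiable ℝ (evC p) := fun x =>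
  let ⟨_, h, _⟩ := hasFDerivAt_evC p x
  h.differentiableAt

@[simp] theorem pd_evC (i : Fin 3) (p : MvPolynomial (Fin 3) ℝ) (x : R3) :
    pd i (evC p) x = evC (MvPolynomial.pderiv i p) x := by
  obtain ⟨f, h, h'⟩ := hasFDerivAt_evC p x
  rw [pd, h.fderiv, h']

theorem contDiff_evC (p : MvPolynomial (Fin 3) ℝ) {k : ℕ∞ω} : ContDiff ℝ k (evC p) := by
  induction p using MvPolynomial.induction_on with
  | C a =>
    have : evC (MvPolynomial.C a) = fun _ => (a : ℂ) := by ext; simp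
    rw [this]; exact contDiff_const
  | add p q hp hq =>
    have : evC (p + q) = fun x => evC p x + evC q x := by ext; simp
    rw [this]; exact hp.add hq
  | mul_X p k hp =>
    have : evC (p * MvPolynomial.X k) = fun x => evC p x * ((x k : ℝ) : ℂ) := by ext; simp
    rw [this]
    exact hp.mul (Complex.ofRealCLM ∘L (EuclideanSpace.proj k : R3 →L[ℝ] ℝ)).contDiff

@[fun_prop] theorem continuous_evC (p : MvPolynomial (Fin 3) ℝ) : Continuous (evC p) :=
  (contDiff_evC p (k := 0)).continuous

@[fun_prop] theorem continuous_evV (P : Fin 3 → MvPolynomial (Fin 3) ℝ) : Continuous (evV P) :=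
  (PiLp.continuous_toLp 2 _).comp (continuous_pi fun i => continuous_evC (P i))

theorem fderiv_apply_eq_sum (f : R3 → ℂ) (x v : R3) :
    fderiv ℝ f x v = ∑ i, (v i : ℂ) * pd i f x := by
  have hv : v = ∑ i, v i • (EuclideanSpace.single i 1 : R3) := by
    ext j; simp [Finset.sum_apply, Pi.single_apply]
  conv_lhs => rw [hv]
  simp [map_sum, pd]

/-- The generator `x ↦ eᵢ × x` of the rotations about the `i`-th axis. -/
def rotGen (i : Fin 3) : R3 →L[ℝ] R3 :=
  (EuclideanSpace.proj (i + 1) : R3 →L[ℝ] ℝ).smulRight (EuclideanSpace.single (i + 2) (1 : ℝ)) -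
    (EuclideanSpace.proj (i + 2) : R3 →L[ℝ] ℝ).smulRight (EuclideanSpace.single (i + 1) (1 : ℝ))

theorem rotGen_apply (i : Fin 3) (x : R3) : rotGen i x =
    x (i + 1) • EuclideanSpace.single (i + 2) (1 : ℝ) -
      x (i + 2) • EuclideanSpace.single (i + 1) (1 : ℝ) := rfl

theorem inner_rotGen_self (i : Fin 3) (x : R3) : inner ℝ x (rotGen i x) = 0 := by
  rw [rotGen_apply, inner_sub_right, inner_smul_right, inner_smul_right]
  simp [EuclideanSpace.inner_single_right]
  ring

theorem inner_rotGen (i : Fin 3) (x y : R3) :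
    inner ℝ x (rotGen i y) = -inner ℝ (rotGen i x) y := by
  have h := inner_rotGen_self i (x + y)
  rw [map_add, inner_add_left, inner_add_right, inner_add_right, inner_rotGen_self,
    inner_rotGen_self, real_inner_comm y (rotGen i x)] at *
  linarith [real_inner_comm y (rotGen i x)]

theorem xGrad_apply' (f : R3 → ℂ) (x : R3) (i : Fin 3) :
    xGrad f x i = (x (i + 1) : ℂ) * pd (i + 2) f x - (x (i + 2) : ℂ) * pd (i + 1) f x := by
  fin_cases i <;> rfl

theorem xGrad_apply (f : R3 → ℂ) (x : R3) (i : Fin 3) :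
    xGrad f x i = fderiv ℝ f x (rotGen i x) := by
  rw [xGrad_apply', rotGen_apply, map_sub, map_smul, map_smul]
  simp [pd]

@[simp] theorem grad_apply (f : R3 → ℂ) (x : R3) (i : Fin 3) : grad f x i = pd i f x := by
  fin_cases i <;> rfl

@[simp] theorem xGrad_evC (p : MvPolynomial (Fin 3) ℝ) (x : R3) (i : Fin 3) :
    xGrad (evC p) x i = evC (rotPoly i p) x := by
  simp [xGrad_apply', rotPoly]

theorem angular_eq (p : MvPolynomial (Fin 3) ℝ) : angular p = fun x => evC p (‖x‖⁻¹ • x) := by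
  ext x
  simp [angular, evC, div_eq_inv_mul]

theorem contDiffAt_angular (p : MvPolynomial (Fin 3) ℝ) {x : R3} (hx : x ≠ 0) :
    ContDiffAt ℝ ∞ (angular p) x := by
  rw [angular_eq]
  exact (contDiff_evC p).contDiffAt.comp x
    (((contDiffAt_norm ℝ hx).inv (norm_ne_zero_iff.2 hx)).smul contDiffAt_id)

theorem hasFDerivAt_norm_of_ne_zero {x : R3} (hx : x ≠ 0) :
    HasFDerivAt (fun y : R3 => ‖y‖) (‖x‖⁻¹ • innerSL ℝ x) x := by
  have hn : ‖x‖ ≠ 0 := norm_ne_zero_iff.2 hx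
  have h2 := (hasStrictFDerivAt_norm_sq x).hasFDerivAt.sqrt (by positivity)
  simp only [Real.sqrt_sq (norm_nonneg _)] at h2
  have h4 : ‖x‖⁻¹ • innerSL ℝ x = (1 / (2 * ‖x‖)) • 2 • (innerSL ℝ) x := by
    rw [← Nat.cast_smul_eq_nsmul ℝ, smul_smul]
    congr 1
    push_cast
    field_simp
  rw [h4]
  exact h2

theorem hasFDerivAt_unit {x : R3} (hx : x ≠ 0) : ∃ f' : R3 →L[ℝ] R3,
    HasFDerivAt (fun y : R3 => ‖y‖⁻¹ • y) f' x ∧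
      ∀ v, f' v = ‖x‖⁻¹ • (v - inner ℝ (‖x‖⁻¹ • x) v • (‖x‖⁻¹ • x)) := by
  have hn : ‖x‖ ≠ 0 := norm_ne_zero_iff.2 hx
  have h1 := hasFDerivAt_norm_of_ne_zero hx
  have h3 := ((hasDerivAt_inv hn).comp_hasFDerivAt x h1).smul (hasFDerivAt_id x)
  refine ⟨_, h3, fun v => ?_⟩
  simp [inner_smul_left, smul_sub, smul_smul]
  rw [sub_eq_add_neg, ← neg_smul]
  congr 2
  field_simp
  rw [neg_smul]

theorem fderiv_angular (p : MvPolynomial (Fin 3) ℝ) {x : R3} (hx : x ≠ 0) (v : R3) :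
    fderiv ℝ (angular p) x v = fderiv ℝ (evC p) (‖x‖⁻¹ • x)
      (‖x‖⁻¹ • (v - inner ℝ (‖x‖⁻¹ • x) v • (‖x‖⁻¹ • x))) := by
  obtain ⟨f', h, h'⟩ := hasFDerivAt_unit hx
  rw [angular_eq, ← h']
  exact congrArg (· v) ((differentiable_evC p _).hasFDerivAt.comp x h).fderiv

section
open MvPolynomial

/-- The components of `x̂ Y` on the sphere. -/
def vshPoly1 (p : MvPolynomial (Fin 3) ℝ) (i : Fin 3) : MvPolynomial (Fin 3) ℝ := X i * p

/-- The components of the surface gradient of `Y` on the sphere, for `Y` homogeneous of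
degree `n`. -/
def vshPoly2 (n : ℕ) (p : MvPolynomial (Fin 3) ℝ) (i : Fin 3) : MvPolynomial (Fin 3) ℝ :=
  pderiv i p - (n : MvPolynomial (Fin 3) ℝ) * (X i * p)

/-- The components of `x × ∇ Y` on the sphere. -/
def vshPoly3 (p : MvPolynomial (Fin 3) ℝ) (i : Fin 3) : MvPolynomial (Fin 3) ℝ := rotPoly i p

theorem angular_smul {r : ℝ} (hr : 0 < r) (s : Metric.sphere (0 : R3) 1)
    (p : MvPolynomial (Fin 3) ℝ) : angular p (r • s.1) = evC p s.1 := by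
  simp [angular_eq, norm_smul, abs_of_pos hr, smul_smul, inv_mul_cancel₀ hr.ne']

theorem vsh1_smul {r : ℝ} (hr : 0 < r) (s : Metric.sphere (0 : R3) 1)
    (p : MvPolynomial (Fin 3) ℝ) : vsh1 p (r • s.1) = evV (vshPoly1 p) s.1 := by
  ext i
  have : ∀ i, r * s.1 i / ‖r • s.1‖ = s.1 i := fun i => by
    rw [norm_smul, Real.norm_of_nonneg hr.le, norm_sphere, mul_one, mul_div_cancel_left₀ _ hr.ne']
  simp only [vsh1, angular_smul hr, evV_apply, vshPoly1, evC_mul, evC_X, PiLp.smul_apply,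
    smul_eq_mul]
  fin_cases i <;> simp only [this] <;> simp [mul_comm]

/-- Differentiating through `x / ‖x‖` keeps the tangential part of `v`, divided by `r`. Euler's
identity evaluates the removed normal derivative `s · ∇p` as `n p`, which is the origin of the term
`n xᵢ p` in `vshPoly2`. -/
theorem fderiv_angular_smul {r : ℝ} (hr : 0 < r) (s : Metric.sphere (0 : R3) 1)
    {p : MvPolynomial (Fin 3) ℝ} {n : ℕ} (hp : p.IsHomogeneous n) (v : R3) :
    fderiv ℝ (angular p) (r • s.1) v =
      (r : ℂ)⁻¹ * ∑ i, (v i : ℂ) * evC (vshPoly2 n p i) s.1 := by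
  have hx : r • s.1 ≠ 0 := smul_ne_zero hr.ne' (by intro h; have := norm_sphere s; simp [h] at this)
  have hu : ‖r • s.1‖⁻¹ • (r • s.1) = s.1 := by
    rw [norm_smul, Real.norm_of_nonneg hr.le, norm_sphere, mul_one, smul_smul,
      inv_mul_cancel₀ hr.ne', one_smul]
  have he : (s.1 0 : ℂ) * evC (pderiv 0 p) s.1 + s.1 1 * evC (pderiv 1 p) s.1 +
      s.1 2 * evC (pderiv 2 p) s.1 = n * evC p s.1 := by
    simpa using congrArg (evC · s.1) (euler_three hp)
  rw [fderiv_angular p hx, hu, map_smul, map_sub, map_smul, fderiv_apply_eq_sum,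
    fderiv_apply_eq_sum, norm_smul, Real.norm_of_nonneg hr.le, norm_sphere, mul_one]
  simp only [Fin.sum_univ_three, pd_evC, vshPoly2, evC_sub, evC_mul, evC_natCast, evC_X, he,
    Complex.real_smul, PiLp.inner_apply, RCLike.inner_apply, conj_trivial]
  push_cast
  ring

theorem vsh2_smul {r : ℝ} (hr : 0 < r) (s : Metric.sphere (0 : R3) 1)
    {p : MvPolynomial (Fin 3) ℝ} {n : ℕ} (hp : p.IsHomogeneous n) :
    vsh2 p (r • s.1) = evV (vshPoly2 n p) s.1 := by
  ext i
  have hr' : (r : ℂ) ≠ 0 := by exact_mod_cast hr.ne'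
  simp only [vsh2, PiLp.smul_apply, grad_apply, pd, fderiv_angular_smul hr s hp, evV_apply,
    norm_smul, Real.norm_of_nonneg hr.le, norm_sphere, mul_one, smul_eq_mul]
  rw [Finset.sum_eq_single i]
  · simp [hr']
  · intro j _ hj; simp [hj]
  · simp

theorem vsh3_smul {r : ℝ} (hr : 0 < r) (s : Metric.sphere (0 : R3) 1)
    {p : MvPolynomial (Fin 3) ℝ} {n : ℕ} (hp : p.IsHomogeneous n) :
    vsh3 p (r • s.1) = evV (vshPoly3 p) s.1 := by
  ext i
  have hr' : (r : ℂ) ≠ 0 := by exact_mod_cast hr.ne'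
  simp only [vsh3, xGrad_apply', pd, fderiv_angular_smul hr s hp, evV_apply, vshPoly3, rotPoly]
  rw [Finset.sum_eq_single (i + 2), Finset.sum_eq_single (i + 1)]
  -- The correction `n xᵢ p` is radial and cancels in the cross product with `x`.
  · simp [vshPoly2]; field_simp; ring
  · intro j _ hj; simp [hj]
  · simp
  · intro j _ hj; simp [hj]
  · simp

end

end

section
/-! ### Polar coordinates -/

section
open scoped ENNReal NNReal

instance : IsFiniteMeasure sphereMeasure :=
  inferInstanceAs (IsFiniteMeasure (volume : Measure R3).toSphere)

instance : sphereMeasure.IsOpenPosMeasure :=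
  inferInstanceAs ((volume : Measure R3).toSphere.IsOpenPosMeasure)

/-- The map `(r, s) ↦ r s`. -/
def polarMap (q : ℝ × Metric.sphere (0 : R3) 1) : R3 := q.1 • q.2.1

theorem continuous_polarMap : Continuous polarMap := by
  unfold polarMap; fun_prop

/-- The origin is a null set, and its complement is measure-preservingly the product of the sphere
and the half line with density `r²`. -/
theorem lintegral_polar {f : R3 → ℝ≥0∞} (hf : Measurable f) :
    ∫⁻ x, f x = ∫⁻ r in Set.Ioi (0 : ℝ), ENNReal.ofReal (r ^ 2) *
      ∫⁻ s, f (r • s.1) ∂sphereMeasure := by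
  have h0 : ∫⁻ x, f x = ∫⁻ x : ↥(({(0 : R3)} : Set R3)ᶜ), f x.1 ∂(volume.comap Subtype.val) := by
    rw [lintegral_subtype_comap (measurableSet_singleton _).compl, restrict_compl_singleton]
  have hmp := (volume : Measure R3).measurePreserving_homeomorphUnitSphereProd
  have hd : Module.finrank ℝ R3 - 1 = 2 := by simp
  rw [hd] at hmp
  have hg : Measurable fun q : Metric.sphere (0 : R3) 1 × Set.Ioi (0 : ℝ) => f (q.2.1 • q.1.1) :=
    hf.comp (by fun_prop)
  have h1 : ∫⁻ x : ↥(({(0 : R3)} : Set R3)ᶜ), f x.1 ∂(volume.comap Subtype.val) =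
      ∫⁻ q : Metric.sphere (0 : R3) 1 × Set.Ioi (0 : ℝ), f (q.2.1 • q.1.1)
        ∂(sphereMeasure.prod (Measure.volumeIoiPow 2)) := by
    rw [sphereMeasure, ← hmp.lintegral_comp hg]
    refine lintegral_congr fun x => ?_
    congr 1
    have : x.1 ≠ 0 := x.2
    simp [this]
  rw [h0, h1, lintegral_prod_symm _ hg.aemeasurable, Measure.volumeIoiPow,
    lintegral_withDensity_eq_lintegral_mul₀ (by fun_prop)
      hg.lintegral_prod_left'.aemeasurable,
    ← lintegral_subtype_comap measurableSet_Ioi]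
  rfl

/-- The measure `r² w(r) dr` on `(0, ∞)`. -/
def radialMeasure (w : ℝ → ℝ≥0∞) : Measure ℝ :=
  (volume.restrict (Set.Ioi 0)).withDensity fun r => ENNReal.ofReal (r ^ 2) * w r

/-- `ν` is a rotation invariant measure with radial part `ρ`. -/
structure IsPolar (ν : Measure R3) (ρ : Measure ℝ) : Prop where
  mp : MeasurePreserving polarMap (ρ.prod sphereMeasure) ν
  pos : ∀ᵐ r ∂ρ, 0 < r
  sfinite : SFinite ρ

/-- The common source of the three instances: Lebesgue measure on `ℝ³`, its restriction to closed
balls (used for the local, distributional statements), and the weighted measure of the transform. -/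
theorem isPolar_withDensity {w : ℝ → ℝ≥0∞} (hw : Measurable w) :
    IsPolar (volume.withDensity fun x => w ‖x‖) (radialMeasure w) where
  mp := by
    refine ⟨continuous_polarMap.measurable, ?_⟩
    ext A hA
    have hA' := continuous_polarMap.measurable hA
    rw [Measure.map_apply continuous_polarMap.measurable hA, withDensity_apply _ hA,
      ← lintegral_indicator hA, lintegral_polar (by fun_prop (disch := assumption)),
      Measure.prod_apply hA', radialMeasure,
      lintegral_withDensity_eq_lintegral_mul₀ (by fun_prop)
        (measurable_measure_prodMk_left hA').aemeasurable]
    refine setLIntegral_congr_fun measurableSet_Ioi fun r (hr : 0 < r) => ?_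
    simp only [Pi.mul_apply, mul_assoc]
    congr 1
    rw [← lintegral_indicator_one (measurable_prodMk_left hA'), ← lintegral_const_mul _
      (measurable_one.indicator (measurable_prodMk_left hA'))]
    refine lintegral_congr fun s => ?_
    by_cases h : r • s.1 ∈ A
    · have h' : s ∈ Prod.mk r ⁻¹' (polarMap ⁻¹' A) := h
      simp [h, h', norm_smul, abs_of_pos hr]
    · have h' : s ∉ Prod.mk r ⁻¹' (polarMap ⁻¹' A) := h
      simp [h, h']
  pos := by
    refine (withDensity_absolutelyContinuous _ _).ae_le ?_
    exact ae_restrict_mem measurableSet_Ioi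
  sfinite := by unfold radialMeasure; infer_instance

/-- The radial part of Lebesgue measure on `ℝ³`. -/
theorem isPolar_volume : IsPolar volume (radialMeasure 1) := by
  have := isPolar_withDensity (w := 1) measurable_one
  simpa using this

/-- The radial density of Lebesgue measure on the closed ball of radius `R`. -/
def ballWeight (R : ℝ) : ℝ → ℝ≥0∞ := (Set.Iic R).indicator 1

theorem isPolar_restrict_closedBall (R : ℝ) :
    IsPolar (volume.restrict (Metric.closedBall 0 R)) (radialMeasure (ballWeight R)) := by
  have := isPolar_withDensity (w := ballWeight R) (measurable_one.indicator measurableSet_Iic)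
  rw [← withDensity_indicator_one Metric.isClosed_closedBall.measurableSet]
  convert this using 3 with x
  by_cases hx : ‖x‖ ≤ R <;> simp [ballWeight, hx]

/-- The radial density of the weighted measure on the unit ball. -/
def jacobiWeight (α : ℝ) : ℝ → ℝ≥0∞ :=
  (Set.Iic 1).indicator fun r => ENNReal.ofReal ((1 - r ^ 2) ^ α)

theorem isPolar_ballMeasure (α : ℝ) :
    IsPolar (ballMeasure α) (radialMeasure (jacobiWeight α)) := by
  have := isPolar_withDensity (w := jacobiWeight α)
    (Measurable.indicator (by fun_prop) measurableSet_Iic)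
  rw [ballMeasure, unitBall, ← withDensity_indicator (Metric.isClosed_closedBall.measurableSet)]
  convert this using 3 with x
  by_cases hx : ‖x‖ ≤ 1 <;> simp [jacobiWeight, hx]

variable {ν : Measure R3} {ρ : Measure ℝ}

theorem IsPolar.ae (h : IsPolar ν ρ) {P : R3 → Prop} (hP : ∀ᵐ x ∂ν, P x) :
    ∀ᵐ r ∂ρ, ∀ᵐ s ∂sphereMeasure, P (r • s.1) := by
  have := h.sfinite
  exact Measure.ae_ae_of_ae_prod (h.mp.quasiMeasurePreserving.ae hP)

theorem IsPolar.ae_ne_zero (h : IsPolar ν ρ) : ∀ᵐ x ∂ν, x ≠ 0 := by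
  have := h.sfinite
  rw [← h.mp.map_eq, ae_map_iff (p := fun x => x ≠ 0) continuous_polarMap.aemeasurable
    (measurableSet_singleton (0 : R3)).compl]
  filter_upwards [Measure.quasiMeasurePreserving_fst.ae h.pos] with q hq h0
  have := congrArg norm h0
  simp [polarMap, norm_smul, hq.ne'] at this

theorem IsPolar.integral (h : IsPolar ν ρ) {V : Type*} [NormedAddCommGroup V] [NormedSpace ℝ V]
    {f : R3 → V} (hf : Integrable f ν) :
    ∫ x, f x ∂ν = ∫ r, ∫ s, f (r • s.1) ∂sphereMeasure ∂ρ := by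
  have := h.sfinite
  have hf' : Integrable (f ∘ polarMap) (ρ.prod sphereMeasure) := h.mp.integrable_comp_of_integrable hf
  rw [← h.mp.map_eq, integral_map continuous_polarMap.aemeasurable
    (by rw [h.mp.map_eq]; exact hf.1)]
  exact integral_prod _ hf'

theorem IsPolar.lintegral (h : IsPolar ν ρ) {f : R3 → ℝ≥0∞} (hf : AEMeasurable f ν) :
    ∫⁻ x, f x ∂ν = ∫⁻ r, ∫⁻ s, f (r • s.1) ∂sphereMeasure ∂ρ := by
  have := h.sfinite
  have hf' : AEMeasurable (f ∘ polarMap) (ρ.prod sphereMeasure) :=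
    hf.comp_quasiMeasurePreserving h.mp.quasiMeasurePreserving
  rw [← h.mp.map_eq, lintegral_map' (by rwa [h.mp.map_eq]) continuous_polarMap.aemeasurable]
  exact lintegral_prod _ hf'

theorem IsPolar.quasiMeasurePreserving_norm (h : IsPolar ν ρ) :
    Measure.QuasiMeasurePreserving (fun x : R3 => ‖x‖) ν ρ := by
  refine ⟨continuous_norm.measurable, Measure.AbsolutelyContinuous.mk fun A hA h0 => ?_⟩
  have := h.sfinite
  rw [Measure.map_apply continuous_norm.measurable hA, ← h.mp.map_eq,
    Measure.map_apply continuous_polarMap.measurable (continuous_norm.measurable hA)]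
  have h1 : ∀ᵐ q ∂ρ.prod sphereMeasure, q.1 ∉ A :=
    Measure.quasiMeasurePreserving_fst.ae (measure_eq_zero_iff_ae_notMem.1 h0)
  rw [measure_eq_zero_iff_ae_notMem]
  filter_upwards [h1, Measure.quasiMeasurePreserving_fst.ae h.pos] with q hq hq0
  simpa [polarMap, norm_smul, abs_of_pos hq0] using hq

theorem IsPolar.ae_norm (h : IsPolar ν ρ) {P : ℝ → Prop} (hP : ∀ᵐ r ∂ρ, P r) :
    ∀ᵐ x ∂ν, P ‖x‖ :=
  h.quasiMeasurePreserving_norm.ae hP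

theorem norm_polarMap {q : ℝ × Metric.sphere (0 : R3) 1} (hq : 0 < q.1) : ‖polarMap q‖ = q.1 := by
  simp [polarMap, norm_smul, abs_of_pos hq]

theorem IsPolar.memLp_comp_norm (h : IsPolar ν ρ) {V : Type*} [NormedAddCommGroup V]
    {e : ℝ → V} {p : ℝ≥0∞} (he : MemLp e p ρ) : MemLp (fun x : R3 => e ‖x‖) p ν := by
  have := h.sfinite
  have hm : AEStronglyMeasurable (fun x : R3 => e ‖x‖) ν :=
    he.1.comp_quasiMeasurePreserving h.quasiMeasurePreserving_norm
  have h1 : MemLp (fun q : ℝ × Metric.sphere (0 : R3) 1 => e q.1) p (ρ.prod sphereMeasure) :=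
    he.comp_fst _
  rw [← h.mp.map_eq] at hm ⊢
  rw [memLp_map_measure_iff hm continuous_polarMap.aemeasurable]
  refine (memLp_congr_ae ?_).1 h1
  filter_upwards [Measure.quasiMeasurePreserving_fst.ae h.pos] with q hq
  simp [norm_polarMap hq]

end

end

section
/-! ### Integration by parts on the sphere -/

theorem contDiff_comp_norm {V : Type*} [NormedAddCommGroup V] [NormedSpace ℝ V] {g : ℝ → V}
    {k : ℕ∞ω} (hg : ContDiff ℝ k g) (h0 : ∀ᶠ r in 𝓝 0, g r = g 0) :
    ContDiff ℝ k fun x : R3 => g ‖x‖ := by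
  rw [contDiff_iff_contDiffAt]
  intro x
  rcases eq_or_ne x 0 with rfl | hx
  · have : (fun x : R3 => g ‖x‖) =ᶠ[𝓝 0] fun _ => g 0 := by
      have h : Tendsto (fun x : R3 => ‖x‖) (𝓝 0) (𝓝 0) := by simpa using (continuous_norm (E := R3)).tendsto 0
      exact h.eventually h0
    exact contDiffAt_const.congr_of_eventuallyEq this
  · exact hg.contDiffAt.comp x (contDiffAt_norm ℝ hx)

theorem hasCompactSupport_comp_norm {V : Type*} [Zero V] {g : ℝ → V}
    (hg : HasCompactSupport g) : HasCompactSupport fun x : R3 => g ‖x‖ := by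
  obtain ⟨R, hR⟩ := hg.isCompact.isBounded.subset_closedBall 0
  refine HasCompactSupport.intro (isCompact_closedBall (0 : R3) R) fun x hx => ?_
  by_contra h
  have := hR (subset_tsupport g h)
  simp at this hx
  linarith

theorem eventually_nhds_zero_of_tsupport_subset_Ioi {V : Type*} [Zero V] {g : ℝ → V}
    (hg : tsupport g ⊆ Set.Ioi 0) : ∀ᶠ r in 𝓝 0, g r = 0 := by
  have h : (0 : ℝ) ∈ (tsupport g)ᶜ := fun h => lt_irrefl (0 : ℝ) (hg h)
  filter_upwards [(isClosed_tsupport g).isOpen_compl.mem_nhds h] with r hr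
  exact image_eq_zero_of_notMem_tsupport hr

/-- Away from the origin the gradient is parallel to `x` and `eᵢ × x` is orthogonal to `x`; at the
origin the direction `eᵢ × x` is itself zero. -/
theorem fderiv_comp_norm_rotGen {g : ℝ → ℂ} (hg : Differentiable ℝ g) (i : Fin 3) (x : R3) :
    fderiv ℝ (fun x : R3 => g ‖x‖) x (rotGen i x) = 0 := by
  rcases eq_or_ne x 0 with rfl | hx
  · simp
  · have h := ((hg ‖x‖).hasFDerivAt.comp x (hasFDerivAt_norm_of_ne_zero hx)).fderiv
    have h' : fderiv ℝ (fun x : R3 => g ‖x‖) x = _ := h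
    rw [h']
    simp [inner_rotGen_self]

theorem continuous_xGrad {f : R3 → ℂ} (hf : ContDiff ℝ 1 f) (i : Fin 3) :
    Continuous fun x => xGrad f x i := by
  simp only [xGrad_apply]
  exact (hf.continuous_fderiv (by norm_num)).clm_apply (rotGen i).continuous

theorem continuous_pd {f : R3 → ℂ} (hf : ContDiff ℝ 1 f) (i : Fin 3) :
    Continuous (pd i f) :=
  (hf.continuous_fderiv (by norm_num)).clm_apply continuous_const

theorem xGrad_mul {f g : R3 → ℂ} (hf : Differentiable ℝ f) (hg : Differentiable ℝ g) (x : R3)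
    (i : Fin 3) :
    xGrad (fun y => f y * g y) x i = xGrad f x i * g x + f x * xGrad g x i := by
  simp only [xGrad_apply]
  rw [fderiv_fun_mul (hf x) (hg x)]
  simp [mul_comm]
  ring

theorem integral_pd_mul {f g : R3 → ℂ} (hf : ContDiff ℝ 1 f) (hg : ContDiff ℝ 1 g)
    (hc : HasCompactSupport g) (i : Fin 3) :
    ∫ x, f x * pd i g x = -∫ x, pd i f x * g x := by
  have hc' : HasCompactSupport (pd i g) := hc.fderiv_apply ℝ _
  refine integral_mul_fderiv_eq_neg_fderiv_mul_of_integrable ?_ ?_ ?_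
    (fun x _ => hf.differentiable (by norm_num) x) (fun x _ => hg.differentiable (by norm_num) x)
  · exact ((continuous_pd hf i).mul hg.continuous).integrable_of_hasCompactSupport hc.mul_left
  · exact (hf.continuous.mul (continuous_pd hg i)).integrable_of_hasCompactSupport hc'.mul_left
  · exact (hf.continuous.mul hg.continuous).integrable_of_hasCompactSupport hc.mul_left

/-- Each term `x_a ∂_b f` has `a ≠ b`, so the derivative of the coefficient that appears in the
integration by parts is zero. -/
theorem integral_xGrad_eq_zero {f : R3 → ℂ} (hf : ContDiff ℝ 1 f) (hc : HasCompactSupport f)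
    (i : Fin 3) : ∫ x, xGrad f x i = 0 := by
  have hX : ∀ a b : Fin 3, a ≠ b → ∫ x : R3, (x a : ℂ) * pd b f x = 0 := by
    intro a b hab
    have h := integral_pd_mul (contDiff_evC (MvPolynomial.X a)) hf hc b
    simp only [pd_evC, evC_X, MvPolynomial.pderiv_X_of_ne hab, evC_zero, zero_mul, integral_zero,
      neg_zero] at h
    exact h
  have hint : ∀ a b : Fin 3, Integrable fun x : R3 => (x a : ℂ) * pd b f x := fun a b => by
    have hc' : HasCompactSupport (pd b f) := hc.fderiv_apply ℝ _
    refine Continuous.integrable_of_hasCompactSupport ?_ hc'.mul_left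
    exact Continuous.mul (by fun_prop) (continuous_pd hf b)
  simp only [xGrad_apply']
  rw [integral_sub (hint _ _) (hint _ _), hX _ _ (by fin_cases i <;> decide),
    hX _ _ (by fin_cases i <;> decide), sub_zero]

theorem continuous_integrable_sphere {V : Type*} [NormedAddCommGroup V]
    {f : Metric.sphere (0 : R3) 1 → V} (hf : Continuous f) : Integrable f sphereMeasure :=
  hf.integrable_of_hasCompactSupport (HasCompactSupport.of_compactSpace f)

theorem continuous_sphere_integral {V : Type*} [NormedAddCommGroup V] [NormedSpace ℝ V]
    {f : ℝ → Metric.sphere (0 : R3) 1 → V} (hf : Continuous (Function.uncurry f)) :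
    Continuous fun r => ∫ s, f r s ∂sphereMeasure := by
  have := continuous_parametric_integral_of_continuous (μ := sphereMeasure) hf isCompact_univ
  simpa only [Measure.restrict_univ] using this

/-- Obtained from the identity on `ℝ³`, without calculus on the sphere. A radial cutoff passes
through `x × ∇`, so the spherical integrals of `x × ∇ f`, weighted by `r²`, integrate to zero
against every test function on `(0, ∞)`. They vanish almost everywhere, and by continuity at `r =
1`. -/
theorem sphere_integral_xGrad {f : R3 → ℂ} (hf : ContDiff ℝ 1 f) (i : Fin 3) :
    ∫ s, xGrad f s.1 i ∂sphereMeasure = 0 := by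
  set m : ℝ → ℂ := fun r => ∫ s, xGrad f (r • s.1) i ∂sphereMeasure with hm
  have hmc : Continuous m := continuous_sphere_integral
    ((continuous_xGrad hf i).comp (f := fun q : ℝ × Metric.sphere (0 : R3) 1 => q.1 • q.2.1)
      (by fun_prop))
  have hmc' : Continuous fun r : ℝ => ((r ^ 2 : ℝ) : ℂ) * m r :=
    Continuous.mul (by fun_prop) hmc
  have key : ∀ᵐ r : ℝ, r ∈ Set.Ioi (0 : ℝ) → ((r ^ 2 : ℝ) : ℂ) * m r = 0 := by
    refine isOpen_Ioi.ae_eq_zero_of_integral_contDiff_smul_eq_zero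
      (hmc'.locallyIntegrable.locallyIntegrableOn _) fun g hg hc hs => ?_
    have hgC : ContDiff ℝ ∞ fun r => (g r : ℂ) := Complex.ofRealCLM.contDiff.comp hg
    have hg0 : ∀ᶠ r in 𝓝 0, g r = 0 := eventually_nhds_zero_of_tsupport_subset_Ioi hs
    have hn : ContDiff ℝ 1 fun x : R3 => (g ‖x‖ : ℂ) :=
      (contDiff_comp_norm hgC (by
        filter_upwards [hg0] with r hr; rw [hr, hg0.self_of_nhds])).of_le (by simp)
    have hnc : HasCompactSupport fun x : R3 => (g ‖x‖ : ℂ) :=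
      (hasCompactSupport_comp_norm hc).comp_left (g := fun r : ℝ => (r : ℂ)) Complex.ofReal_zero
    have h0 := integral_xGrad_eq_zero (hn.mul hf) hnc.mul_right i
    simp only [xGrad_mul (hn.differentiable (by norm_num)) (hf.differentiable (by norm_num))] at h0
    have hz : ∀ x, xGrad (fun x : R3 => (g ‖x‖ : ℂ)) x i = 0 := fun x => by
      rw [xGrad_apply]
      exact fderiv_comp_norm_rotGen (hgC.differentiable (by norm_num)) i x
    simp only [hz, zero_mul, zero_add] at h0
    have hi : Integrable fun x : R3 => (g ‖x‖ : ℂ) * xGrad f x i :=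
      (hn.continuous.mul (continuous_xGrad hf i)).integrable_of_hasCompactSupport hnc.mul_right
    rw [isPolar_volume.integral hi, radialMeasure,
      integral_withDensity_eq_integral_toReal_smul (by fun_prop) (by simp)] at h0
    rw [← h0, ← setIntegral_eq_integral_of_forall_compl_eq_zero (s := Set.Ioi 0)]
    · refine setIntegral_congr_fun measurableSet_Ioi fun r (hr : 0 < r) => ?_
      simp only [norm_smul, norm_sphere, Real.norm_of_nonneg hr.le, mul_one, integral_const_mul]
      simp [hm, sq_nonneg]
      ring
    · intro r hr
      have : g r = 0 := image_eq_zero_of_notMem_tsupport fun h => hr (hs h)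
      simp [this]
  have h1 : ∀ᵐ r ∂(volume.restrict (Set.Ioi (0:ℝ))), ((r ^ 2 : ℝ) : ℂ) * m r = 0 := by
    rwa [ae_restrict_iff' measurableSet_Ioi]
  have h2 := Measure.eqOn_open_of_ae_eq (f := fun r : ℝ => ((r ^ 2 : ℝ) : ℂ) * m r) (g := fun _ => 0) h1
    isOpen_Ioi hmc'.continuousOn continuousOn_const
  have h3 := h2 (show (1 : ℝ) ∈ Set.Ioi 0 by simp)
  simpa [hm] using h3

/-- `x × ∇` is antisymmetric on the sphere. -/
theorem sphere_integral_mul_xGrad {f g : R3 → ℂ} (hf : ContDiff ℝ 1 f) (hg : ContDiff ℝ 1 g)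
    (i : Fin 3) :
    ∫ s, f s.1 * xGrad g s.1 i ∂sphereMeasure = -∫ s, xGrad f s.1 i * g s.1 ∂sphereMeasure := by
  have h := sphere_integral_xGrad (hf.mul hg) i
  simp only [xGrad_mul (hf.differentiable (by norm_num)) (hg.differentiable (by norm_num))] at h
  have h1 : Integrable (fun s : Metric.sphere (0 : R3) 1 => xGrad f s.1 i * g s.1) sphereMeasure :=
    continuous_integrable_sphere (((continuous_xGrad hf i).mul hg.continuous).comp
      continuous_subtype_val)
  have h2 : Integrable (fun s : Metric.sphere (0 : R3) 1 => f s.1 * xGrad g s.1 i) sphereMeasure :=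
    continuous_integrable_sphere ((hf.continuous.mul (continuous_xGrad hg i)).comp
      continuous_subtype_val)
  rw [integral_add h1 h2] at h
  linear_combination h

theorem fderiv_comp_smul_apply {f : R3 → ℂ} (hf : Differentiable ℝ f) (r : ℝ) (x v : R3) :
    fderiv ℝ (fun y => f (r • y)) x v = r * fderiv ℝ f (r • x) v := by
  have h : HasFDerivAt (fun y : R3 => r • y) (r • ContinuousLinearMap.id ℝ R3) x :=
    (hasFDerivAt_id x).const_smul r
  have := ((hf (r • x)).hasFDerivAt.comp x h).fderiv
  have h' : fderiv ℝ (fun y => f (r • y)) x = _ := this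
  rw [h']
  simp

theorem xGrad_comp_smul {f : R3 → ℂ} (hf : Differentiable ℝ f) (r : ℝ) (x : R3) (i : Fin 3) :
    xGrad (fun y => f (r • y)) x i = xGrad f (r • x) i := by
  rw [xGrad_apply, xGrad_apply, fderiv_comp_smul_apply hf, map_smul, map_smul]
  simp

theorem sphere_integral_evC_mul_xGrad (p : MvPolynomial (Fin 3) ℝ) {f : R3 → ℂ}
    (hf : ContDiff ℝ 1 f) (r : ℝ) (i : Fin 3) :
    ∫ s, evC p s.1 * xGrad f (r • s.1) i ∂sphereMeasure =
      -∫ s, evC (rotPoly i p) s.1 * f (r • s.1) ∂sphereMeasure := by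
  have hs : ContDiff ℝ 1 fun y : R3 => f (r • y) := hf.comp (by fun_prop)
  have := sphere_integral_mul_xGrad (contDiff_evC p) hs i
  simpa only [xGrad_comp_smul (hf.differentiable (by norm_num)), xGrad_evC] using this

end

section
/-! ### Inner products of spherical harmonics -/

theorem integrable_evC_sphere (p : MvPolynomial (Fin 3) ℝ) :
    Integrable (fun s : Metric.sphere (0 : R3) 1 => evC p s.1) sphereMeasure :=
  continuous_integrable_sphere ((continuous_evC p).comp continuous_subtype_val)

/-- The integral of a polynomial over the unit sphere. -/
def sphereInt (p : MvPolynomial (Fin 3) ℝ) : ℂ :=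
  ∫ s : Metric.sphere (0 : R3) 1, evC p s.1 ∂sphereMeasure

theorem sphereInt_add (p q : MvPolynomial (Fin 3) ℝ) :
    sphereInt (p + q) = sphereInt p + sphereInt q := by
  simp only [sphereInt, evC_add]
  exact integral_add (integrable_evC_sphere p) (integrable_evC_sphere q)

theorem sphereInt_natCast_mul (n : ℕ) (p : MvPolynomial (Fin 3) ℝ) :
    sphereInt (n * p) = n * sphereInt p := by
  simp only [sphereInt, evC_mul, evC_natCast]
  exact integral_const_mul _ _

theorem sphereInt_C_mul (a : ℝ) (p : MvPolynomial (Fin 3) ℝ) :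
    sphereInt (MvPolynomial.C a * p) = a * sphereInt p := by
  simp only [sphereInt, evC_mul, evC_C]
  exact integral_const_mul _ _

theorem sphereInt_zero : sphereInt 0 = 0 := by simp [sphereInt]

theorem sphereInt_sum {ι : Type*} (t : Finset ι) (P : ι → MvPolynomial (Fin 3) ℝ) :
    sphereInt (∑ i ∈ t, P i) = ∑ i ∈ t, sphereInt (P i) := by
  simp only [sphereInt, evC_sum]
  exact integral_finsetSum _ fun i _ => integrable_evC_sphere (P i)

theorem sphereInt_congr {p q : MvPolynomial (Fin 3) ℝ}
    (h : ∀ s : Metric.sphere (0 : R3) 1, evC p s.1 = evC q s.1) : sphereInt p = sphereInt q :=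
  integral_congr_ae (Eventually.of_forall h)

theorem sphereInt_mul_rotPoly (p q : MvPolynomial (Fin 3) ℝ) (i : Fin 3) :
    sphereInt (p * rotPoly i q) = -sphereInt (rotPoly i p * q) := by
  simpa [sphereInt] using sphere_integral_mul_xGrad (contDiff_evC p) (contDiff_evC q) i

/-- Green's identity on the sphere: move `x × ∇` from `q` to `p` and use the eigenvalue of the
angular Laplacian. -/
theorem sphereInt_sum_rotPoly_mul_rotPoly {p : MvPolynomial (Fin 3) ℝ} {n : ℕ}
    (hp : p ∈ solidHarmonic n) (q : MvPolynomial (Fin 3) ℝ) :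
    sphereInt (∑ i, rotPoly i p * rotPoly i q) = n * (n + 1) * sphereInt (p * q) := by
  rw [sphereInt_sum]
  simp only [sphereInt_mul_rotPoly]
  rw [Finset.sum_neg_distrib, ← sphereInt_sum, ← Finset.sum_mul, sum_rotPoly_rotPoly hp.1, hp.2,
    show (normSqPoly * 0 - (n * (n + 1) : MvPolynomial (Fin 3) ℝ) * p) * q =
      (-1 : ℝ) • ((n * (n + 1) : ℕ) * (p * q)) by push_cast; rw [neg_one_smul]; ring,
    MvPolynomial.smul_eq_C_mul, sphereInt_C_mul, sphereInt_natCast_mul]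
  push_cast; ring

/-- Eigenvectors of a symmetric operator for distinct eigenvalues: `n(n+1) - m(m+1) = (n-m)(n+m+1)`.
-/
theorem sphereInt_mul_eq_zero {p q : MvPolynomial (Fin 3) ℝ} {m n : ℕ} (hp : p ∈ solidHarmonic n)
    (hq : q ∈ solidHarmonic m) (hnm : n ≠ m) : sphereInt (p * q) = 0 := by
  have h1 := sphereInt_sum_rotPoly_mul_rotPoly hp q
  have h2 := sphereInt_sum_rotPoly_mul_rotPoly hq p
  rw [mul_comm q p, show ∑ i, rotPoly i q * rotPoly i p = ∑ i, rotPoly i p * rotPoly i q from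
    Finset.sum_congr rfl fun i _ => mul_comm _ _, h1] at h2
  have h3 : ((n : ℂ) - m) * (n + m + 1) * sphereInt (p * q) = 0 := by linear_combination h2
  have h4 : (n : ℂ) - m ≠ 0 := sub_ne_zero.2 (by exact_mod_cast hnm)
  have h5 : (n : ℂ) + m + 1 ≠ 0 := by exact_mod_cast (n + m).succ_ne_zero
  exact (mul_eq_zero.1 h3).resolve_left (mul_ne_zero h4 h5)

theorem evC_smul {p : MvPolynomial (Fin 3) ℝ} {n : ℕ} (hp : p.IsHomogeneous n) (r : ℝ) (x : R3) :
    evC p (r • x) = r ^ n * evC p x := by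
  rw [evC, evC, MvPolynomial.eval_eq', MvPolynomial.eval_eq', ← Complex.ofReal_pow,
    ← Complex.ofReal_mul, Finset.mul_sum]
  congr 1
  refine Finset.sum_congr rfl fun d hd => ?_
  have : n = ∑ i, d i := by
    rw [← hp (MvPolynomial.mem_support_iff.1 hd)]
    simp [Finsupp.weight_apply, Finsupp.sum_fintype]
  rw [this]
  simp only [PiLp.smul_apply, smul_eq_mul, mul_pow, Finset.prod_mul_distrib, Finset.prod_pow_eq_pow_sum]
  ring

theorem eq_zero_of_sphereInt_mul_self {p : MvPolynomial (Fin 3) ℝ} {n : ℕ}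
    (hp : p.IsHomogeneous n) (h : sphereInt (p * p) = 0) : p = 0 := by
  set f : Metric.sphere (0 : R3) 1 → ℝ := fun s => MvPolynomial.eval (fun i => s.1 i) p with hf
  have hc : Continuous f := by
    have : f = fun s => (evC p s.1).re := by ext s; simp [hf, evC]
    rw [this]
    exact Complex.continuous_re.comp ((continuous_evC p).comp continuous_subtype_val)
  have h1 : ∫ s, f s * f s ∂sphereMeasure = 0 := by
    have : sphereInt (p * p) = ((∫ s, f s * f s ∂sphereMeasure : ℝ) : ℂ) := by
      rw [← integral_complex_ofReal]
      simp [sphereInt, evC, hf]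
    rw [this] at h
    exact_mod_cast h
  have hff : Continuous fun s => f s * f s := hc.mul hc
  have h2 := (hff.ae_eq_iff_eq sphereMeasure continuous_zero).1
    ((integral_eq_zero_iff_of_nonneg (fun s => mul_self_nonneg _)
      (continuous_integrable_sphere hff)).1 h1)
  refine hp.eq_zero_of_forall_eval_eq_zero fun x => ?_
  set y : R3 := WithLp.toLp 2 x
  have hy : evC p y = 0 := by
    rcases eq_or_ne y 0 with h0 | h0
    · rcases Nat.eq_zero_or_pos n with rfl | hn
      -- The origin lies on no ray through the sphere. In degree 0 its value is the constant value
      -- on the sphere; in positive degree homogeneity makes it zero.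
      · have s : Metric.sphere (0 : R3) 1 := ⟨EuclideanSpace.single 0 1, by simp⟩
        have e1 := evC_smul hp 0 y
        have e2 := evC_smul hp 0 s.1
        have e3 : f s = 0 := by simpa using congrFun h2 s
        rw [zero_smul, pow_zero, one_mul] at e1 e2
        rw [← e1, e2]
        exact Complex.ofReal_eq_zero.2 e3
      · have := evC_smul hp 0 y
        rwa [zero_smul, Complex.ofReal_zero, zero_pow hn.ne', zero_mul, ← h0] at this
    · have hn : ‖y‖ ≠ 0 := norm_ne_zero_iff.2 h0
      set s : Metric.sphere (0 : R3) 1 := ⟨‖y‖⁻¹ • y, by simp [norm_smul, hn]⟩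
      have e3 : f s = 0 := by simpa using congrFun h2 s
      have : y = ‖y‖ • s.1 := by simp [s, smul_smul, hn]
      rw [this, evC_smul hp]
      have : evC p s.1 = 0 := Complex.ofReal_eq_zero.2 e3
      rw [this, mul_zero]
  exact Complex.ofReal_eq_zero.1 hy

theorem exists_orthonormal_solidHarmonic (n : ℕ) :
    ∃ Y : Fin (2 * n + 1) → MvPolynomial (Fin 3) ℝ, (∀ ℓ, Y ℓ ∈ solidHarmonic n) ∧
      ∀ ℓ k, sphereInt (Y ℓ * Y k) = if ℓ = k then 1 else 0 := by
  have hre : ∀ p, ((sphereInt p).re : ℂ) = sphereInt p := fun p => by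
    have : sphereInt p = ((∫ s : Metric.sphere (0 : R3) 1,
        (MvPolynomial.eval (fun i => s.1 i) p : ℝ) ∂sphereMeasure : ℝ) : ℂ) := by
      rw [← integral_complex_ofReal]; rfl
    rw [this, Complex.ofReal_re]
  let core : InnerProductSpace.Core ℝ (solidHarmonic n) :=
    { inner := fun p q => (sphereInt (p.1 * q.1)).re
      conj_inner_symm := fun p q => by simp [mul_comm]
      re_inner_nonneg := fun p => by
        have : sphereInt (p.1 * p.1) = ((∫ s : Metric.sphere (0 : R3) 1,
            (MvPolynomial.eval (fun i => s.1 i) p.1 *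
              MvPolynomial.eval (fun i => s.1 i) p.1 : ℝ) ∂sphereMeasure : ℝ) : ℂ) := by
          rw [← integral_complex_ofReal]; simp [sphereInt, evC]
        simp only [this, Complex.ofReal_re, RCLike.re_to_real]
        exact integral_nonneg fun s => mul_self_nonneg _
      add_left := fun p q r => by simp [add_mul, sphereInt_add]
      smul_left := fun p q a => by
        simp [MvPolynomial.smul_eq_C_mul, mul_assoc, sphereInt_C_mul]
      definite := fun p hp => by
        refine Subtype.ext (eq_zero_of_sphereInt_mul_self p.2.1 ?_)
        rw [← hre, hp, Complex.ofReal_zero] }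
  let : NormedAddCommGroup (solidHarmonic n) := core.toNormedAddCommGroup
  let : InnerProductSpace ℝ (solidHarmonic n) := InnerProductSpace.ofCore core.toCore
  have hd : Module.finrank ℝ (solidHarmonic n) = 2 * n + 1 := finrank_solidHarmonic n
  let b := (stdOrthonormalBasis ℝ (solidHarmonic n)).reindex (finCongr hd)
  refine ⟨fun ℓ => (b ℓ).1, fun ℓ => (b ℓ).2, fun ℓ k => ?_⟩
  have h : (sphereInt ((b ℓ).1 * (b k).1)).re = if ℓ = k then 1 else 0 :=
    orthonormal_iff_ite.1 b.orthonormal ℓ k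
  rw [← hre, h]
  split_ifs <;> simp

theorem sphericalHarmonicSystem_orthonormal_iff
    (Y : (n : ℕ) → Fin (2 * n + 1) → MvPolynomial (Fin 3) ℝ) (n : ℕ) (ℓ : Fin (2 * n + 1))
    (m : ℕ) (k : Fin (2 * m + 1)) (a : ℝ) :
    ∫ s : Metric.sphere (0 : R3) 1,
        MvPolynomial.eval (fun i => s.1 i) (Y n ℓ) * MvPolynomial.eval (fun i => s.1 i) (Y m k)
          ∂sphereMeasure = a ↔ sphereInt (Y n ℓ * Y m k) = a := by
  rw [← Complex.ofReal_inj, ← integral_complex_ofReal]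
  simp [sphereInt, evC]

theorem exists_isSphericalHarmonicSystem : ∃ Y, IsSphericalHarmonicSystem Y := by
  choose Y hY hO using exists_orthonormal_solidHarmonic
  refine ⟨Y, fun n ℓ => (hY n ℓ).1, fun n ℓ => (hY n ℓ).2, fun n ℓ m k => ?_⟩
  rw [sphericalHarmonicSystem_orthonormal_iff]
  rcases eq_or_ne n m with rfl | h
  · rw [hO]; simp only [Sigma.mk.injEq, heq_eq_eq, true_and]; split_ifs <;> simp
  · rw [sphereInt_mul_eq_zero (hY n ℓ) (hY m k) h, if_neg]
    · simp
    · intro h'; exact h (congrArg Sigma.fst h')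

variable {Y : (n : ℕ) → Fin (2 * n + 1) → MvPolynomial (Fin 3) ℝ}

theorem IsSphericalHarmonicSystem.mem (hY : IsSphericalHarmonicSystem Y) (n : ℕ)
    (ℓ : Fin (2 * n + 1)) : Y n ℓ ∈ solidHarmonic n :=
  ⟨hY.homogeneous n ℓ, hY.harmonic n ℓ⟩

theorem IsSphericalHarmonicSystem.sphereInt_mul (hY : IsSphericalHarmonicSystem Y) (n : ℕ)
    (ℓ : Fin (2 * n + 1)) (m : ℕ) (k : Fin (2 * m + 1)) :
    sphereInt (Y n ℓ * Y m k) =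
      if (⟨n, ℓ⟩ : Σ n : ℕ, Fin (2 * n + 1)) = ⟨m, k⟩ then 1 else 0 := by
  rw [(sphericalHarmonicSystem_orthonormal_iff Y n ℓ m k _).1 (hY.orthonormal n ℓ m k)]
  split_ifs <;> simp

/-- Orthonormality gives linear independence, and the dimension count does the rest. This is the
source of completeness for an arbitrary system. -/
theorem IsSphericalHarmonicSystem.span_eq (hY : IsSphericalHarmonicSystem Y) (n : ℕ) :
    Submodule.span ℝ (Set.range (Y n)) = solidHarmonic n := by
  have hli : LinearIndependent ℝ (Y n) := by
    rw [Fintype.linearIndependent_iff]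
    intro g hg k
    have h : sphereInt ((∑ i, g i • Y n i) * Y n k) = 0 := by rw [hg, zero_mul, sphereInt_zero]
    simp only [Finset.sum_mul, sphereInt_sum, MvPolynomial.smul_eq_C_mul, mul_assoc,
      sphereInt_C_mul, hY.sphereInt_mul] at h
    simpa using h
  refine Submodule.eq_of_le_of_finrank_eq (Submodule.span_le.2 ?_) ?_
  · rintro _ ⟨ℓ, rfl⟩; exact hY.mem n ℓ
  · rw [finrank_span_eq_card hli, finrank_solidHarmonic, Fintype.card_fin]

/-- Induction on polynomial functions on the sphere, through spherical harmonics. -/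
theorem IsSphericalHarmonicSystem.induction (hY : IsSphericalHarmonicSystem Y)
    {P : MvPolynomial (Fin 3) ℝ → Prop} (hbase : ∀ n ℓ, P (Y n ℓ))
    (hzero : P 0) (hadd : ∀ p q, P p → P q → P (p + q)) (hsmul : ∀ (a : ℝ) p, P p → P (a • p))
    (hmul : ∀ p, P p → P (normSqPoly * p)) (p : MvPolynomial (Fin 3) ℝ) : P p := by
  have hharm : ∀ n, ∀ p ∈ solidHarmonic n, P p := by
    intro n p hp
    rw [← hY.span_eq n] at hp
    induction hp using Submodule.span_induction with
    | mem x hx => obtain ⟨ℓ, rfl⟩ := hx; exact hbase n ℓ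
    | zero => exact hzero
    | add x y _ _ hx hy => exact hadd x y hx hy
    | smul a x _ hx => exact hsmul a x hx
  -- Strong induction on the degree: `p = h + |x|² q` with `h` harmonic and `q` of degree two less.
  have hhom : ∀ n, ∀ p : MvPolynomial (Fin 3) ℝ, p.IsHomogeneous n → P p := by
    intro n
    induction n using Nat.strong_induction_on with
    | _ n ih =>
      intro p hp
      rcases lt_or_ge n 2 with hn | hn
      · exact hharm n p ⟨hp, lapPoly_eq_zero_of_lt_two hp hn⟩
      · obtain ⟨m, rfl⟩ := Nat.exists_eq_add_of_le' hn
        obtain ⟨h, hh, q, hq, rfl⟩ := exists_solidHarmonic_add_normSqPoly_mul hp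
        exact hadd _ _ (hharm _ h hh) (hmul q (ih m (by omega) q hq))
  rw [← MvPolynomial.sum_homogeneousComponent p]
  exact Finset.sum_induction _ _ (fun a b => hadd a b) hzero fun n _ =>
    hhom n _ (MvPolynomial.homogeneousComponent_isHomogeneous n p)

end

section
/-! ### Completeness of the vector spherical harmonics -/

/-- Evaluation of real polynomials, as an algebra homomorphism to continuous functions. -/
def evalContinuous : MvPolynomial (Fin 3) ℝ →ₐ[ℝ] C(R3, ℝ) :=
  MvPolynomial.aeval fun i => ⟨fun x => x i, by fun_prop⟩

theorem evalContinuous_apply (p : MvPolynomial (Fin 3) ℝ) (x : R3) :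
    evalContinuous p x = MvPolynomial.eval (fun i => x i) p := by
  induction p using MvPolynomial.induction_on with
  | C a => simp [evalContinuous]
  | add p q hp hq => simp [hp, hq]
  | mul_X p k h => rw [map_mul, ContinuousMap.mul_apply, h]; simp [evalContinuous]

/-- Stone–Weierstrass: on `K` a test function is uniformly close to a polynomial, and `f` is
integrable, so `f` integrates to zero against all test functions. -/
theorem ae_eq_zero_of_integral_eval_smul {V : Type*} [NormedAddCommGroup V] [NormedSpace ℝ V]
    [CompleteSpace V] {μ : Measure R3} {K : Set R3} (hK : IsCompact K) (hμ : μ Kᶜ = 0)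
    {f : R3 → V} (hf : Integrable f μ)
    (h : ∀ p : MvPolynomial (Fin 3) ℝ, ∫ x, MvPolynomial.eval (fun i => x i) p • f x ∂μ = 0) :
    ∀ᵐ x ∂μ, f x = 0 := by
  refine ae_eq_zero_of_integral_contDiff_smul_eq_zero hf.locallyIntegrable fun g hg hgc => ?_
  have hsep : (evalContinuous.range).SeparatesPoints := by
    intro x y hxy
    have : ∃ i, x i ≠ y i := by
      by_contra! h'
      exact hxy (PiLp.ext h')
    obtain ⟨i, hi⟩ := this
    exact ⟨_, ⟨_, ⟨MvPolynomial.X i, rfl⟩, rfl⟩, by simpa [evalContinuous_apply] using hi⟩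
  have hKae : ∀ᵐ x ∂μ, x ∈ K := by
    rw [ae_iff]; exact hμ
  refine norm_le_zero_iff.1 (le_of_forall_pos_le_add fun ε hε => ?_)
  rw [zero_add]
  -- Chosen so that `δ ∫ ‖f‖ ≤ ε`; the summand 1 avoids a vanishing denominator.
  set δ := ε / (1 + ∫ x, ‖f x‖ ∂μ) with hδ
  have hI : 0 ≤ ∫ x, ‖f x‖ ∂μ := integral_nonneg fun x => norm_nonneg _
  have hδ0 : 0 < δ := by positivity
  obtain ⟨_, ⟨p, rfl⟩, hp⟩ := ContinuousMap.exists_mem_subalgebra_near_continuous_of_isCompact_of_separatesPoints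
    hsep ⟨g, hg.continuous⟩ hK hδ0
  have hgi : Integrable (fun x => g x • f x) μ := by
    obtain ⟨C, hC⟩ := hgc.exists_bound_of_continuous hg.continuous
    exact hf.bdd_smul C hg.continuous.aestronglyMeasurable (Eventually.of_forall hC)
  obtain ⟨C, hC⟩ := (hK.image (evalContinuous p).continuous).isBounded.exists_norm_le
  have hpi : Integrable (fun x => MvPolynomial.eval (fun i => x i) p • f x) μ := by
    simp only [← evalContinuous_apply]
    refine hf.bdd_smul C (evalContinuous p).continuous.aestronglyMeasurable ?_
    filter_upwards [hKae] with x hx using hC _ ⟨x, hx, rfl⟩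
  have : ∫ x, g x • f x ∂μ = ∫ x, (g x - MvPolynomial.eval (fun i => x i) p) • f x ∂μ := by
    simp only [sub_smul]
    rw [integral_sub hgi hpi, h, sub_zero]
  rw [this]
  calc ‖∫ x, (g x - MvPolynomial.eval (fun i => x i) p) • f x ∂μ‖ ≤ ∫ x, δ * ‖f x‖ ∂μ := by
        refine norm_integral_le_of_norm_le (hf.norm.const_mul δ) ?_
        filter_upwards [hKae] with x hx
        rw [norm_smul, ← evalContinuous_apply, norm_sub_rev]
        exact mul_le_mul_of_nonneg_right (hp x hx).le (norm_nonneg _)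
    _ = δ * ∫ x, ‖f x‖ ∂μ := integral_const_mul _ _
    _ ≤ ε := by
        rw [hδ, div_mul_eq_mul_div, div_le_iff₀ (by positivity)]
        nlinarith

/-- The surface measure is pushed forward to `ℝ³`, where the complement of the sphere is null and
the extension of `f` by zero is harmless. -/
theorem ae_eq_zero_of_sphere_integral {f : Metric.sphere (0 : R3) 1 → ℂ}
    (hf : Integrable f sphereMeasure) (h : ∀ p, ∫ s, evC p s.1 * f s ∂sphereMeasure = 0) :
    ∀ᵐ s ∂sphereMeasure, f s = 0 := by
  have he : MeasurableEmbedding (Subtype.val : Metric.sphere (0 : R3) 1 → R3) :=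
    MeasurableEmbedding.subtype_coe Metric.isClosed_sphere.measurableSet
  set f' : R3 → ℂ := Function.extend Subtype.val f 0 with hf'
  have hex : ∀ s : Metric.sphere (0 : R3) 1, f' s.1 = f s := fun s =>
    Subtype.val_injective.extend_apply _ _ _
  have := ae_eq_zero_of_integral_eval_smul (μ := sphereMeasure.map Subtype.val) (f := f')
    (isCompact_sphere (0 : R3) 1) ?_ ?_ ?_
  · rw [he.ae_map_iff] at this
    simpa only [hex] using this
  · rw [he.map_apply]
    convert measure_empty (μ := sphereMeasure)
    ext s; simp
  · rw [he.integrable_map_iff]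
    exact hf.congr (Eventually.of_forall fun s => (hex s).symm)
  · intro p
    rw [he.integral_map, ← h p]
    simp [hex, evC]

theorem dot_evV (a : C3) (P : Fin 3 → MvPolynomial (Fin 3) ℝ) (x : R3) :
    dot a (evV P x) = ∑ i, evC (P i) x * a i := by
  simp [dot, mul_comm]

theorem integrable_evC_mul {f : Metric.sphere (0 : R3) 1 → ℂ} (hf : Integrable f sphereMeasure)
    (p : MvPolynomial (Fin 3) ℝ) : Integrable (fun s => evC p s.1 * f s) sphereMeasure := by
  obtain ⟨C, hC⟩ := (isCompact_univ.image ((continuous_evC p).comp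
    (continuous_subtype_val (p := fun x => x ∈ Metric.sphere (0 : R3) 1)))).isBounded.exists_norm_le
  exact hf.bdd_mul ((continuous_evC p).comp continuous_subtype_val).aestronglyMeasurable
    (Eventually.of_forall fun s => hC _ ⟨s, trivial, rfl⟩)

theorem integrable_apply {X : Type*} [MeasurableSpace X] {μ : Measure X} {v : X → C3}
    (hv : Integrable v μ) (i : Fin 3) : Integrable (fun x => v x i) μ :=
  (EuclideanSpace.proj (𝕜 := ℂ) i).integrable_comp hv

section
open MvPolynomial

variable {Y : (n : ℕ) → Fin (2 * n + 1) → MvPolynomial (Fin 3) ℝ}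

theorem ae_eq_zero_of_integral_mul_harmonic (hY : IsSphericalHarmonicSystem Y)
    {f : Metric.sphere (0 : R3) 1 → ℂ} (hf : Integrable f sphereMeasure)
    (h : ∀ n ℓ, ∫ s, evC (Y n ℓ) s.1 * f s ∂sphereMeasure = 0) :
    ∀ᵐ s ∂sphereMeasure, f s = 0 := by
  refine ae_eq_zero_of_sphere_integral hf fun p => ?_
  refine hY.induction (P := fun p => ∫ s, evC p s.1 * f s ∂sphereMeasure = 0) h (by simp)
    (fun p q hp hq => ?_) (fun a p hp => ?_) (fun p hp => ?_) p
  · simp only [evC_add, add_mul]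
    rw [integral_add (integrable_evC_mul hf p) (integrable_evC_mul hf q), hp, hq, add_zero]
  · simp only [smul_eq_C_mul, evC_mul, evC_C, mul_assoc]
    rw [integral_const_mul, hp, mul_zero]
  · simpa only [evC_mul, evC_normSqPoly_sphere, one_mul] using hp

/-- A field on the sphere that is orthogonal to all vector spherical harmonics vanishes. -/
theorem ae_eq_zero_of_integral_dot_vsh (hY : IsSphericalHarmonicSystem Y)
    {v : Metric.sphere (0 : R3) 1 → C3} (hv : Integrable v sphereMeasure)
    (h1 : ∀ n ℓ, ∫ s, dot (v s) (evV (vshPoly1 (Y n ℓ)) s.1) ∂sphereMeasure = 0)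
    (h2 : ∀ n ℓ, ∫ s, dot (v s) (evV (vshPoly2 n (Y n ℓ)) s.1) ∂sphereMeasure = 0)
    (h3 : ∀ n ℓ, ∫ s, dot (v s) (evV (vshPoly3 (Y n ℓ)) s.1) ∂sphereMeasure = 0) :
    ∀ᵐ s ∂sphereMeasure, v s = 0 := by
  have hvi := integrable_apply hv
  have hint : ∀ p i, Integrable (fun s => evC p s.1 * v s i) sphereMeasure :=
    fun p i => integrable_evC_mul (hvi i) p
  -- `A P` is the pairing of `v` with the polynomial field `P`; it depends only on the values of `P`
  -- on the sphere. The aim is to show that it kills radial fields, then gradients, then rotations,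
  -- then fields `Y eᵢ`.
  set A : (Fin 3 → MvPolynomial (Fin 3) ℝ) → ℂ :=
    fun P => ∑ i, ∫ s, evC (P i) s.1 * v s i ∂sphereMeasure with hA
  have hAdot : ∀ P, ∫ s, dot (v s) (evV P s.1) ∂sphereMeasure = A P := fun P => by
    simp only [dot_evV]
    exact integral_finsetSum _ fun i _ => hint _ i
  have hAadd : ∀ P Q, A (fun i => P i + Q i) = A P + A Q := fun P Q => by
    simp only [hA, evC_add, add_mul]
    rw [← Finset.sum_add_distrib]
    exact Finset.sum_congr rfl fun i _ => integral_add (hint _ i) (hint _ i)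
  have hAmul : ∀ (a : ℝ) P, A (fun i => C a * P i) = a * A P := fun a P => by
    simp only [hA, evC_mul, evC_C, mul_assoc, integral_const_mul, Finset.mul_sum]
  have hAcongr : ∀ P Q, (∀ i (s : Metric.sphere (0 : R3) 1), evC (P i) s.1 = evC (Q i) s.1) →
      A P = A Q := fun P Q hPQ => by simp only [hA, hPQ]
  -- The radial component of `v`: `h1` says that it is orthogonal to every scalar harmonic.
  set u : Metric.sphere (0 : R3) 1 → ℂ := fun s => ∑ i, evC (X i) s.1 * v s i with hu
  have hui : Integrable u sphereMeasure := integrable_finsetSum _ fun i _ => hint _ i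
  have hAu : ∀ p, A (fun i => X i * p) = ∫ s, evC p s.1 * u s ∂sphereMeasure := fun p => by
    rw [← hAdot]
    refine integral_congr_ae (Eventually.of_forall fun s => ?_)
    simp only [dot_evV, evC_mul, hu, Finset.mul_sum]
    exact Finset.sum_congr rfl fun i _ => by ring
  have hu0 : ∀ᵐ s ∂sphereMeasure, u s = 0 := by
    refine ae_eq_zero_of_integral_mul_harmonic hY hui fun n ℓ => ?_
    rw [← hAu, ← h1 n ℓ, hAdot]; rfl
  have hAX : ∀ p, A (fun i => X i * p) = 0 := fun p => by
    rw [hAu, integral_eq_zero_of_ae]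
    filter_upwards [hu0] with s hs; simp [hs]
  -- For a harmonic, the gradient differs from the field in `h2` by a radial field, which `A`
  -- already kills. Multiplying `p` by `|x|²` adds the radial field `2 xᵢ p` on the sphere.
  have hgrad : ∀ p, A (fun i => pderiv i p) = 0 := by
    refine fun p => hY.induction (P := fun p => A (fun i => pderiv i p) = 0) (fun n ℓ => ?_)
      (by simp [hA]) (fun p q hp hq => ?_) (fun a p hp => ?_) (fun p hp => ?_) p
    · have e : A (fun i => pderiv i (Y n ℓ)) =
          A (vshPoly2 n (Y n ℓ)) + A (fun i => X i * ((n : MvPolynomial (Fin 3) ℝ) * Y n ℓ)) := by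
        rw [← hAadd]
        refine hAcongr _ _ fun i s => ?_
        simp [vshPoly2]; ring
      rw [e, ← hAdot, h2, hAX, add_zero]
    · simp only [map_add]; rw [hAadd, hp, hq, add_zero]
    · have e := hAmul a fun i => pderiv i p
      rw [hp, mul_zero] at e
      rw [← e]
      simp [smul_eq_C_mul, Derivation.leibniz]
    · have e : A (fun i => pderiv i (normSqPoly * p)) =
          A (fun i => X i * (C 2 * p)) + A (fun i => pderiv i p) := by
        rw [← hAadd]
        refine hAcongr _ _ fun i s => ?_
        have e1 : pderiv i normSqPoly = C 2 * X i := by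
          have h2 : C (2 : ℝ) = (2 : MvPolynomial (Fin 3) ℝ) := map_ofNat C 2
          fin_cases i <;> simp [normSqPoly, Derivation.leibniz_pow, pderiv_X, h2]
        simp only [Derivation.leibniz, smul_eq_mul, e1, evC_add, evC_mul, evC_normSqPoly_sphere,
          evC_X, evC_C]
        ring
      rw [e, hAX, hp, add_zero]
  have hrot : ∀ p, A (fun i => rotPoly i p) = 0 := by
    refine fun p => hY.induction (P := fun p => A (fun i => rotPoly i p) = 0) (fun n ℓ => ?_)
      (by simp [hA, rotPoly]) (fun p q hp hq => ?_) (fun a p hp => ?_) (fun p hp => ?_) p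
    · rw [← h3 n ℓ, hAdot]; rfl
    · simp only [rotPoly_add]; rw [hAadd, hp, hq, add_zero]
    · have e := hAmul a fun i => rotPoly i p
      rw [hp, mul_zero] at e
      rw [← e]
      congr 1; ext1 i
      rw [smul_eq_C_mul, rotPoly_mul]; simp [rotPoly]
    · rw [← hp]
      refine hAcongr _ _ fun i s => ?_
      have e1 : rotPoly i normSqPoly = 0 := by
        fin_cases i <;> simp [rotPoly, normSqPoly, Derivation.leibniz_pow, pderiv_X] <;> ring
      rw [rotPoly_mul, e1]
      simp [evC_normSqPoly_sphere]
  -- For `n ≥ 1`, `hodge_identity` writes `n(n+1) Y eᵢ` on the sphere through fields killed by `A`.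
  -- In degree 0 that factor is zero, but `Y eᵢ` is then itself the gradient of `Y xᵢ`.
  have hcomp : ∀ i, ∀ᵐ s ∂sphereMeasure, v s i = 0 := by
    intro i
    refine ae_eq_zero_of_integral_mul_harmonic hY (hvi i) fun n ℓ => ?_
    rcases Nat.eq_zero_or_pos n with rfl | hn
    · have e := hgrad (Y 0 ℓ * X i)
      have hd : ∀ j, pderiv j (Y 0 ℓ) = 0 :=
        fun j => pderiv_eq_zero_of_isHomogeneous_zero (hY.homogeneous 0 ℓ) j
      simp only [hA, Derivation.leibniz, hd, smul_zero, add_zero] at e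
      rw [Finset.sum_eq_single i] at e
      · simpa using e
      · intro j _ hj; simp [pderiv_X_of_ne hj.symm]
      · simp
    · have e : A (fun j => if i = j then C (n * (n + 1) : ℝ) * Y n ℓ else 0) +
          A (fun j => pderiv j (pderiv i (Y n ℓ) - (n : MvPolynomial (Fin 3) ℝ) * (X i * Y n ℓ))) +
          A (fun j => rotPoly j (rotPoly i (Y n ℓ))) =
          A (fun j => X j * (((n : MvPolynomial (Fin 3) ℝ) - 1) * pderiv i (Y n ℓ))) := by
        rw [← hAadd, ← hAadd]
        refine hAcongr _ _ fun j s => ?_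
        have := congrArg (evC · s.1) (hodge_identity (hY.homogeneous n ℓ) (hY.harmonic n ℓ) i j)
        simp only [evC_add, evC_mul (1 - normSqPoly), evC_sub 1, evC_normSqPoly_sphere, evC_one,
          sub_self, zero_mul, add_zero] at this ⊢
        rw [← this]
        congr 3
        split_ifs <;> simp
      rw [hgrad, hrot, hAX, add_zero, add_zero] at e
      simp only [hA] at e
      rw [Finset.sum_eq_single i] at e
      · simp only [if_true, evC_mul, evC_C, mul_assoc, integral_const_mul] at e
        refine (mul_eq_zero.1 e).resolve_left ?_
        have : (n : ℝ) * (n + 1) ≠ 0 := by positivity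
        exact_mod_cast this
      · intro j _ hj; simp [hj.symm]
      · simp
  filter_upwards [hcomp 0, hcomp 1, hcomp 2] with s a b c
  ext i
  fin_cases i <;> simpa

end

end

section
/-! ### Expansions on the sphere -/

/-- Normalisation gives a Hilbert basis. The norm bound is Pythagoras; it becomes the dominating
function when the slices are integrated over `r`. -/
theorem hasSum_of_orthogonal {ι H : Type*} [NormedAddCommGroup H] [InnerProductSpace ℂ H]
    [CompleteSpace H] [DecidableEq ι] (f : ι → H) (N : ι → ℝ) (hN : ∀ i, 0 < N i)
    (ho : ∀ i j, inner ℂ (f i) (f j) = if i = j then (N i : ℂ) else 0)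
    (hc : ∀ x, (∀ i, inner ℂ (f i) x = 0) → x = 0) (x : H) :
    HasSum (fun i => ((N i : ℂ)⁻¹ * inner ℂ (f i) x) • f i) x ∧
      ∀ t : Finset ι, ‖x - ∑ i ∈ t, ((N i : ℂ)⁻¹ * inner ℂ (f i) x) • f i‖ ≤ ‖x‖ := by
  set e : ι → H := fun i => ((Real.sqrt (N i) : ℂ)⁻¹) • f i with he
  have hs : ∀ i, (Real.sqrt (N i) : ℂ)⁻¹ * (Real.sqrt (N i) : ℂ)⁻¹ = (N i : ℂ)⁻¹ := fun i => by
    rw [← mul_inv, ← Complex.ofReal_mul, Real.mul_self_sqrt (hN i).le]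
  have hie : ∀ i y, inner ℂ (e i) y = (Real.sqrt (N i) : ℂ)⁻¹ * inner ℂ (f i) y := fun i y => by
    simp [he, mul_comm]
  have hon : Orthonormal ℂ e := by
    rw [orthonormal_iff_ite]
    intro i j
    rw [hie, he, inner_smul_right, ho]
    split_ifs with h
    · subst h
      rw [← mul_assoc, hs, inv_mul_cancel₀]
      exact_mod_cast (hN i).ne'
    · simp
  have hbot : (Submodule.span ℂ (Set.range e))ᗮ = ⊥ := by
    rw [Submodule.eq_bot_iff]
    intro y hy
    refine hc y fun i => ?_
    have h1 := (Submodule.mem_orthogonal _ _).1 hy (e i) (Submodule.subset_span ⟨i, rfl⟩)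
    rw [hie] at h1
    refine (mul_eq_zero.1 h1).resolve_left (inv_ne_zero ?_)
    exact_mod_cast (Real.sqrt_pos.2 (hN i)).ne'
  have hterm : ∀ i, inner ℂ (e i) x • e i = ((N i : ℂ)⁻¹ * inner ℂ (f i) x) • f i := fun i => by
    rw [hie, he, smul_smul, ← hs]; congr 1; ring
  constructor
  · have := (HilbertBasis.mkOfOrthogonalEqBot hon hbot).hasSum_repr x
    simpa only [HilbertBasis.repr_apply_apply, HilbertBasis.coe_mkOfOrthogonalEqBot, hterm]
      using this
  · intro t
    simp only [← hterm]
    set y := ∑ i ∈ t, inner ℂ (e i) x • e i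
    have h0 : inner ℂ (x - y) y = 0 := by
      simp only [y, inner_sum, inner_smul_right]
      refine Finset.sum_eq_zero fun i hi => ?_
      rw [inner_sub_left, hon.inner_left_sum _ hi, inner_conj_symm, sub_self, mul_zero]
    have h1 := norm_add_sq_eq_norm_sq_add_norm_sq_of_inner_eq_zero (x - y) y h0
    rw [sub_add_cancel] at h1
    nlinarith [norm_nonneg x, norm_nonneg (x - y), mul_self_nonneg ‖y‖]

theorem inner_eq_dot_of_real {a z : C3} (hz : ∀ i, (starRingEnd ℂ) (z i) = z i) :
    inner ℂ z a = dot a z := by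
  simp [PiLp.inner_apply, dot, hz]

theorem dot_comm (a b : C3) : dot a b = dot b a := by simp [dot, mul_comm]

/-- The Hilbert space statement in terms of functions rather than classes, so that it applies to
slices of a field. Since the family is real, the bilinear `dot` agrees with the Hermitian product.
-/
theorem expansion_of_orthogonal {X ι : Type*} [MeasurableSpace X] [DecidableEq ι] {μ : Measure X}
    (F : ι → X → C3) (N : ι → ℝ) (hN : ∀ i, 0 < N i) (hF : ∀ i, MemLp (F i) 2 μ)
    (hreal : ∀ i x k, (starRingEnd ℂ) (F i x k) = F i x k)
    (ho : ∀ i j, ∫ x, dot (F i x) (F j x) ∂μ = if i = j then (N i : ℂ) else 0)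
    (hc : ∀ v, MemLp v 2 μ → (∀ i, ∫ x, dot (v x) (F i x) ∂μ = 0) → ∀ᵐ x ∂μ, v x = 0)
    {v : X → C3} (hv : MemLp v 2 μ) :
    Tendsto (fun t : Finset ι => eLpNorm (fun x => v x - ∑ i ∈ t,
      ((N i : ℂ)⁻¹ * ∫ y, dot (v y) (F i y) ∂μ) • F i x) 2 μ) atTop (𝓝 0) ∧
    ∀ t : Finset ι, eLpNorm (fun x => v x - ∑ i ∈ t,
      ((N i : ℂ)⁻¹ * ∫ y, dot (v y) (F i y) ∂μ) • F i x) 2 μ ≤ eLpNorm v 2 μ := by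
  have hin : ∀ {w : X → C3} (hw : MemLp w 2 μ) i,
      inner ℂ ((hF i).toLp) hw.toLp = ∫ y, dot (w y) (F i y) ∂μ := fun hw i => by
    rw [L2.inner_def]
    refine integral_congr_ae ?_
    filter_upwards [(hF i).coeFn_toLp, hw.coeFn_toLp] with x h1 h2
    rw [h1, h2, inner_eq_dot_of_real (hreal i x)]
  obtain ⟨hsum, hle⟩ := hasSum_of_orthogonal (fun i => (hF i).toLp) N hN
    (fun i j => by
      rw [hin, ← ho]
      exact integral_congr_ae (Eventually.of_forall fun x => dot_comm _ _))
    (fun x hx => by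
      have hx' : MemLp x 2 μ := Lp.memLp x
      have h1 := hc x hx' fun i => by rw [← hin hx', Lp.toLp_coeFn]; exact hx i
      exact Lp.eq_zero_iff_ae_eq_zero.2 h1) hv.toLp
  simp only [hin hv] at hsum hle
  have hn : ∀ t : Finset ι, eLpNorm (fun x => v x - ∑ i ∈ t,
      ((N i : ℂ)⁻¹ * ∫ y, dot (v y) (F i y) ∂μ) • F i x) 2 μ =
      ‖hv.toLp - ∑ i ∈ t, ((N i : ℂ)⁻¹ * ∫ y, dot (v y) (F i y) ∂μ) • (hF i).toLp‖ₑ := by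
    intro t
    rw [Lp.enorm_def]
    refine eLpNorm_congr_ae ?_
    have hterms : ∀ i ∈ t, (((N i : ℂ)⁻¹ * ∫ y, dot (v y) (F i y) ∂μ) • (hF i).toLp : Lp C3 2 μ)
        =ᵐ[μ] fun x => ((N i : ℂ)⁻¹ * ∫ y, dot (v y) (F i y) ∂μ) • F i x := fun i _ => by
      filter_upwards [Lp.coeFn_smul ((N i : ℂ)⁻¹ * ∫ y, dot (v y) (F i y) ∂μ) ((hF i).toLp),
        (hF i).coeFn_toLp] with x h1 h2
      rw [h1, Pi.smul_apply, h2]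
    have hall := (eventually_all_finset t).2 hterms
    filter_upwards [Lp.coeFn_sub hv.toLp (∑ i ∈ t, ((N i : ℂ)⁻¹ * ∫ y, dot (v y) (F i y) ∂μ) •
      (hF i).toLp), hv.coeFn_toLp, Lp.coeFn_finsetSum t (fun i =>
      ((N i : ℂ)⁻¹ * ∫ y, dot (v y) (F i y) ∂μ) • (hF i).toLp), hall] with x h1 h2 h3 h4
    rw [h1, Pi.sub_apply, h2, h3, Finset.sum_apply]
    congr 1
    exact Finset.sum_congr rfl fun i hi => (h4 i hi).symm
  simp only [hn]
  constructor
  · rw [HasSum, SummationFilter.unconditional_filter] at hsum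
    have h1 := (tendsto_const_nhds (x := hv.toLp)).sub hsum
    simpa using h1.enorm
  · intro t
    rw [← Lp.enorm_toLp hv]
    exact enorm_le_iff_norm_le.2 (hle t)

theorem conj_evV (P : Fin 3 → MvPolynomial (Fin 3) ℝ) (x : R3) (k : Fin 3) :
    (starRingEnd ℂ) (evV P x k) = evV P x k := star_evC _ _

theorem integral_dot_evV_evV (P Q : Fin 3 → MvPolynomial (Fin 3) ℝ) :
    ∫ s : Metric.sphere (0 : R3) 1, dot (evV P s.1) (evV Q s.1) ∂sphereMeasure =
      sphereInt (∑ i, P i * Q i) := by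
  simp [sphereInt, dot, evC_sum]

section
open MvPolynomial

theorem evC_euler {p : MvPolynomial (Fin 3) ℝ} {n : ℕ} (hp : p.IsHomogeneous n) (x : R3) :
    (x 0 : ℂ) * evC (pderiv 0 p) x + x 1 * evC (pderiv 1 p) x + x 2 * evC (pderiv 2 p) x =
      n * evC p x := by
  simpa using congrArg (evC · x) (euler_three hp)

theorem vshPoly_one_one (p q : MvPolynomial (Fin 3) ℝ) :
    sphereInt (∑ i, vshPoly1 p i * vshPoly1 q i) = sphereInt (p * q) :=
  sphereInt_congr fun s => by
    have h := sum_sq_sphere s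
    simp only [Fin.sum_univ_three, vshPoly1, evC_add, evC_mul, evC_X]
    linear_combination evC p s.1 * evC q s.1 * h

theorem vshPoly_one_two (p : MvPolynomial (Fin 3) ℝ) {q : MvPolynomial (Fin 3) ℝ} {n : ℕ}
    (hq : q.IsHomogeneous n) : sphereInt (∑ i, vshPoly1 p i * vshPoly2 n q i) = 0 := by
  rw [← sphereInt_zero]
  refine sphereInt_congr fun s => ?_
  have h := sum_sq_sphere s
  have e := evC_euler hq s.1
  simp only [Fin.sum_univ_three, vshPoly1, vshPoly2, evC_add, evC_sub, evC_mul, evC_X, evC_natCast,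
    evC_zero]
  linear_combination evC p s.1 * e - n * evC p s.1 * evC q s.1 * h

theorem vshPoly_one_three (p q : MvPolynomial (Fin 3) ℝ) :
    sphereInt (∑ i, vshPoly1 p i * vshPoly3 q i) = 0 := by
  rw [← sphereInt_zero]
  refine sphereInt_congr fun s => ?_
  simp only [Fin.sum_univ_three, vshPoly1, vshPoly3, rotPoly, evC_add, evC_sub, evC_mul, evC_X,
    evC_zero, zero_add, show (1 : Fin 3) + 1 = 2 from rfl, show (1 : Fin 3) + 2 = 0 from rfl,
    show (2 : Fin 3) + 1 = 0 from rfl, show (2 : Fin 3) + 2 = 1 from rfl]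
  ring

/-- Lagrange's identity: on the sphere, tangential vectors may be rotated by a right angle. -/
theorem sum_vshPoly2_mul_eq {p : MvPolynomial (Fin 3) ℝ} {n : ℕ} (hp : p.IsHomogeneous n)
    (s : Metric.sphere (0 : R3) 1) (a : Fin 3 → ℂ) :
    ∑ i, evC (vshPoly2 n p i) s.1 * a i = ∑ i : Fin 3, evC (vshPoly3 p i) s.1 *
      ((s.1 (i + 1) : ℂ) * a (i + 2) - (s.1 (i + 2) : ℂ) * a (i + 1)) := by
  have h := sum_sq_sphere s
  have e := evC_euler hp s.1
  simp only [Fin.sum_univ_three, vshPoly2, vshPoly3, rotPoly, evC_sub, evC_mul, evC_X, evC_natCast,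
    zero_add, show (1 : Fin 3) + 1 = 2 from rfl, show (1 : Fin 3) + 2 = 0 from rfl,
    show (2 : Fin 3) + 1 = 0 from rfl, show (2 : Fin 3) + 2 = 1 from rfl]
  linear_combination (-(a 0 * evC (pderiv 0 p) s.1 + a 1 * evC (pderiv 1 p) s.1 +
    a 2 * evC (pderiv 2 p) s.1)) * h + (a 0 * s.1 0 + a 1 * s.1 1 + a 2 * s.1 2) * e

/-- A rotation by a right angle in the tangent plane turns surface gradients into surface curls, for
which Green's identity is available. -/
theorem vshPoly_two_two {p q : MvPolynomial (Fin 3) ℝ} {m n : ℕ} (hp : p ∈ solidHarmonic n) :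
    sphereInt (∑ i, vshPoly2 n p i * vshPoly2 m q i) = n * (n + 1) * sphereInt (p * q) := by
  rw [← sphereInt_sum_rotPoly_mul_rotPoly hp q]
  refine sphereInt_congr fun s => ?_
  simp only [evC_sum, evC_mul]
  rw [sum_vshPoly2_mul_eq hp.1 s fun i => evC (vshPoly2 m q i) s.1]
  refine Finset.sum_congr rfl fun i _ => ?_
  simp only [vshPoly3, vshPoly2, evC_sub, evC_mul, evC_X, rotPoly]
  ring

theorem vshPoly_three_three {p : MvPolynomial (Fin 3) ℝ} {n : ℕ} (hp : p ∈ solidHarmonic n)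
    (q : MvPolynomial (Fin 3) ℝ) :
    sphereInt (∑ i, vshPoly3 p i * vshPoly3 q i) = n * (n + 1) * sphereInt (p * q) :=
  sphereInt_sum_rotPoly_mul_rotPoly hp q

/-- The radial correction in `vshPoly2` is orthogonal to the tangential field `vshPoly3`; what
remains integrates by parts to `(x × ∇) · ∇ p = 0`. -/
theorem vshPoly_two_three (n : ℕ) (p q : MvPolynomial (Fin 3) ℝ) :
    sphereInt (∑ i, vshPoly2 n p i * vshPoly3 q i) = 0 := by
  have h1 : sphereInt (∑ i, vshPoly2 n p i * vshPoly3 q i) =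
      sphereInt (∑ i, pderiv i p * rotPoly i q) := sphereInt_congr fun s => by
    simp only [Fin.sum_univ_three, vshPoly2, vshPoly3, rotPoly, evC_add, evC_sub, evC_mul, evC_X,
      evC_natCast, zero_add, show (1 : Fin 3) + 1 = 2 from rfl, show (1 : Fin 3) + 2 = 0 from rfl,
      show (2 : Fin 3) + 1 = 0 from rfl, show (2 : Fin 3) + 2 = 1 from rfl]
    ring
  rw [h1, sphereInt_sum]
  simp only [sphereInt_mul_rotPoly]
  rw [Finset.sum_neg_distrib, ← sphereInt_sum, ← Finset.sum_mul, sum_rotPoly_pderiv, zero_mul,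
    sphereInt_zero, neg_zero]

end

/-! ### The three families on the sphere as one orthogonal family -/

/-- The degrees and orders of the vector spherical harmonics of the three kinds. -/
abbrev VshIndex := (Σ n : ℕ, Fin (2 * n + 1)) ⊕
  ((Σ n : ℕ, Fin (2 * (n + 1) + 1)) ⊕ (Σ n : ℕ, Fin (2 * (n + 1) + 1)))

variable {Y : (n : ℕ) → Fin (2 * n + 1) → MvPolynomial (Fin 3) ℝ}

/-- The components of all the vector spherical harmonics. -/
def vshFamily (Y : (n : ℕ) → Fin (2 * n + 1) → MvPolynomial (Fin 3) ℝ) :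
    VshIndex → Fin 3 → MvPolynomial (Fin 3) ℝ
  | .inl i => vshPoly1 (Y i.1 i.2)
  | .inr (.inl i) => vshPoly2 (i.1 + 1) (Y (i.1 + 1) i.2)
  | .inr (.inr i) => vshPoly3 (Y (i.1 + 1) i.2)

/-- The squared norms of the vector spherical harmonics. -/
def vshNormSq : VshIndex → ℝ
  | .inl _ => 1
  | .inr (.inl i) => (i.1 + 1) * (i.1 + 2)
  | .inr (.inr i) => (i.1 + 1) * (i.1 + 2)

theorem vshFamily_orthogonal (hY : IsSphericalHarmonicSystem Y) (i j : VshIndex) :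
    sphereInt (∑ k, vshFamily Y i k * vshFamily Y j k) =
      if i = j then (vshNormSq i : ℂ) else 0 := by
  have hsymm : ∀ P Q : Fin 3 → MvPolynomial (Fin 3) ℝ,
      sphereInt (∑ k, P k * Q k) = sphereInt (∑ k, Q k * P k) := fun P Q => by
    simp only [mul_comm]
  have hinj : ∀ (n : ℕ) (ℓ : Fin (2 * (n + 1) + 1)) (m : ℕ) (k : Fin (2 * (m + 1) + 1)),
      ((⟨n + 1, ℓ⟩ : Σ n : ℕ, Fin (2 * n + 1)) = ⟨m + 1, k⟩) ↔
      ((⟨n, ℓ⟩ : Σ n : ℕ, Fin (2 * (n + 1) + 1)) = ⟨m, k⟩) := fun n ℓ m k => by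
    simp
  rcases i with ⟨n, ℓ⟩ | ⟨n, ℓ⟩ | ⟨n, ℓ⟩ <;> rcases j with ⟨m, k⟩ | ⟨m, k⟩ | ⟨m, k⟩ <;>
    simp only [vshFamily, vshNormSq, Sum.inl.injEq, Sum.inr.injEq, reduceCtorEq, if_false]
  · rw [vshPoly_one_one, hY.sphereInt_mul]; simp
  · exact vshPoly_one_two _ (hY.homogeneous _ _)
  · exact vshPoly_one_three _ _
  · rw [hsymm]; exact vshPoly_one_two _ (hY.homogeneous _ _)
  · rw [vshPoly_two_two (hY.mem _ _), hY.sphereInt_mul]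
    simp only [hinj]
    split_ifs <;> push_cast <;> ring
  · exact vshPoly_two_three _ _ _
  · rw [hsymm]; exact vshPoly_one_three _ _
  · rw [hsymm]; exact vshPoly_two_three _ _ _
  · rw [vshPoly_three_three (hY.mem _ _), hY.sphereInt_mul]
    simp only [hinj]
    split_ifs <;> push_cast <;> ring

theorem memLp_evV_sphere (P : Fin 3 → MvPolynomial (Fin 3) ℝ) (p : ENNReal) :
    MemLp (fun s : Metric.sphere (0 : R3) 1 => evV P s.1) p sphereMeasure :=
  ((continuous_evV P).comp continuous_subtype_val).memLp_of_hasCompactSupport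
    (HasCompactSupport.of_compactSpace _)

/-- The coefficient of a field on the sphere at a polynomial field. -/
def sphereCoeff (N : ℂ) (P : Fin 3 → MvPolynomial (Fin 3) ℝ)
    (v : Metric.sphere (0 : R3) 1 → C3) : ℂ :=
  N⁻¹ * ∫ s, dot (v s) (evV P s.1) ∂sphereMeasure

/-- The terms of degree `n` of the expansion of a field on the sphere. -/
def sphereTerm (Y : (n : ℕ) → Fin (2 * n + 1) → MvPolynomial (Fin 3) ℝ) (n : ℕ)
    (v : Metric.sphere (0 : R3) 1 → C3) (s : Metric.sphere (0 : R3) 1) : C3 :=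
  ∑ ℓ, (sphereCoeff (n * (n + 1)) (vshPoly3 (Y n ℓ)) v • evV (vshPoly3 (Y n ℓ)) s.1 +
    (sphereCoeff 1 (vshPoly1 (Y n ℓ)) v • evV (vshPoly1 (Y n ℓ)) s.1 +
      sphereCoeff (n * (n + 1)) (vshPoly2 n (Y n ℓ)) v • evV (vshPoly2 n (Y n ℓ)) s.1))

theorem vsh_expansion_sphere (hY : IsSphericalHarmonicSystem Y)
    {v : Metric.sphere (0 : R3) 1 → C3} (hv : MemLp v 2 sphereMeasure) :
    Tendsto (fun N : ℕ => eLpNorm (fun s => v s - ∑ n ∈ Finset.range (N + 1), sphereTerm Y n v s)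
      2 sphereMeasure) atTop (𝓝 0) ∧
    ∀ N : ℕ, eLpNorm (fun s => v s - ∑ n ∈ Finset.range (N + 1), sphereTerm Y n v s)
      2 sphereMeasure ≤ eLpNorm v 2 sphereMeasure := by
  have key := expansion_of_orthogonal (fun i (s : Metric.sphere (0 : R3) 1) => evV (vshFamily Y i) s.1)
    vshNormSq (fun i => by rcases i with i | i | i <;> simp only [vshNormSq] <;> positivity)
    (fun i => memLp_evV_sphere _ _) (fun i s k => conj_evV _ _ _)
    (fun i j => by rw [integral_dot_evV_evV, vshFamily_orthogonal hY])
    (fun w hw h0 => by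
      refine ae_eq_zero_of_integral_dot_vsh hY (hw.integrable (by norm_num))
        (fun n ℓ => h0 (.inl ⟨n, ℓ⟩)) (fun n ℓ => ?_) (fun n ℓ => ?_)
      · rcases n with _ | n
        · have : ∀ i, vshPoly2 0 (Y 0 ℓ) i = 0 := fun i => by
            simp [vshPoly2, pderiv_eq_zero_of_isHomogeneous_zero (hY.homogeneous 0 ℓ)]
          simp [dot_evV, this]
        · exact h0 (.inr (.inl ⟨n, ℓ⟩))
      · rcases n with _ | n
        · have : ∀ i, vshPoly3 (Y 0 ℓ) i = 0 := fun i => by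
            simp [vshPoly3, rotPoly, pderiv_eq_zero_of_isHomogeneous_zero (hY.homogeneous 0 ℓ)]
          simp [dot_evV, this]
        · exact h0 (.inr (.inr ⟨n, ℓ⟩))) hv
  set t : ℕ → Finset VshIndex := fun N =>
    ((Finset.range (N + 1)).sigma fun n => (Finset.univ : Finset (Fin (2 * n + 1)))).disjSum
      (((Finset.range N).sigma fun n => (Finset.univ : Finset (Fin (2 * (n + 1) + 1)))).disjSum
        ((Finset.range N).sigma fun n => (Finset.univ : Finset (Fin (2 * (n + 1) + 1))))) with ht
  have hsum : ∀ N s, ∑ i ∈ t N, ((vshNormSq i : ℂ)⁻¹ * ∫ y, dot (v y) (evV (vshFamily Y i) y.1)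
      ∂sphereMeasure) • evV (vshFamily Y i) s.1 =
      ∑ n ∈ Finset.range (N + 1), sphereTerm Y n v s := by
    intro N s
    simp only [ht, Finset.sum_disjSum, Finset.sum_sigma, vshFamily, vshNormSq, sphereTerm,
      Finset.sum_add_distrib]
    -- In degree 0 the normalisation is `0⁻¹ = 0`, so the second and third kinds contribute nothing
    -- and the index shift by one in `VshIndex` loses no term.
    have h0 : ∀ f : Fin (2 * 0 + 1) → C3, ∑ ℓ, sphereCoeff ((0 : ℕ) * ((0 : ℕ) + 1))
        (vshPoly2 0 (Y 0 ℓ)) v • f ℓ = 0 := fun f => by simp [sphereCoeff]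
    have h0' : ∀ f : Fin (2 * 0 + 1) → C3, ∑ ℓ, sphereCoeff ((0 : ℕ) * ((0 : ℕ) + 1))
        (vshPoly3 (Y 0 ℓ)) v • f ℓ = 0 := fun f => by simp [sphereCoeff]
    rw [Finset.sum_range_succ' (fun n => ∑ ℓ, sphereCoeff _ (vshPoly3 (Y n ℓ)) v • _) N,
      Finset.sum_range_succ' (fun n => ∑ ℓ, sphereCoeff _ (vshPoly2 n (Y n ℓ)) v • _) N, h0, h0',
      add_zero, add_zero]
    simp only [sphereCoeff]
    push_cast
    rw [add_comm, add_assoc, add_comm, add_assoc]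
    have e : ∀ x : ℂ, x + 1 + 1 = x + 2 := fun x => by ring
    simp only [e]
  have htend : Tendsto t atTop atTop := by
    refine tendsto_atTop_finset_of_monotone (monotone_nat_of_le_succ fun N => ?_) fun i => ?_
    · intro i hi
      rcases i with i | i | i <;>
        simp only [ht, Finset.inl_mem_disjSum, Finset.inr_mem_disjSum, Finset.mem_sigma,
          Finset.mem_range, Finset.mem_univ, and_true] at hi ⊢ <;> omega
    · rcases i with i | i | i <;> refine ⟨i.1 + 1, ?_⟩ <;>
        simp only [ht, Finset.inl_mem_disjSum, Finset.inr_mem_disjSum, Finset.mem_sigma,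
          Finset.mem_range, Finset.mem_univ, and_true] <;> omega
  constructor
  · refine (key.1.comp htend).congr fun N => ?_
    simp only [Function.comp_apply, hsum]
  · intro N
    have := key.2 (t N)
    simpa only [hsum] using this

end

section
/-! ### Radial coefficients and modes -/

section
open scoped ENNReal

variable {ν : Measure R3} {ρ : Measure ℝ}

theorem vsh1_sphere (p : MvPolynomial (Fin 3) ℝ) (s : Metric.sphere (0 : R3) 1) :
    vsh1 p s.1 = evV (vshPoly1 p) s.1 := by
  simpa using vsh1_smul one_pos s p

theorem vsh2_sphere {p : MvPolynomial (Fin 3) ℝ} {n : ℕ} (hp : p.IsHomogeneous n)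
    (s : Metric.sphere (0 : R3) 1) : vsh2 p s.1 = evV (vshPoly2 n p) s.1 := by
  simpa using vsh2_smul one_pos s hp

theorem vsh3_sphere {p : MvPolynomial (Fin 3) ℝ} {n : ℕ} (hp : p.IsHomogeneous n)
    (s : Metric.sphere (0 : R3) 1) : vsh3 p s.1 = evV (vshPoly3 p) s.1 := by
  simpa using vsh3_smul one_pos s hp

theorem coeff1_eq (p : MvPolynomial (Fin 3) ℝ) (E : R3 → C3) (r : ℝ) :
    coeff1 p E r = sphereCoeff 1 (vshPoly1 p) fun s => E (r • s.1) := by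
  simp only [coeff1, radialCoeff, sphereCoeff, vsh1_sphere]

theorem coeff2_eq {p : MvPolynomial (Fin 3) ℝ} {n : ℕ} (hp : p.IsHomogeneous n) (E : R3 → C3)
    (r : ℝ) : coeff2 n p E r =
      sphereCoeff (n * (n + 1)) (vshPoly2 n p) fun s => E (r • s.1) := by
  simp only [coeff2, radialCoeff, sphereCoeff, vsh2_sphere hp]

theorem coeff3_eq {p : MvPolynomial (Fin 3) ℝ} {n : ℕ} (hp : p.IsHomogeneous n) (E : R3 → C3)
    (r : ℝ) : coeff3 n p E r =
      sphereCoeff (n * (n + 1)) (vshPoly3 p) fun s => E (r • s.1) := by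
  simp only [coeff3, radialCoeff, sphereCoeff, vsh3_sphere hp]

theorem IsPolar.eLpNorm_rpow (h : IsPolar ν ρ) {V : Type*} [NormedAddCommGroup V] {f : R3 → V}
    (hf : AEStronglyMeasurable f ν) {p : ℝ≥0∞} (h0 : p ≠ 0) (ht : p ≠ ⊤) :
    eLpNorm f p ν ^ p.toReal =
      ∫⁻ r, eLpNorm (fun s : Metric.sphere (0 : R3) 1 => f (r • s.1)) p sphereMeasure ^ p.toReal
        ∂ρ := by
  have hp : p.toReal ≠ 0 := (ENNReal.toReal_pos h0 ht).ne'
  have key : ∀ {X : Type} [MeasurableSpace X] (μ : Measure X) (g : X → V),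
      eLpNorm g p μ ^ p.toReal = ∫⁻ x, ‖g x‖ₑ ^ p.toReal ∂μ := fun μ g => by
    rw [eLpNorm_eq_lintegral_rpow_enorm_toReal h0 ht, ← ENNReal.rpow_mul, one_div,
      inv_mul_cancel₀ hp, ENNReal.rpow_one]
  simp only [key]
  exact h.lintegral (hf.enorm.pow_const _)

theorem IsPolar.aestronglyMeasurable_comp (h : IsPolar ν ρ) {V : Type*} [NormedAddCommGroup V]
    {f : R3 → V} (hf : AEStronglyMeasurable f ν) :
    AEStronglyMeasurable (fun q : ℝ × Metric.sphere (0 : R3) 1 => f (q.1 • q.2.1))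
      (ρ.prod sphereMeasure) :=
  hf.comp_quasiMeasurePreserving h.mp.quasiMeasurePreserving

theorem IsPolar.aemeasurable_eLpNorm (h : IsPolar ν ρ) {V : Type*} [NormedAddCommGroup V]
    {f : R3 → V} (hf : AEStronglyMeasurable f ν) {p : ℝ≥0∞} (h0 : p ≠ 0) (ht : p ≠ ⊤) :
    AEMeasurable (fun r => eLpNorm (fun s : Metric.sphere (0 : R3) 1 => f (r • s.1)) p
      sphereMeasure ^ p.toReal) ρ := by
  have hp : p.toReal ≠ 0 := (ENNReal.toReal_pos h0 ht).ne'
  have := h.sfinite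
  simp only [eLpNorm_eq_lintegral_rpow_enorm_toReal h0 ht, ← ENNReal.rpow_mul, one_div,
      inv_mul_cancel₀ hp, ENNReal.rpow_one]
  exact ((h.aestronglyMeasurable_comp hf).enorm.pow_const _).lintegral_prod_right'

theorem IsPolar.memLp_slice (h : IsPolar ν ρ) {V : Type*} [NormedAddCommGroup V] {f : R3 → V}
    {p : ℝ≥0∞} (h0 : p ≠ 0) (ht : p ≠ ⊤) (hf : MemLp f p ν) :
    ∀ᵐ r ∂ρ, MemLp (fun s : Metric.sphere (0 : R3) 1 => f (r • s.1)) p sphereMeasure := by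
  have := h.sfinite
  have hp : 0 < p.toReal := ENNReal.toReal_pos h0 ht
  have h1 := (h.aestronglyMeasurable_comp hf.1).prodMk_left
  have h2 := ae_lt_top' (h.aemeasurable_eLpNorm hf.1 h0 ht) (by
    rw [← h.eLpNorm_rpow hf.1 h0 ht]
    exact ENNReal.rpow_ne_top_of_nonneg hp.le hf.2.ne)
  filter_upwards [h1, h2] with r h1 h2
  exact ⟨h1, by rwa [ENNReal.rpow_lt_top_iff_of_pos hp] at h2⟩

theorem norm_dot_le (a b : C3) : ‖dot a b‖ ≤ 3 * ‖a‖ * ‖b‖ := by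
  have h : ∀ (c : C3) i, ‖c i‖ ≤ ‖c‖ := fun c i => PiLp.norm_apply_le c i
  calc ‖dot a b‖ ≤ ∑ i, ‖a i * b i‖ := norm_sum_le _ _
    _ ≤ ∑ _i : Fin 3, ‖a‖ * ‖b‖ := Finset.sum_le_sum fun i _ => by
        rw [norm_mul]; exact mul_le_mul (h a i) (h b i) (norm_nonneg _) (norm_nonneg _)
    _ = 3 * ‖a‖ * ‖b‖ := by simp; ring

theorem continuous_dot : Continuous fun q : C3 × C3 => dot q.1 q.2 := by
  unfold dot; fun_prop

theorem exists_bound_evV (P : Fin 3 → MvPolynomial (Fin 3) ℝ) :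
    ∃ C : ℝ, 0 ≤ C ∧ ∀ s : Metric.sphere (0 : R3) 1, ‖evV P s.1‖ ≤ C := by
  obtain ⟨C, hC⟩ := ((isCompact_sphere (0 : R3) 1).image (continuous_evV P)).isBounded.exists_norm_le
  exact ⟨C, (norm_nonneg _).trans (hC _ ⟨EuclideanSpace.single 0 1, by simp, rfl⟩),
    fun s => hC _ ⟨s.1, s.2, rfl⟩⟩

theorem aestronglyMeasurable_dot {X : Type*} [MeasurableSpace X] {μ : Measure X} {f g : X → C3}
    (hf : AEStronglyMeasurable f μ) (hg : AEStronglyMeasurable g μ) :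
    AEStronglyMeasurable (fun x => dot (f x) (g x)) μ :=
  Continuous.comp_aestronglyMeasurable (g := fun q : C3 × C3 => dot q.1 q.2)
    (f := fun x => (f x, g x)) continuous_dot (hf.prodMk hg)

/-- Hölder on the sphere, which has finite measure. The exponent 2 serves the expansions, the
exponent 1 the locally integrable fields in the weak formulations. -/
theorem exists_sphereCoeff_bound (N : ℂ) (P : Fin 3 → MvPolynomial (Fin 3) ℝ) {p : ℝ≥0∞}
    (h1 : 1 ≤ p) : ∃ K : ℝ≥0∞, K ≠ ⊤ ∧ ∀ v : Metric.sphere (0 : R3) 1 → C3,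
      AEStronglyMeasurable v sphereMeasure →
      ‖sphereCoeff N P v‖ₑ ≤ K * eLpNorm v p sphereMeasure := by
  obtain ⟨C, hC0, hC⟩ := exists_bound_evV P
  refine ⟨‖N⁻¹‖ₑ * (ENNReal.ofReal (3 * C) *
    sphereMeasure Set.univ ^ (1 / (1 : ℝ≥0∞).toReal - 1 / p.toReal)), ?_, fun v hv => ?_⟩
  · refine ENNReal.mul_ne_top enorm_ne_top (ENNReal.mul_ne_top ENNReal.ofReal_ne_top
      (ENNReal.rpow_ne_top_of_nonneg ?_ (measure_ne_top _ _)))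
    rw [ENNReal.toReal_one, sub_nonneg]
    rcases eq_or_ne p ⊤ with rfl | ht
    · simp
    · have : 1 ≤ p.toReal := by rw [← ENNReal.toReal_one]; exact ENNReal.toReal_mono ht h1
      gcongr
  · rw [sphereCoeff, enorm_mul, mul_assoc]
    gcongr
    calc ‖∫ s, dot (v s) (evV P s.1) ∂sphereMeasure‖ₑ
        ≤ ∫⁻ s, ‖dot (v s) (evV P s.1)‖ₑ ∂sphereMeasure := enorm_integral_le_lintegral_enorm _
      _ ≤ ∫⁻ s, ENNReal.ofReal (3 * C) * ‖v s‖ₑ ∂sphereMeasure := by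
          refine lintegral_mono fun s => ?_
          rw [← ofReal_norm, ← ofReal_norm, ← ENNReal.ofReal_mul (by positivity)]
          refine ENNReal.ofReal_le_ofReal ((norm_dot_le _ _).trans ?_)
          nlinarith [norm_nonneg (v s), hC s, norm_nonneg (evV P s.1),
            mul_le_mul_of_nonneg_left (hC s) (norm_nonneg (v s))]
      _ = ENNReal.ofReal (3 * C) * eLpNorm v 1 sphereMeasure := by
          rw [lintegral_const_mul' _ _ ENNReal.ofReal_ne_top, eLpNorm_one_eq_lintegral_enorm]
      _ ≤ _ := by
          rw [mul_assoc, mul_comm (_ ^ _)]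
          gcongr
          exact eLpNorm_le_eLpNorm_mul_rpow_measure_univ h1 hv

theorem IsPolar.memLp_sphereCoeff (h : IsPolar ν ρ) {E : R3 → C3} {p : ℝ≥0∞} (h1 : 1 ≤ p)
    (ht : p ≠ ⊤) (hE : MemLp E p ν) (N : ℂ) (P : Fin 3 → MvPolynomial (Fin 3) ℝ) :
    MemLp (fun r => sphereCoeff N P fun s => E (r • s.1)) p ρ := by
  have := h.sfinite
  have h0 : p ≠ 0 := (one_pos.trans_le h1).ne'
  have hp : 0 < p.toReal := ENNReal.toReal_pos h0 ht
  obtain ⟨K, hK, hb⟩ := exists_sphereCoeff_bound N P h1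
  constructor
  · refine AEStronglyMeasurable.const_mul (AEStronglyMeasurable.integral_prod_right'
      (f := fun q : ℝ × Metric.sphere (0 : R3) 1 => dot (E (q.1 • q.2.1)) (evV P q.2.1)) ?_) _
    exact aestronglyMeasurable_dot (h.aestronglyMeasurable_comp hE.1)
      (Continuous.aestronglyMeasurable (by fun_prop))
  · rw [eLpNorm_lt_top_iff_lintegral_rpow_enorm_lt_top h0 ht]
    calc ∫⁻ r, ‖sphereCoeff N P fun s => E (r • s.1)‖ₑ ^ p.toReal ∂ρ
        ≤ ∫⁻ r, K ^ p.toReal * eLpNorm (fun s : Metric.sphere (0 : R3) 1 => E (r • s.1)) p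
            sphereMeasure ^ p.toReal ∂ρ := by
          refine lintegral_mono_ae ?_
          filter_upwards [h.memLp_slice h0 ht hE] with r hr
          rw [← ENNReal.mul_rpow_of_nonneg _ _ hp.le]
          gcongr
          exact hb _ hr.1
      _ = K ^ p.toReal * eLpNorm E p ν ^ p.toReal := by
          rw [lintegral_const_mul' _ _ (ENNReal.rpow_ne_top_of_nonneg hp.le hK),
            h.eLpNorm_rpow hE.1 h0 ht]
      _ < ⊤ := ENNReal.mul_lt_top (ENNReal.rpow_lt_top_of_nonneg hp.le hK)
          (ENNReal.rpow_lt_top_of_nonneg hp.le hE.2.ne)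

/-- The unit vector in the direction of a nonzero vector. -/
def unitVec (x : R3) (hx : x ≠ 0) : Metric.sphere (0 : R3) 1 :=
  ⟨‖x‖⁻¹ • x, by simp [norm_smul, norm_ne_zero_iff.2 hx]⟩

theorem norm_smul_unitVec {x : R3} (hx : x ≠ 0) : ‖x‖ • (unitVec x hx).1 = x := by
  simp [unitVec, smul_smul, norm_ne_zero_iff.2 hx]

theorem vsh1_eq (p : MvPolynomial (Fin 3) ℝ) {x : R3} (hx : x ≠ 0) :
    vsh1 p x = evV (vshPoly1 p) (‖x‖⁻¹ • x) := by
  conv_lhs => rw [← norm_smul_unitVec hx]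
  exact vsh1_smul (norm_pos_iff.2 hx) _ p

theorem vsh2_eq {p : MvPolynomial (Fin 3) ℝ} {n : ℕ} (hp : p.IsHomogeneous n) {x : R3}
    (hx : x ≠ 0) : vsh2 p x = evV (vshPoly2 n p) (‖x‖⁻¹ • x) := by
  conv_lhs => rw [← norm_smul_unitVec hx]
  exact vsh2_smul (norm_pos_iff.2 hx) _ hp

theorem vsh3_eq {p : MvPolynomial (Fin 3) ℝ} {n : ℕ} (hp : p.IsHomogeneous n) {x : R3}
    (hx : x ≠ 0) : vsh3 p x = evV (vshPoly3 p) (‖x‖⁻¹ • x) := by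
  conv_lhs => rw [← norm_smul_unitVec hx]
  exact vsh3_smul (norm_pos_iff.2 hx) _ hp

theorem IsPolar.memLp_mode (h : IsPolar ν ρ) {V : Type*} [NormedAddCommGroup V] [NormedSpace ℂ V]
    [SecondCountableTopology V]
    {e : ℝ → ℂ} {p : ℝ≥0∞} (he : MemLp e p ρ) {Q : R3 → V} (hQ : Continuous Q) :
    MemLp (fun x => e ‖x‖ • Q (‖x‖⁻¹ • x)) p ν := by
  borelize V
  obtain ⟨C, hC⟩ := ((isCompact_closedBall (0 : R3) 1).image hQ).isBounded.exists_norm_le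
  have hm : Measurable fun x : R3 => Q (‖x‖⁻¹ • x) := hQ.measurable.comp (by fun_prop)
  refine MemLp.of_le_mul (c := C) (h.memLp_comp_norm he)
    ((h.memLp_comp_norm he).1.smul hm.aestronglyMeasurable) (Eventually.of_forall fun x => ?_)
  rw [norm_smul, mul_comm]
  refine mul_le_mul_of_nonneg_right (hC _ ⟨_, ?_, rfl⟩) (norm_nonneg _)
  -- At the origin `‖x‖⁻¹ • x` is zero, which still lies in the closed unit ball where `Q` is
  -- bounded.
  rcases eq_or_ne x 0 with rfl | hx
  · simp
  · simp [norm_smul, norm_ne_zero_iff.2 hx]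

theorem IsPolar.memLp_scalarMode (h : IsPolar ν ρ) {e : ℝ → ℂ} {q : ℝ≥0∞} (he : MemLp e q ρ)
    (p : MvPolynomial (Fin 3) ℝ) : MemLp (scalarMode p e) q ν := by
  have := h.memLp_mode he (continuous_evC p)
  refine (memLp_congr_ae (Eventually.of_forall fun x => ?_)).1 this
  simp [scalarMode, angular_eq]

theorem IsPolar.memLp_toroidalMode (h : IsPolar ν ρ) {e : ℝ → ℂ} {q : ℝ≥0∞} (he : MemLp e q ρ)
    {p : MvPolynomial (Fin 3) ℝ} {n : ℕ} (hp : p.IsHomogeneous n) :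
    MemLp (toroidalMode p e) q ν := by
  refine (memLp_congr_ae ?_).1 (h.memLp_mode he (continuous_evV (vshPoly3 p)))
  filter_upwards [h.ae_ne_zero] with x hx
  rw [toroidalMode, vsh3_eq hp hx]

theorem IsPolar.memLp_poloidalMode (h : IsPolar ν ρ) {e₁ e₂ : ℝ → ℂ} {q : ℝ≥0∞}
    (he₁ : MemLp e₁ q ρ) (he₂ : MemLp e₂ q ρ)
    {p : MvPolynomial (Fin 3) ℝ} {n : ℕ} (hp : p.IsHomogeneous n) :
    MemLp (poloidalMode p e₁ e₂) q ν := by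
  refine (memLp_congr_ae ?_).1 ((h.memLp_mode he₁ (continuous_evV (vshPoly1 p))).add
    (h.memLp_mode he₂ (continuous_evV (vshPoly2 n p))))
  filter_upwards [h.ae_ne_zero] with x hx
  rw [poloidalMode, vsh1_eq p hx, vsh2_eq hp hx]; rfl

theorem scalarMode_smul {r : ℝ} (hr : 0 < r) (s : Metric.sphere (0 : R3) 1)
    (p : MvPolynomial (Fin 3) ℝ) (e : ℝ → ℂ) :
    scalarMode p e (r • s.1) = e r * evC p s.1 := by
  rw [scalarMode, angular_smul hr, norm_smul, Real.norm_of_nonneg hr.le, norm_sphere, mul_one]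

theorem toroidalMode_smul {r : ℝ} (hr : 0 < r) (s : Metric.sphere (0 : R3) 1)
    {p : MvPolynomial (Fin 3) ℝ} {n : ℕ} (hp : p.IsHomogeneous n) (e : ℝ → ℂ) :
    toroidalMode p e (r • s.1) = e r • evV (vshPoly3 p) s.1 := by
  rw [toroidalMode, vsh3_smul hr s hp, norm_smul, Real.norm_of_nonneg hr.le, norm_sphere, mul_one]

theorem poloidalMode_smul {r : ℝ} (hr : 0 < r) (s : Metric.sphere (0 : R3) 1)
    {p : MvPolynomial (Fin 3) ℝ} {n : ℕ} (hp : p.IsHomogeneous n) (e₁ e₂ : ℝ → ℂ) :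
    poloidalMode p e₁ e₂ (r • s.1) =
      e₁ r • evV (vshPoly1 p) s.1 + e₂ r • evV (vshPoly2 n p) s.1 := by
  rw [poloidalMode, vsh1_smul hr, vsh2_smul hr s hp, norm_smul, Real.norm_of_nonneg hr.le,
    norm_sphere, mul_one]

theorem dot_add_left (a b c : C3) : dot (a + b) c = dot a c + dot b c := by
  simp [dot, add_mul, Finset.sum_add_distrib]

theorem dot_add_right (a b c : C3) : dot a (b + c) = dot a b + dot a c := by
  simp [dot, mul_add, Finset.sum_add_distrib]

theorem dot_smul_left (z : ℂ) (a b : C3) : dot (z • a) b = z * dot a b := by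
  simp [dot, mul_assoc, Finset.mul_sum]

theorem dot_smul_right (z : ℂ) (a b : C3) : dot a (z • b) = z * dot a b := by
  simp only [dot, PiLp.smul_apply, smul_eq_mul, Finset.mul_sum]
  exact Finset.sum_congr rfl fun i _ => by ring

theorem integrable_dot_evV (P Q : Fin 3 → MvPolynomial (Fin 3) ℝ) (z : ℂ) :
    Integrable (fun s : Metric.sphere (0 : R3) 1 => z * dot (evV P s.1) (evV Q s.1))
      sphereMeasure :=
  continuous_integrable_sphere (by unfold dot; fun_prop)

variable {Y : (n : ℕ) → Fin (2 * n + 1) → MvPolynomial (Fin 3) ℝ}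

theorem IsSphericalHarmonicSystem.sphereInt_mul_self (hY : IsSphericalHarmonicSystem Y) (n : ℕ)
    (ℓ : Fin (2 * n + 1)) : sphereInt (Y n ℓ * Y n ℓ) = 1 := by
  rw [hY.sphereInt_mul, if_pos rfl]

theorem degree_factor_ne_zero {n : ℕ} (hn : 1 ≤ n) : ((n : ℂ) * (n + 1)) ≠ 0 := by
  have h1 : (n : ℂ) ≠ 0 := by exact_mod_cast (by omega : n ≠ 0)
  have h2 : (n : ℂ) + 1 ≠ 0 := by exact_mod_cast n.succ_ne_zero
  exact mul_ne_zero h1 h2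

/-- Recovers the radial profile from the field, so that integrability of the profile can be deduced
from integrability of the mode. -/
theorem coeff3_toroidalMode (hY : IsSphericalHarmonicSystem Y) {n : ℕ} (hn : 1 ≤ n)
    (ℓ : Fin (2 * n + 1)) (e : ℝ → ℂ) {r : ℝ} (hr : 0 < r) :
    coeff3 n (Y n ℓ) (toroidalMode (Y n ℓ) e) r = e r := by
  rw [coeff3_eq (hY.homogeneous n ℓ), sphereCoeff]
  simp only [toroidalMode_smul hr _ (hY.homogeneous n ℓ), dot_smul_left, integral_const_mul,
    integral_dot_evV_evV, vshPoly_three_three (hY.mem n ℓ), hY.sphereInt_mul_self]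
  rw [mul_one, mul_comm (e r), inv_mul_cancel_left₀ (degree_factor_ne_zero hn)]

theorem coeff1_poloidalMode (hY : IsSphericalHarmonicSystem Y) (n : ℕ)
    (ℓ : Fin (2 * n + 1)) (e₁ e₂ : ℝ → ℂ) {r : ℝ} (hr : 0 < r) :
    coeff1 (Y n ℓ) (poloidalMode (Y n ℓ) e₁ e₂) r = e₁ r := by
  rw [coeff1_eq, sphereCoeff]
  simp only [poloidalMode_smul hr _ (hY.homogeneous n ℓ), dot_add_left, dot_smul_left]
  rw [integral_add (integrable_dot_evV _ _ _) (integrable_dot_evV _ _ _)]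
  simp only [integral_const_mul, dot_comm (evV (vshPoly2 _ _) _),
    integral_dot_evV_evV, vshPoly_one_one, vshPoly_one_two _ (hY.homogeneous n ℓ),
    hY.sphereInt_mul_self]
  simp

theorem coeff2_poloidalMode (hY : IsSphericalHarmonicSystem Y) {n : ℕ} (hn : 1 ≤ n)
    (ℓ : Fin (2 * n + 1)) (e₁ e₂ : ℝ → ℂ) {r : ℝ} (hr : 0 < r) :
    coeff2 n (Y n ℓ) (poloidalMode (Y n ℓ) e₁ e₂) r = e₂ r := by
  rw [coeff2_eq (hY.homogeneous n ℓ), sphereCoeff]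
  simp only [poloidalMode_smul hr _ (hY.homogeneous n ℓ), dot_add_left, dot_smul_left]
  rw [integral_add (integrable_dot_evV _ _ _) (integrable_dot_evV _ _ _)]
  simp only [integral_const_mul,
    integral_dot_evV_evV, vshPoly_one_two _ (hY.homogeneous n ℓ),
    vshPoly_two_two (hY.mem n ℓ), hY.sphereInt_mul_self]
  rw [mul_zero, zero_add, mul_one, mul_comm (e₂ r), inv_mul_cancel_left₀ (degree_factor_ne_zero hn)]

/-- The terms of degree `n` in the expansion of a field. -/
def vshTerm (Y : (n : ℕ) → Fin (2 * n + 1) → MvPolynomial (Fin 3) ℝ) (E : R3 → C3) (n : ℕ)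
    (x : R3) : C3 :=
  ∑ ℓ, (toroidalMode (Y n ℓ) (coeff3 n (Y n ℓ) E) x +
    poloidalMode (Y n ℓ) (coeff1 (Y n ℓ) E) (coeff2 n (Y n ℓ) E) x)

theorem IsPolar.memLp_coeff1 (h : IsPolar ν ρ) {E : R3 → C3} {q : ℝ≥0∞} (h1 : 1 ≤ q)
    (ht : q ≠ ⊤) (hE : MemLp E q ν) (p : MvPolynomial (Fin 3) ℝ) : MemLp (coeff1 p E) q ρ := by
  simpa only [← coeff1_eq] using h.memLp_sphereCoeff h1 ht hE 1 (vshPoly1 p)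

theorem IsPolar.memLp_coeff2 (h : IsPolar ν ρ) {E : R3 → C3} {q : ℝ≥0∞} (h1 : 1 ≤ q)
    (ht : q ≠ ⊤) (hE : MemLp E q ν) {p : MvPolynomial (Fin 3) ℝ} {n : ℕ}
    (hp : p.IsHomogeneous n) : MemLp (coeff2 n p E) q ρ := by
  simpa only [← coeff2_eq hp] using h.memLp_sphereCoeff h1 ht hE (n * (n + 1)) (vshPoly2 n p)

theorem IsPolar.memLp_coeff3 (h : IsPolar ν ρ) {E : R3 → C3} {q : ℝ≥0∞} (h1 : 1 ≤ q)
    (ht : q ≠ ⊤) (hE : MemLp E q ν) {p : MvPolynomial (Fin 3) ℝ} {n : ℕ}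
    (hp : p.IsHomogeneous n) : MemLp (coeff3 n p E) q ρ := by
  simpa only [← coeff3_eq hp] using h.memLp_sphereCoeff h1 ht hE (n * (n + 1)) (vshPoly3 p)

theorem vshTerm_smul (hY : IsSphericalHarmonicSystem Y) (E : R3 → C3) (n : ℕ) {r : ℝ}
    (hr : 0 < r) (s : Metric.sphere (0 : R3) 1) :
    vshTerm Y E n (r • s.1) = sphereTerm Y n (fun s => E (r • s.1)) s := by
  simp only [vshTerm, sphereTerm, toroidalMode_smul hr s (hY.homogeneous n _),
    poloidalMode_smul hr s (hY.homogeneous n _), coeff1_eq, coeff2_eq (hY.homogeneous n _),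
    coeff3_eq (hY.homogeneous n _)]

theorem IsPolar.memLp_vshTerm (h : IsPolar ν ρ) (hY : IsSphericalHarmonicSystem Y) {E : R3 → C3}
    (hE : MemLp E 2 ν) (n : ℕ) : MemLp (vshTerm Y E n) 2 ν :=
  memLp_finsetSum _ fun ℓ _ => (h.memLp_toroidalMode (h.memLp_coeff3 (by norm_num) (by norm_num) hE
    (hY.homogeneous n ℓ)) (hY.homogeneous n ℓ)).add
    (h.memLp_poloidalMode (h.memLp_coeff1 (by norm_num) (by norm_num) hE _)
      (h.memLp_coeff2 (by norm_num) (by norm_num) hE (hY.homogeneous n ℓ)) (hY.homogeneous n ℓ))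

/-- Every square integrable field is the sum of its modes. -/
theorem IsPolar.vsh_expansion (h : IsPolar ν ρ) (hY : IsSphericalHarmonicSystem Y) {E : R3 → C3}
    (hE : MemLp E 2 ν) :
    Tendsto (fun N : ℕ => eLpNorm (fun x => E x - ∑ n ∈ Finset.range (N + 1), vshTerm Y E n x) 2 ν)
      atTop (𝓝 0) := by
  have hD : ∀ N : ℕ, MemLp (fun x => E x - ∑ n ∈ Finset.range (N + 1), vshTerm Y E n x) 2 ν :=
    fun N => hE.sub (memLp_finsetSum _ fun n _ => h.memLp_vshTerm hY hE n)
  have h0 : (2 : ℝ≥0∞) ≠ 0 := by norm_num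
  have ht : (2 : ℝ≥0∞) ≠ ⊤ := by norm_num
  have key : Tendsto (fun N : ℕ => eLpNorm (fun x => E x -
      ∑ n ∈ Finset.range (N + 1), vshTerm Y E n x) 2 ν ^ (2 : ℝ≥0∞).toReal) atTop (𝓝 0) := by
    simp only [fun N => h.eLpNorm_rpow (hD N).1 h0 ht]
    rw [← lintegral_zero (μ := ρ)]
    -- Dominated convergence in `r`: almost every slice converges by `vsh_expansion_sphere`, with
    -- error at most the norm of the slice of `E`.
    refine tendsto_lintegral_of_dominated_convergence' (fun r => eLpNorm
      (fun s : Metric.sphere (0 : R3) 1 => E (r • s.1)) 2 sphereMeasure ^ (2 : ℝ≥0∞).toReal)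
      (fun N => h.aemeasurable_eLpNorm (hD N).1 h0 ht) (fun N => ?_) ?_ ?_
    · filter_upwards [h.memLp_slice h0 ht hE, h.pos] with r hr hr0
      simp only [vshTerm_smul hY E _ hr0]
      gcongr
      exact (vsh_expansion_sphere hY hr).2 N
    · rw [← h.eLpNorm_rpow hE.1 h0 ht]
      exact ENNReal.rpow_ne_top_of_nonneg (by simp) hE.2.ne
    · filter_upwards [h.memLp_slice h0 ht hE, h.pos] with r hr hr0
      simp only [vshTerm_smul hY E _ hr0]
      have := (vsh_expansion_sphere hY hr).1.ennrpow_const (2 : ℝ≥0∞).toReal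
      rwa [ENNReal.zero_rpow_of_pos (by simp)] at this
  have := key.ennrpow_const (1 / 2)
  rw [ENNReal.zero_rpow_of_pos (by norm_num)] at this
  refine this.congr fun N => ?_
  rw [← ENNReal.rpow_mul]
  norm_num

end

end

section
/-! ### The weighted measure on the ball -/

section
open scoped ENNReal

theorem ae_radialMeasure_iff {w : ℝ → ℝ≥0∞} (hw : Measurable w) {P : ℝ → Prop} :
    (∀ᵐ r ∂radialMeasure w, P r) ↔ ∀ᵐ r : ℝ, 0 < r → w r ≠ 0 → P r := by
  rw [radialMeasure, ae_withDensity_iff (by fun_prop), ae_restrict_iff' measurableSet_Ioi]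
  refine eventually_congr (Eventually.of_forall fun r => ?_)
  refine forall_congr' fun (hr : 0 < r) => ?_
  have : ENNReal.ofReal (r ^ 2) ≠ 0 := by simpa using hr.ne'
  simp [this]

theorem measurable_jacobiWeight (α : ℝ) : Measurable (jacobiWeight α) :=
  Measurable.indicator (by fun_prop) measurableSet_Iic

theorem measurable_ballWeight (R : ℝ) : Measurable (ballWeight R) :=
  measurable_one.indicator measurableSet_Iic

theorem jacobiWeight_ne_zero {α r : ℝ} (h0 : 0 < r) (h1 : r < 1) : jacobiWeight α r ≠ 0 := by
  have : 0 < (1 - r ^ 2) ^ α := Real.rpow_pos_of_pos (by nlinarith) _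
  simp [jacobiWeight, h1.le, this]

/-- For every `α` the weight is positive on `(0, 1)`; the endpoint `1`, where its value depends on
`α`, is a null set. -/
theorem ae_jacobi_iff {α : ℝ} {P : ℝ → Prop} :
    (∀ᵐ r ∂radialMeasure (jacobiWeight α), P r) ↔ ∀ᵐ r : ℝ, r ∈ Set.Ioo 0 1 → P r := by
  rw [ae_radialMeasure_iff (measurable_jacobiWeight α)]
  have h1 : ∀ᵐ r : ℝ, r ≠ 1 := (measure_eq_zero_iff_ae_notMem.1 (measure_singleton (1 : ℝ)))
  constructor
  · intro h
    filter_upwards [h] with r hr hr'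
    exact hr hr'.1 (jacobiWeight_ne_zero hr'.1 hr'.2)
  · intro h
    filter_upwards [h, h1] with r hr hr1 h0 hw
    refine hr ⟨h0, lt_of_le_of_ne ?_ hr1⟩
    by_contra h'
    exact hw (by simp [jacobiWeight, h'])

theorem ae_restrict_unitBall_iff {α : ℝ} {P : R3 → Prop} :
    (∀ᵐ x ∂volume.restrict unitBall, P x) ↔ ∀ᵐ x ∂ballMeasure α, P x := by
  rw [ballMeasure, ae_withDensity_iff (by fun_prop)]
  refine ⟨fun h => h.mono fun x hx _ => hx, fun h => ?_⟩
  have h1 : ∀ᵐ x : R3 ∂volume.restrict unitBall, ‖x‖ ≠ 1 := by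
    refine ae_restrict_of_ae ?_
    have := measure_eq_zero_iff_ae_notMem.1 (Measure.addHaar_sphere volume (0 : R3) 1)
    filter_upwards [this] with x hx
    simpa using hx
  filter_upwards [h, h1, ae_restrict_mem (Metric.isClosed_closedBall.measurableSet :
    MeasurableSet unitBall)] with x hx hx1 hxm
  refine hx ?_
  have h2 : ‖x‖ ≤ 1 := by simpa [unitBall] using hxm
  have h3 : ‖x‖ < 1 := lt_of_le_of_ne h2 hx1
  have : 0 < (1 - ‖x‖ ^ 2) ^ α := Real.rpow_pos_of_pos (by nlinarith [norm_nonneg x]) _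
  simpa using this

theorem ae_restrict_ball_iff {P : R3 → Prop} :
    (∀ᵐ x ∂volume.restrict (Metric.ball 0 1), P x) ↔ ∀ᵐ x ∂volume.restrict unitBall, P x := by
  have : (Metric.ball (0 : R3) 1) =ᵐ[volume] unitBall := by
    rw [unitBall, ← Metric.ball_union_sphere]
    exact (union_ae_eq_left_of_ae_eq_empty (ae_eq_empty.2 (Measure.addHaar_sphere volume _ _))).symm
  rw [Measure.restrict_congr_set this]

theorem isFiniteMeasure_radialMeasure_jacobi {α : ℝ} (hα : -1 < α) :
    IsFiniteMeasure (radialMeasure (jacobiWeight α)) := by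
  refine isFiniteMeasure_withDensity (ne_of_lt ?_)
  have hint : IntegrableOn (fun r : ℝ => 1 + (1 - r) ^ α) (Set.Ioc 0 1) := by
    have h1 : IntervalIntegrable (fun r : ℝ => (1 - r) ^ α) volume 0 1 := by
      have := (intervalIntegral.intervalIntegrable_rpow' (a := 0) (b := 1) hα).comp_sub_left 1
      simpa using this.symm
    exact (integrableOn_const (by simp)).add ((intervalIntegrable_iff_integrableOn_Ioc_of_le
      zero_le_one).1 h1)
  calc ∫⁻ r in Set.Ioi 0, ENNReal.ofReal (r ^ 2) * jacobiWeight α r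
      ≤ ∫⁻ r in Set.Ioi 0, (Set.Ioc 0 1).indicator
          (fun r => ENNReal.ofReal (1 + (1 - r) ^ α)) r := by
        refine setLIntegral_mono' measurableSet_Ioi fun r (hr : 0 < r) => ?_
        by_cases h1 : r ≤ 1
        · rw [Set.indicator_of_mem (show r ∈ Set.Ioc 0 1 from ⟨hr, h1⟩), jacobiWeight,
            Set.indicator_of_mem (by exact h1), ← ENNReal.ofReal_mul (by positivity)]
          refine ENNReal.ofReal_le_ofReal ?_
          have hb : 0 ≤ (1 - r ^ 2) := by nlinarith
          -- The summand 1 covers `α ≥ 0`; for `α < 0` one uses `1 - r ≤ 1 - r²`. The bound is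
          -- integrable because `α > -1`.
          have h2 : (1 - r ^ 2) ^ α ≤ 1 + (1 - r) ^ α := by
            have hp : 0 ≤ (1 - r) ^ α := Real.rpow_nonneg (by linarith) _
            rcases le_or_gt 0 α with h | h
            · have := Real.rpow_le_one hb (by nlinarith) h
              linarith
            · rcases eq_or_lt_of_le h1 with rfl | h1
              · simp [Real.zero_rpow h.ne]
              · have := Real.rpow_le_rpow_of_nonpos (show 0 < 1 - r by linarith)
                  (show 1 - r ≤ 1 - r ^ 2 by nlinarith) h.le
                linarith
          have h3 : 0 ≤ (1 - r ^ 2) ^ α := Real.rpow_nonneg hb _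
          have h4 : r ^ 2 ≤ 1 := by nlinarith
          nlinarith
        · simp [jacobiWeight, h1]
    _ ≤ ∫⁻ r, (Set.Ioc 0 1).indicator (fun r => ENNReal.ofReal (1 + (1 - r) ^ α)) r :=
        setLIntegral_le_lintegral _ _
    _ = ∫⁻ r in Set.Ioc 0 1, ENNReal.ofReal (1 + (1 - r) ^ α) :=
        lintegral_indicator measurableSet_Ioc _
    _ < ⊤ := hint.lintegral_lt_top

theorem isFiniteMeasure_ballMeasure {α : ℝ} (hα : -1 < α) : IsFiniteMeasure (ballMeasure α) := by
  have := isFiniteMeasure_radialMeasure_jacobi hα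
  rw [← (isPolar_ballMeasure α).mp.map_eq]
  infer_instance

theorem ballMeasure_compl_unitBall (α : ℝ) : ballMeasure α unitBallᶜ = 0 := by
  refine (withDensity_absolutelyContinuous _ _) ?_
  have hm : MeasurableSet unitBall := Metric.isClosed_closedBall.measurableSet
  rw [Measure.restrict_apply hm.compl]
  simp

theorem ae_ballMeasure_norm_le (α : ℝ) : ∀ᵐ x ∂ballMeasure α, ‖x‖ ≤ 1 := by
  rw [ae_iff]
  convert ballMeasure_compl_unitBall α
  ext x; simp [unitBall]

theorem restrict_closedBall_le_ballMeasure {α R : ℝ} (hR : R < 1) :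
    ∃ c : ℝ≥0∞, c ≠ ⊤ ∧ volume.restrict (Metric.closedBall (0 : R3) R) ≤ c • ballMeasure α := by
  rcases lt_or_ge R 0 with h | hR0
  · exact ⟨0, by simp, by simp [Metric.closedBall_eq_empty.2 h]⟩
  -- A lower bound for the weight on the smaller ball: the value at radius `R` for `α ≥ 0`, and 1
  -- for `α < 0`.
  set a : ℝ := min 1 ((1 - R ^ 2) ^ α) with ha
  have hb : 0 < 1 - R ^ 2 := by nlinarith
  have ha0 : 0 < a := lt_min one_pos (Real.rpow_pos_of_pos hb _)
  have hle : ∀ x ∈ Metric.closedBall (0 : R3) R, a ≤ (1 - ‖x‖ ^ 2) ^ α := by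
    intro x hx
    have hx' : ‖x‖ ≤ R := by simpa using hx
    have h1 : 1 - R ^ 2 ≤ 1 - ‖x‖ ^ 2 := by nlinarith [norm_nonneg x]
    rcases le_or_gt 0 α with h | h
    · exact (min_le_right _ _).trans (Real.rpow_le_rpow hb.le h1 h)
    · exact (min_le_left _ _).trans (Real.one_le_rpow_of_pos_of_le_one_of_nonpos (hb.trans_le h1)
        (by nlinarith [norm_nonneg x]) h.le)
  refine ⟨ENNReal.ofReal a⁻¹, ENNReal.ofReal_ne_top, Measure.le_iff.2 fun A hA => ?_⟩
  have hm : MeasurableSet (Metric.closedBall (0 : R3) R) :=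
    Metric.isClosed_closedBall.measurableSet
  rw [Measure.smul_apply, smul_eq_mul, ballMeasure, withDensity_apply _ hA, Measure.restrict_apply hA,
    ← lintegral_const_mul _ (by fun_prop), Measure.restrict_restrict hA, ← setLIntegral_one]
  calc ∫⁻ _ in A ∩ Metric.closedBall (0 : R3) R, 1 ≤ ∫⁻ x in A ∩ Metric.closedBall (0 : R3) R,
        ENNReal.ofReal a⁻¹ * ENNReal.ofReal ((1 - ‖x‖ ^ 2) ^ α) := by
        refine setLIntegral_mono' (hA.inter hm) fun x hx => ?_
        rw [← ENNReal.ofReal_mul (by positivity), ← ENNReal.ofReal_one]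
        refine ENNReal.ofReal_le_ofReal ?_
        rw [inv_mul_eq_div, one_le_div ha0]
        exact hle x hx.2
    _ ≤ _ := lintegral_mono_set (Set.inter_subset_inter_right _
        (Metric.closedBall_subset_closedBall hR.le))

theorem integrableOn_closedBall_of_memLp {V : Type*} [NormedAddCommGroup V] {α R : ℝ} (hR : R < 1)
    {f : R3 → V} (hf : MemLp f 2 (ballMeasure α)) : IntegrableOn f (Metric.closedBall 0 R) := by
  obtain ⟨c, hc, hle⟩ := restrict_closedBall_le_ballMeasure (α := α) hR
  have : IsFiniteMeasure (volume.restrict (Metric.closedBall (0 : R3) R)) :=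
    ⟨by simpa using (measure_closedBall_lt_top : volume (Metric.closedBall (0 : R3) R) < ⊤)⟩
  exact (hf.of_measure_le_smul hc hle).integrable (by norm_num)

/-- The open sets `{‖x‖ < R}`, `0 < R ≤ ∞`: the compact subsets lie in closed balls. -/
structure IsBallDomain (Ω : Set R3) : Prop where
  isOpen : IsOpen Ω
  exists_closedBall : ∀ K ⊆ Ω, IsCompact K → ∃ R, 0 < R ∧ K ⊆ Metric.closedBall 0 R ∧
    Metric.closedBall 0 R ⊆ Ω

theorem isBallDomain_univ : IsBallDomain Set.univ where
  isOpen := isOpen_univ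
  exists_closedBall K _ hK := by
    obtain ⟨R, hR0, hR⟩ := hK.isBounded.subset_closedBall_lt 0 (0 : R3)
    exact ⟨R, hR0, hR, Set.subset_univ _⟩

theorem isBallDomain_ball : IsBallDomain (Metric.ball 0 1) where
  isOpen := Metric.isOpen_ball
  exists_closedBall K hK hKc := by
    rcases K.eq_empty_or_nonempty with rfl | hne
    · exact ⟨1 / 2, by norm_num, by simp, Metric.closedBall_subset_ball (by norm_num)⟩
    · obtain ⟨x, hx, hmax⟩ := hKc.exists_isMaxOn hne continuous_norm.continuousOn
      have hx1 : ‖x‖ < 1 := by simpa using hK hx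
      refine ⟨(‖x‖ + 1) / 2, by positivity, fun y hy => ?_,
        Metric.closedBall_subset_ball (by linarith)⟩
      have : ‖y‖ ≤ ‖x‖ := hmax hy
      simp; linarith

theorem IsBallDomain.locallyIntegrableOn {Ω : Set R3} (hΩ : IsBallDomain Ω) {V : Type*}
    [NormedAddCommGroup V] {f : R3 → V}
    (hf : ∀ R, Metric.closedBall 0 R ⊆ Ω → IntegrableOn f (Metric.closedBall 0 R)) :
    LocallyIntegrableOn f Ω := by
  rw [locallyIntegrableOn_iff hΩ.isOpen.isLocallyClosed]
  intro K hK hKc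
  obtain ⟨R, -, h1, h2⟩ := hΩ.exists_closedBall K hK hKc
  exact (hf R h2).mono_set h1

theorem locallyIntegrableOn_of_memLp_ballMeasure {V : Type*} [NormedAddCommGroup V] {α : ℝ}
    {f : R3 → V} (hf : MemLp f 2 (ballMeasure α)) : LocallyIntegrableOn f (Metric.ball 0 1) :=
  isBallDomain_ball.locallyIntegrableOn fun R hR => by
    refine integrableOn_closedBall_of_memLp (α := α) ?_ hf
    by_contra h
    have : (EuclideanSpace.single 0 1 : R3) ∈ Metric.ball (0 : R3) 1 := hR (by simpa using h)
    simp at this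

end

end

section
/-! ### Weak formulations for single modes -/

section
open scoped ENNReal

theorem integrable_continuous_mul {ν : Measure R3} {R : ℝ} (hR : ∀ᵐ x ∂ν, ‖x‖ ≤ R)
    {f g : R3 → ℂ} (hf : Continuous f) (hg : Integrable g ν) :
    Integrable (fun x => f x * g x) ν := by
  obtain ⟨C, hC⟩ := ((isCompact_closedBall (0 : R3) R).image hf).isBounded.exists_norm_le
  refine hg.bdd_mul hf.aestronglyMeasurable (c := C) ?_
  filter_upwards [hR] with x hx
  exact hC _ ⟨x, by simpa using hx, rfl⟩

variable {ν : Measure R3} {ρ : Measure ℝ}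

/-- Integration by parts takes place on each sphere separately, where the profile `e` is a constant.
Hence `e` needs no regularity and there is no boundary term. -/
theorem IsPolar.integral_mul_toroidalMode (h : IsPolar ν ρ) {R : ℝ} (hR : ∀ᵐ x ∂ν, ‖x‖ ≤ R)
    {e : ℝ → ℂ} (he : Integrable e ρ) {p : MvPolynomial (Fin 3) ℝ} {n : ℕ}
    (hp : p.IsHomogeneous n) {f : R3 → ℂ} (hf : ContDiff ℝ 1 f) (i : Fin 3) :
    ∫ x, f x * toroidalMode p e x i ∂ν = -∫ x, xGrad f x i * scalarMode p e x ∂ν := by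
  have he' := memLp_one_iff_integrable.2 he
  have h1 := integrable_apply (memLp_one_iff_integrable.1 (h.memLp_toroidalMode he' hp)) i
  have h2 := memLp_one_iff_integrable.1 (h.memLp_scalarMode he' p)
  rw [h.integral (integrable_continuous_mul hR hf.continuous h1),
    h.integral (integrable_continuous_mul hR (continuous_xGrad hf i) h2), ← integral_neg]
  refine integral_congr_ae ?_
  filter_upwards [h.pos] with r hr
  simp only [toroidalMode_smul hr _ hp, scalarMode_smul hr, PiLp.smul_apply, smul_eq_mul,
    evV_apply]
  have := sphere_integral_evC_mul_xGrad p hf r i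
  have e1 : ∀ s : Metric.sphere (0 : R3) 1, f (r • s.1) * (e r * evC (vshPoly3 p i) s.1) =
    e r * (evC (rotPoly i p) s.1 * f (r • s.1)) := fun s => by rw [vshPoly3]; ring
  have e2 : ∀ s : Metric.sphere (0 : R3) 1, xGrad f (r • s.1) i * (e r * evC p s.1) =
    e r * (evC p s.1 * xGrad f (r • s.1) i) := fun s => by ring
  simp only [e1, e2, integral_const_mul, this]
  ring

theorem integral_eq_closedBall {V : Type*} [NormedAddCommGroup V] [NormedSpace ℝ V]
    {Ω : Set R3} {R : ℝ} (hR : Metric.closedBall 0 R ⊆ Ω) {F : R3 → V}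
    (hF : ∀ x ∉ Metric.closedBall (0 : R3) R, F x = 0) :
    ∫ x in Ω, F x = ∫ x in Metric.closedBall 0 R, F x := by
  rw [setIntegral_eq_integral_of_forall_compl_eq_zero hF,
    setIntegral_eq_integral_of_forall_compl_eq_zero fun x hx => hF x fun h => hx (hR h)]

theorem ae_closedBall_norm_le (R : ℝ) :
    ∀ᵐ x ∂(volume.restrict (Metric.closedBall (0 : R3) R)), ‖x‖ ≤ R := by
  have hm : MeasurableSet (Metric.closedBall (0 : R3) R) :=
    Metric.isClosed_closedBall.measurableSet
  filter_upwards [ae_restrict_mem hm] with x hx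
  simpa using hx

theorem fderiv_eq_zero_of_notMem_tsupport {V : Type*} [NormedAddCommGroup V] [NormedSpace ℝ V]
    {ψ : R3 → V} {x : R3} (hx : x ∉ tsupport ψ) : fderiv ℝ ψ x = 0 := by
  by_contra h
  exact hx (support_fderiv_subset ℝ h)

theorem xGrad_eq_zero_of_notMem_tsupport {ψ : R3 → ℂ} {x : R3} (hx : x ∉ tsupport ψ) (i : Fin 3) :
    xGrad ψ x i = 0 := by
  rw [xGrad_apply, fderiv_eq_zero_of_notMem_tsupport hx]; rfl

theorem grad_eq_zero_of_notMem_tsupport {ψ : R3 → ℂ} {x : R3} (hx : x ∉ tsupport ψ) :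
    grad ψ x = 0 := by
  ext i
  rw [grad_apply, pd, fderiv_eq_zero_of_notMem_tsupport hx]; rfl

theorem dot_zero_right (a : C3) : dot a 0 = 0 := by simp [dot]

variable {Ω : Set R3} {p : MvPolynomial (Fin 3) ℝ} {n : ℕ}

theorem locallyIntegrableOn_toroidalMode (hΩ : IsBallDomain Ω) {e : ℝ → ℂ}
    (he : ∀ R, Metric.closedBall 0 R ⊆ Ω → Integrable e (radialMeasure (ballWeight R)))
    (hp : p.IsHomogeneous n) : LocallyIntegrableOn (toroidalMode p e) Ω :=
  hΩ.locallyIntegrableOn fun R hR => memLp_one_iff_integrable.1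
    ((isPolar_restrict_closedBall R).memLp_toroidalMode (memLp_one_iff_integrable.2 (he R hR)) hp)

theorem locallyIntegrableOn_scalarMode (hΩ : IsBallDomain Ω) {e : ℝ → ℂ}
    (he : ∀ R, Metric.closedBall 0 R ⊆ Ω → Integrable e (radialMeasure (ballWeight R)))
    (p : MvPolynomial (Fin 3) ℝ) : LocallyIntegrableOn (scalarMode p e) Ω :=
  hΩ.locallyIntegrableOn fun R hR => memLp_one_iff_integrable.1
    ((isPolar_restrict_closedBall R).memLp_scalarMode (memLp_one_iff_integrable.2 (he R hR)) p)

theorem hasWeakXGrad_mode (hΩ : IsBallDomain Ω) {e : ℝ → ℂ}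
    (he : ∀ R, Metric.closedBall 0 R ⊆ Ω → Integrable e (radialMeasure (ballWeight R)))
    (hp : p.IsHomogeneous n) : HasWeakXGrad Ω (scalarMode p e) (toroidalMode p e) := by
  refine ⟨locallyIntegrableOn_scalarMode hΩ he p, locallyIntegrableOn_toroidalMode hΩ he hp,
    fun ψ hψ i => ?_⟩
  obtain ⟨R, -, h1, h2⟩ := hΩ.exists_closedBall _ hψ.2.2 hψ.2.1
  rw [integral_eq_closedBall h2, integral_eq_closedBall h2]
  · have := (isPolar_restrict_closedBall R).integral_mul_toroidalMode (ae_closedBall_norm_le R)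
      (he R h2) hp (hψ.1.of_le (by simp)) i
    simpa only [mul_comm] using this
  · intro x hx
    rw [xGrad_eq_zero_of_notMem_tsupport fun h => hx (h1 h), mul_zero]
  · intro x hx
    rw [image_eq_zero_of_notMem_tsupport fun h => hx (h1 h), mul_zero]

/-- The weak form of `(r² e₁)' = N r e₂` on `(0, R)`. -/
def RadialDivFree (N : ℂ) (R : ℝ) (e₁ e₂ : ℝ → ℂ) : Prop :=
  ∀ β : ℝ → ℂ, ContDiff ℝ ∞ β → ∀ ε > 0, (∀ r ≤ ε, β r = 0) → (∀ r > R, β r = 0) →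
    ∫ r, (e₁ r * deriv β r + N * e₂ r * (β r / r)) ∂radialMeasure (ballWeight R) = 0

theorem fderiv_comp_norm {β : ℝ → ℂ} {x : R3} (hβ : DifferentiableAt ℝ β ‖x‖) (hx : x ≠ 0)
    (v : R3) : fderiv ℝ (fun y : R3 => β ‖y‖) x v =
      (inner ℝ (‖x‖⁻¹ • x) v : ℝ) * deriv β ‖x‖ := by
  have h := (hβ.hasDerivAt.hasFDerivAt.comp x (hasFDerivAt_norm_of_ne_zero hx)).fderiv
  have h' : fderiv ℝ (fun y : R3 => β ‖y‖) x = _ := h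
  rw [h', inner_smul_left]
  simp [mul_assoc]

theorem grad_scalarMode {β : ℝ → ℂ} (hβ : Differentiable ℝ β) (hp : p.IsHomogeneous n) {r : ℝ}
    (hr : 0 < r) (s : Metric.sphere (0 : R3) 1) :
    grad (scalarMode p β) (r • s.1) =
      deriv β r • evV (vshPoly1 p) s.1 + (β r / r) • evV (vshPoly2 n p) s.1 := by
  have hn : ‖r • s.1‖ = r := by rw [norm_smul, Real.norm_of_nonneg hr.le, norm_sphere, mul_one]
  have hx : r • s.1 ≠ 0 := by rw [← norm_ne_zero_iff, hn]; exact hr.ne'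
  ext i
  have h1 : DifferentiableAt ℝ (fun y : R3 => β ‖y‖) (r • s.1) :=
    (hβ _).comp _ (hasFDerivAt_norm_of_ne_zero hx).differentiableAt
  have h2 : DifferentiableAt ℝ (angular p) (r • s.1) :=
    (contDiffAt_angular p hx).differentiableAt (by simp)
  have h3 : fderiv ℝ (scalarMode p β) (r • s.1) = _ := fderiv_fun_mul h1 h2
  rw [grad_apply, pd, h3]
  simp only [add_apply, smul_apply,
    fderiv_comp_norm (hβ _) hx, fderiv_angular_smul hr s hp, angular_smul hr, hn, smul_smul,
    inv_mul_cancel₀ hr.ne', one_smul]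
  have hδ : ∀ x : Fin 3, ((if x = i then (1 : ℝ) else 0 : ℝ) : ℂ) = if x = i then 1 else 0 :=
    fun x => by split_ifs <;> simp
  simp [EuclideanSpace.inner_single_right, vshPoly1, hδ]
  ring

/-- Test with `β(r) Y(x̂)`: its gradient is `β' Y¹ + (β / r) Y²`, so only the first two radial
coefficients of `E` survive. -/
theorem radialIntegral_of_weakDivFree {E : R3 → C3} (hE : WeakDivFree Ω E)
    {R : ℝ} (hR : Metric.closedBall 0 R ⊆ Ω) (hp : p.IsHomogeneous n) {β : ℝ → ℂ}
    (hβ : Differentiable ℝ β) (hψ : IsTest Ω (scalarMode p β))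
    (hs : tsupport (scalarMode p β) ⊆ Metric.closedBall 0 R) :
    ∫ r, (deriv β r * ∫ s, dot (E (r • s.1)) (evV (vshPoly1 p) s.1) ∂sphereMeasure +
      β r / r * ∫ s, dot (E (r • s.1)) (evV (vshPoly2 n p) s.1) ∂sphereMeasure)
        ∂radialMeasure (ballWeight R) = 0 := by
  have hP := isPolar_restrict_closedBall R
  have hEi : Integrable E (volume.restrict (Metric.closedBall 0 R)) :=
    hE.1.integrableOn_compact_subset hR (isCompact_closedBall _ _)
  have h0 := hE.2 _ hψ
  rw [integral_eq_closedBall hR fun x hx => by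
    rw [grad_eq_zero_of_notMem_tsupport fun h => hx (hs h), dot_zero_right]] at h0
  rw [hP.integral] at h0
  · rw [← h0]
    refine integral_congr_ae ?_
    filter_upwards [hP.pos, hP.memLp_slice one_ne_zero ENNReal.one_ne_top
      (memLp_one_iff_integrable.2 hEi)] with r hr hsl
    have hi := memLp_one_iff_integrable.1 hsl
    have hd : ∀ P : Fin 3 → MvPolynomial (Fin 3) ℝ, Integrable (fun s : Metric.sphere (0 : R3) 1 =>
        dot (E (r • s.1)) (evV P s.1)) sphereMeasure := fun P => by
      simp only [dot_evV]
      exact integrable_finsetSum _ fun i _ => integrable_evC_mul (integrable_apply hi i) _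
    simp only [grad_scalarMode hβ hp hr, dot_add_right, dot_smul_right]
    rw [integral_add ((hd _).const_mul _) ((hd _).const_mul _), integral_const_mul,
      integral_const_mul]
  · simp only [dot, grad_apply]
    refine integrable_finsetSum _ fun i _ => ?_
    simp only [mul_comm (E _ _)]
    exact integrable_continuous_mul (ae_closedBall_norm_le R)
      (continuous_pd (hψ.1.of_le (by simp)) i) (integrable_apply hEi i)

/-- In general `Y(x̂)` is not smooth at the origin, so the profile is required to vanish near 0. -/
theorem isTest_scalarMode {R : ℝ} (hR : Metric.closedBall 0 R ⊆ Ω)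
    (p : MvPolynomial (Fin 3) ℝ) {β : ℝ → ℂ} (hβ : ContDiff ℝ ∞ β) {ε : ℝ} (hε : 0 < ε)
    (h0 : ∀ r ≤ ε, β r = 0) (h1 : ∀ r > R, β r = 0) :
    IsTest Ω (scalarMode p β) ∧ tsupport (scalarMode p β) ⊆ Metric.closedBall 0 R := by
  have hz : ∀ x ∉ Metric.closedBall (0 : R3) R, scalarMode p β x = 0 := fun x hx => by
    rw [scalarMode, h1 _ (by simpa using hx), zero_mul]
  have hs : tsupport (scalarMode p β) ⊆ Metric.closedBall 0 R :=
    closure_minimal (fun x hx => by_contra fun h => hx (hz x h)) Metric.isClosed_closedBall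
  refine ⟨⟨?_, HasCompactSupport.intro (isCompact_closedBall _ _) hz, hs.trans hR⟩, hs⟩
  rw [contDiff_iff_contDiffAt]
  intro x
  rcases eq_or_ne x 0 with rfl | hx
  · have : scalarMode p β =ᶠ[𝓝 0] fun _ => 0 := by
      filter_upwards [Metric.ball_mem_nhds (0 : R3) hε] with y hy
      rw [scalarMode, h0 _ (by simpa using (mem_ball_zero_iff.1 hy).le), zero_mul]
    exact contDiffAt_const.congr_of_eventuallyEq this
  · exact (hβ.contDiffAt.comp x (contDiffAt_norm ℝ hx)).mul (contDiffAt_angular p hx)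

theorem radialDivFree_of_weakDivFree {E : R3 → C3} (hE : WeakDivFree Ω E)
    {R : ℝ} (hR : Metric.closedBall 0 R ⊆ Ω) (hn : 1 ≤ n) (hp : p.IsHomogeneous n) :
    RadialDivFree (n * (n + 1)) R (coeff1 p E) (coeff2 n p E) := by
  intro β hβ ε hε h0 h1
  obtain ⟨ht, hs⟩ := isTest_scalarMode hR p hβ hε h0 h1
  rw [← radialIntegral_of_weakDivFree hE hR hp (hβ.differentiable (by simp)) ht hs]
  refine integral_congr_ae (Eventually.of_forall fun r => ?_)
  simp only [coeff1_eq, coeff2_eq hp, sphereCoeff]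
  rw [mul_inv_cancel_left₀ (degree_factor_ne_zero hn), inv_one, one_mul]
  ring

theorem evC_eq_of_isHomogeneous_zero (hp : p.IsHomogeneous 0) (x : R3) : evC p x = evC p 0 := by
  have := evC_smul hp 0 x
  simpa using this.symm

theorem vshPoly2_eq_zero (hp : p.IsHomogeneous 0) (i : Fin 3) : vshPoly2 0 p i = 0 := by
  simp [vshPoly2, pderiv_eq_zero_of_isHomogeneous_zero hp]

theorem ae_eq_zero_of_integral_radialMeasure {R : ℝ} {c : ℝ → ℂ}
    (hc : Integrable c (radialMeasure (ballWeight R)))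
    (h : ∀ γ : ℝ → ℝ, ContDiff ℝ ∞ γ → HasCompactSupport γ → tsupport γ ⊆ Set.Ioo 0 R →
      ∫ r, (γ r : ℂ) * c r ∂radialMeasure (ballWeight R) = 0) :
    ∀ᵐ r : ℝ, r ∈ Set.Ioo 0 R → c r = 0 := by
  have hm : Measurable fun r : ℝ => ENNReal.ofReal (r ^ 2) * ballWeight R r :=
    Measurable.mul (by fun_prop) (measurable_ballWeight R)
  have hlt : ∀ r : ℝ, ENNReal.ofReal (r ^ 2) * ballWeight R r < ⊤ := fun r =>
    ENNReal.mul_lt_top ENNReal.ofReal_lt_top (by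
      by_cases hr : r ≤ R <;> simp [ballWeight, hr])
  rw [radialMeasure, integrable_withDensity_iff_integrable_smul' hm
    (Eventually.of_forall hlt)] at hc
  have hc' : IntegrableOn (fun r : ℝ => (ENNReal.ofReal (r ^ 2) * ballWeight R r).toReal • c r)
    (Set.Ioi 0) := hc
  have key := isOpen_Ioo.ae_eq_zero_of_integral_contDiff_smul_eq_zero (U := Set.Ioo 0 R)
    (hc'.mono_set
      (fun r hr => hr.1 : Set.Ioo 0 R ⊆ Set.Ioi 0)).locallyIntegrableOn fun γ hγ hγc hs => ?_
  · filter_upwards [key] with r hr hr'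
    have h2 := hr hr'
    have h3 : ballWeight R r = 1 := by simp [ballWeight, hr'.2.le]
    have h4 : r ≠ 0 := hr'.1.ne'
    simpa [h3, h4, sq_nonneg] using h2
  · have h1 := h γ hγ hγc hs
    rw [radialMeasure, integral_withDensity_eq_integral_toReal_smul hm
      (Eventually.of_forall hlt)] at h1
    rw [← h1, ← setIntegral_eq_integral_of_forall_compl_eq_zero (s := Set.Ioi 0)]
    · refine integral_congr_ae (Eventually.of_forall fun r => ?_)
      simp only [Complex.real_smul]
      ring
    · intro r hr
      rw [image_eq_zero_of_notMem_tsupport fun h => hr (hs h).1, zero_smul]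

/-- In degree 0 the harmonic is constant, so a profile that is merely constant near 0 gives a test
function. Its derivative can be any test function on `(0, R)`, which excludes the profile `r⁻²` of a
point source. -/
theorem ae_coeff1_eq_zero_of_weakDivFree {E : R3 → C3} (hE : WeakDivFree Ω E)
    {R : ℝ} (hR : Metric.closedBall 0 R ⊆ Ω) (hp : p.IsHomogeneous 0) :
    ∀ᵐ r : ℝ, r ∈ Set.Ioo 0 R → coeff1 p E r = 0 := by
  have hP := isPolar_restrict_closedBall R
  have hEi : Integrable E (volume.restrict (Metric.closedBall 0 R)) :=
    hE.1.integrableOn_compact_subset hR (isCompact_closedBall _ _)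
  rcases le_or_gt R 0 with hR0 | hR0
  · exact Eventually.of_forall fun r hr => absurd (hr.1.trans hr.2) hR0.not_gt
  refine ae_eq_zero_of_integral_radialMeasure (memLp_one_iff_integrable.1
    (hP.memLp_coeff1 le_rfl ENNReal.one_ne_top (memLp_one_iff_integrable.2 hEi) p))
    fun γ hγ hγc hs => ?_
  -- The primitive based at `R` vanishes beyond `R` and is constant, in general not zero, near the
  -- origin.
  set β : ℝ → ℂ := fun r => ∫ t in R..r, (γ t : ℂ) with hβ
  have hγC : ContDiff ℝ ∞ fun r => (γ r : ℂ) := Complex.ofRealCLM.contDiff.comp hγ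
  have hd : ∀ r, HasDerivAt β (γ r) r := fun r =>
    intervalIntegral.integral_hasDerivAt_right (hγC.continuous.intervalIntegrable _ _)
      hγC.continuous.stronglyMeasurable.stronglyMeasurableAtFilter hγC.continuous.continuousAt
  have hdβ : deriv β = fun r => (γ r : ℂ) := funext fun r => (hd r).deriv
  have hβs : ContDiff ℝ ∞ β := by
    rw [contDiff_infty_iff_deriv, hdβ]
    exact ⟨fun r => (hd r).differentiableAt, hγC⟩
  have hsub : ∀ {a b : ℝ}, (∀ t ∈ Set.uIcc a b, γ t = 0) → ∫ t in a..b, (γ t : ℂ) = 0 :=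
    fun {a b} h => by
      rw [intervalIntegral.integral_congr (g := fun _ => 0) fun t ht => by simp [h t ht]]
      simp
  have h1 : ∀ r > R, β r = 0 := fun r hr => hsub fun t ht => by
    rw [Set.uIcc_of_le hr.le] at ht
    exact image_eq_zero_of_notMem_tsupport fun h => absurd (hs h).2 (not_lt.2 ht.1)
  have h0 : ∀ᶠ r in 𝓝 0, β r = β 0 := by
    obtain ⟨ε, hε, h⟩ := Metric.eventually_nhds_iff_ball.1
      (eventually_nhds_zero_of_tsupport_subset_Ioi (hs.trans Set.Ioo_subset_Ioi_self))
    filter_upwards [Metric.ball_mem_nhds (0 : ℝ) hε] with r hr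
    have : β r - β 0 = ∫ t in (0 : ℝ)..r, (γ t : ℂ) :=
      intervalIntegral.integral_interval_sub_left (hγC.continuous.intervalIntegrable _ _)
        (hγC.continuous.intervalIntegrable _ _)
    rw [← sub_eq_zero, this]
    refine hsub fun t ht => h t ?_
    have := (convex_ball (0 : ℝ) ε).ordConnected.uIcc_subset (Metric.mem_ball_self hε) hr
    exact this ht
  have hsm : scalarMode p β = fun x => β ‖x‖ * evC p 0 := by
    ext x
    simp only [scalarMode, angular_eq, evC_eq_of_isHomogeneous_zero hp (_ • _)]
  have hz : ∀ x ∉ Metric.closedBall (0 : R3) R, scalarMode p β x = 0 := fun x hx => by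
    rw [scalarMode, h1 _ (by simpa using hx), zero_mul]
  have ht : tsupport (scalarMode p β) ⊆ Metric.closedBall 0 R :=
    closure_minimal (fun x hx => by_contra fun h => hx (hz x h)) Metric.isClosed_closedBall
  have hT : IsTest Ω (scalarMode p β) :=
    ⟨by rw [hsm]; exact (contDiff_comp_norm hβs h0).mul contDiff_const,
      HasCompactSupport.intro (isCompact_closedBall _ _) hz, ht.trans hR⟩
  rw [← radialIntegral_of_weakDivFree hE hR hp (hβs.differentiable (by simp)) hT ht]
  refine integral_congr_ae (Eventually.of_forall fun r => ?_)
  have h2 : ∀ s : Metric.sphere (0 : R3) 1, dot (E (r • s.1)) (evV (vshPoly2 0 p) s.1) = 0 :=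
    fun s => by simp [dot_evV, vshPoly2_eq_zero hp]
  simp [h2, hdβ, coeff1_eq, sphereCoeff]
end

end

section
/-! ### The curl of a toroidal mode -/

section
open MvPolynomial

/-- From `x × (∇ × Φ) = ∇(x · Φ) - Φ - (x · ∇)Φ`. The radial corrections in `vshPoly2` cancel
between the two sums, so no homogeneity is needed. -/
theorem sum_vsh3_mul_curl {Φ : R3 → C3} (p : MvPolynomial (Fin 3) ℝ) (n : ℕ) (x : R3)
    (hΦ : ∀ j, DifferentiableAt ℝ (fun y => Φ y j) x) :
    dot (evV (vshPoly3 p) x) (curl Φ x) =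
      ∑ j, evC (vshPoly2 n p j) x * (Φ x j + fderiv ℝ (fun y => Φ y j) x x) -
        ∑ j, evC (vshPoly2 n p j) x * pd j (fun y => ∑ k, evC (X k) y * Φ y k) x := by
  have h : ∀ j, pd j (fun y => ∑ k, evC (X k) y * Φ y k) x =
      Φ x j + ∑ k, (x k : ℂ) * pd j (fun y => Φ y k) x := by
    intro j
    have h1 : ∀ k ∈ Finset.univ, DifferentiableAt ℝ (fun y => evC (X k) y * Φ y k) x :=
      fun k _ => (differentiable_evC _ x).mul (hΦ k)
    rw [pd, fderiv_fun_sum h1, sum_apply]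
    have h2 : ∀ k, fderiv ℝ (fun y => evC (X k) y * Φ y k) x (EuclideanSpace.single j 1) =
        evC (pderiv j (X k)) x * Φ x k + x k * pd j (fun y => Φ y k) x := fun k => by
      rw [fderiv_fun_mul (differentiable_evC _ x) (hΦ k), ← pd_evC]
      simp only [add_apply, smul_apply, evC_X, smul_eq_mul, pd]
      ring
    simp only [h2, Finset.sum_add_distrib]
    congr 1
    simp [pderiv_X, Pi.single_apply, apply_ite (fun q => evC q x)]
  simp only [h]
  clear h
  simp only [fderiv_apply_eq_sum, dot, curl, evV_apply, Fin.sum_univ_three, vshPoly2, vshPoly3,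
    rotPoly, evC_sub, evC_mul, evC_X, evC_natCast, zero_add, show (1 : Fin 3) + 1 = 2 from rfl,
    show (1 : Fin 3) + 2 = 0 from rfl, show (2 : Fin 3) + 1 = 0 from rfl,
    show (2 : Fin 3) + 2 = 1 from rfl, Matrix.cons_val]
  ring

/-- Green's identity for a surface gradient against a general function `H`: rotate to `x × ∇`, move
it over, and use the eigenvalue of `p`. -/
theorem sphere_integral_vshPoly2_mul_pd {p : MvPolynomial (Fin 3) ℝ} {n : ℕ}
    (hp : p ∈ solidHarmonic n) {H : R3 → ℂ} (hH : ContDiff ℝ 1 H) :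
    ∫ s, ∑ j, evC (vshPoly2 n p j) s.1 * pd j H s.1 ∂sphereMeasure =
      n * (n + 1) * ∫ s, evC p s.1 * H s.1 ∂sphereMeasure := by
  have hi : ∀ (q : MvPolynomial (Fin 3) ℝ) {f : R3 → ℂ}, Continuous f →
      Integrable (fun s : Metric.sphere (0 : R3) 1 => evC q s.1 * f s.1) sphereMeasure :=
    fun q f hf => continuous_integrable_sphere
      (((continuous_evC q).mul hf).comp continuous_subtype_val)
  simp only [sum_vshPoly2_mul_eq hp.1, ← xGrad_apply']
  rw [integral_finsetSum _ fun i _ => hi _ (continuous_xGrad hH i)]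
  have h := fun i => sphere_integral_evC_mul_xGrad (vshPoly3 p i) hH 1 i
  simp only [one_smul] at h
  simp only [h, Finset.sum_neg_distrib]
  rw [← integral_finsetSum _ fun i _ => hi _ hH.continuous]
  simp only [← Finset.sum_mul, ← evC_sum, vshPoly3, sum_rotPoly_rotPoly hp.1]
  have h0 : lapPoly p = 0 := hp.2
  simp only [h0, mul_zero, zero_sub, evC_neg, evC_mul, evC_add, evC_natCast, evC_one, neg_mul,
    integral_neg, neg_neg, mul_assoc, integral_const_mul]

theorem sphere_integral_vsh3_curl {p : MvPolynomial (Fin 3) ℝ} {n : ℕ}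
    (hp : p ∈ solidHarmonic n) {Φ : R3 → C3} (hΦ : ∀ j, ContDiff ℝ 1 fun y => Φ y j) :
    ∫ s, dot (evV (vshPoly3 p) s.1) (curl Φ s.1) ∂sphereMeasure =
      (∫ s, ∑ j, evC (vshPoly2 n p j) s.1 * (Φ s.1 j + fderiv ℝ (fun y => Φ y j) s.1 s.1)
        ∂sphereMeasure) - n * (n + 1) * ∫ s, dot (evV (vshPoly1 p) s.1) (Φ s.1) ∂sphereMeasure := by
  have hH : ContDiff ℝ 1 fun y => ∑ k, evC (X k) y * Φ y k :=
    ContDiff.sum fun k _ => (contDiff_evC _).mul (hΦ k)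
  simp only [fun s : Metric.sphere (0 : R3) 1 => sum_vsh3_mul_curl p n s.1
    fun j => (hΦ j).differentiable (by norm_num) s.1]
  rw [integral_sub, sphere_integral_vshPoly2_mul_pd hp hH]
  · congr 2
    refine integral_congr_ae (Eventually.of_forall fun s => ?_)
    simp only [dot, evV_apply, vshPoly1, evC_mul, Finset.mul_sum]
    exact Finset.sum_congr rfl fun i _ => by ring
  · refine continuous_integrable_sphere ?_
    have : ∀ j, Continuous fun s : Metric.sphere (0 : R3) 1 => fderiv ℝ (fun y => Φ y j) s.1 s.1 :=
      fun j => (((hΦ j).continuous_fderiv (by norm_num)).comp continuous_subtype_val).clm_apply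
        continuous_subtype_val
    have h2 : ∀ j, Continuous fun s : Metric.sphere (0 : R3) 1 => Φ s.1 j :=
      fun j => (hΦ j).continuous.comp continuous_subtype_val
    exact continuous_finsetSum _ fun j _ =>
      ((continuous_evC _).comp continuous_subtype_val).mul ((h2 j).add (this j))
  · refine continuous_integrable_sphere ?_
    have : ∀ j, Continuous fun s : Metric.sphere (0 : R3) 1 =>
        pd j (fun y => ∑ k, evC (X k) y * Φ y k) s.1 :=
      fun j => (continuous_pd hH j).comp continuous_subtype_val
    exact continuous_finsetSum _ fun j _ =>
      ((continuous_evC _).comp continuous_subtype_val).mul (this j)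

theorem curl_comp_smul {Ψ : R3 → C3} (hΨ : ∀ j, Differentiable ℝ fun y => Ψ y j) (r : ℝ) (x : R3) :
    curl (fun y => Ψ (r • y)) x = (r : ℂ) • curl Ψ (r • x) := by
  have h : ∀ i j, pd i (fun y => Ψ (r • y) j) x = r * pd i (fun y => Ψ y j) (r • x) :=
    fun i j => fderiv_comp_smul_apply (hΨ j) r x _
  ext i
  fin_cases i <;> simp [curl, h] <;> ring

theorem hasDerivAt_mul_dot {Ψ : R3 → C3} (hd : ∀ j, Differentiable ℝ fun y => Ψ y j)
    (P : Fin 3 → MvPolynomial (Fin 3) ℝ) (s : Metric.sphere (0 : R3) 1) (r : ℝ) :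
    HasDerivAt (fun t : ℝ => (t : ℂ) * dot (evV P s.1) (Ψ (t • s.1)))
      (dot (evV P s.1) (Ψ (r • s.1)) +
        r * ∑ j, evC (P j) s.1 * fderiv ℝ (fun y => Ψ y j) (r • s.1) s.1) r := by
  have h1 : ∀ j, HasDerivAt (fun t : ℝ => Ψ (t • s.1) j)
      (fderiv ℝ (fun y => Ψ y j) (r • s.1) s.1) r := fun j => by
    have h2 : HasDerivAt (fun t : ℝ => t • s.1) s.1 r := by
      simpa using (hasDerivAt_id r).smul_const s.1
    exact (hd j (r • s.1)).hasFDerivAt.comp_hasDerivAt r h2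
  have h3 := HasDerivAt.mul (HasDerivAt.ofReal_comp (hasDerivAt_id r))
    (HasDerivAt.fun_sum (u := Finset.univ) fun j _ => (h1 j).const_mul (evC (P j) s.1))
  simp only [Complex.ofReal_one, one_mul] at h3
  exact h3

/-- Applied to the dilated field `y ↦ Ψ(r y)`, the term `Φ + (x · ∇)Φ` becomes the derivative of `t
Ψ(t s)` at `t = r`. The curl is thereby reduced to a radial derivative and an algebraic term. -/
theorem sphere_integral_vsh3_curl_smul {p : MvPolynomial (Fin 3) ℝ} {n : ℕ}
    (hp : p ∈ solidHarmonic n) {Ψ : R3 → C3} (hΨ : ∀ j, ContDiff ℝ 1 fun y => Ψ y j) (r : ℝ) :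
    r * ∫ s, dot (evV (vshPoly3 p) s.1) (curl Ψ (r • s.1)) ∂sphereMeasure =
      (∫ s, deriv (fun t : ℝ => (t : ℂ) * dot (evV (vshPoly2 n p) s.1) (Ψ (t • s.1))) r
        ∂sphereMeasure) -
        n * (n + 1) * ∫ s, dot (evV (vshPoly1 p) s.1) (Ψ (r • s.1)) ∂sphereMeasure := by
  have hd : ∀ j, Differentiable ℝ fun y => Ψ y j := fun j => (hΨ j).differentiable (by norm_num)
  have h := sphere_integral_vsh3_curl hp (Φ := fun y => Ψ (r • y))
    fun j => (hΨ j).comp (contDiff_const_smul r)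
  simp only [curl_comp_smul hd, dot_smul_right, integral_const_mul] at h
  rw [h]
  congr 1
  refine integral_congr_ae (Eventually.of_forall fun s => ?_)
  dsimp only
  rw [(hasDerivAt_mul_dot hd _ s r).deriv]
  simp only [fderiv_comp_smul_apply (hd _), dot, evV_apply, Finset.mul_sum, mul_add,
    Finset.sum_add_distrib]
  congr 1
  exact Finset.sum_congr rfl fun i _ => by ring

end

end

/-! ### Enlarging the class of radial test functions -/

section
theorem exists_cutoff : ∃ χ : ℝ → ℝ, ContDiff ℝ ∞ χ ∧ (∀ t ≤ 1, χ t = 0) ∧ (∀ t, 2 ≤ t → χ t = 1) ∧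
    (∀ t, |χ t| ≤ 1) ∧ (∀ t, 2 < t → deriv χ t = 0) ∧ ∃ C, 0 ≤ C ∧ ∀ t, |deriv χ t| ≤ C := by
  have hc : ContDiff ℝ ∞ fun t : ℝ => Real.smoothTransition (t - 1) :=
    Real.smoothTransition.contDiff.comp (contDiff_id.sub contDiff_const)
  have h2 : ∀ t : ℝ, 2 < t → deriv (fun t : ℝ => Real.smoothTransition (t - 1)) t = 0 :=
    fun t ht => by
      have : (fun t : ℝ => Real.smoothTransition (t - 1)) =ᶠ[𝓝 t] fun _ => 1 := by
        filter_upwards [Ioi_mem_nhds ht] with u hu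
        exact Real.smoothTransition.one_of_one_le (by linarith [Set.mem_Ioi.1 hu])
      rw [this.deriv_eq, deriv_const]
  have h1 : ∀ t : ℝ, t < 1 → deriv (fun t : ℝ => Real.smoothTransition (t - 1)) t = 0 :=
    fun t ht => by
      have : (fun t : ℝ => Real.smoothTransition (t - 1)) =ᶠ[𝓝 t] fun _ => 0 := by
        filter_upwards [Iio_mem_nhds ht] with u hu
        exact Real.smoothTransition.zero_of_nonpos (by linarith [Set.mem_Iio.1 hu])
      rw [this.deriv_eq, deriv_const]
  obtain ⟨C, hC⟩ := ((isCompact_Icc (a := (1 : ℝ)) (b := 2)).image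
    (hc.continuous_deriv (by simp))).isBounded.exists_norm_le
  have hC0 : 0 ≤ C := (norm_nonneg _).trans (hC _ ⟨1, by norm_num, rfl⟩)
  refine ⟨_, hc, fun t ht => Real.smoothTransition.zero_of_nonpos (by linarith),
    fun t ht => Real.smoothTransition.one_of_one_le (by linarith), fun t => ?_, h2, C, hC0,
    fun t => ?_⟩
  · rw [abs_of_nonneg (Real.smoothTransition.nonneg _)]
    exact Real.smoothTransition.le_one _
  · rcases lt_or_ge t 1 with h | h
    · rw [h1 t h, abs_zero]; exact hC0
    · rcases lt_or_ge 2 t with h' | h'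
      · rw [h2 t h', abs_zero]; exact hC0
      · exact hC _ ⟨t, ⟨h, h'⟩, rfl⟩

theorem ae_radialMeasure_ballWeight (R : ℝ) :
    ∀ᵐ r ∂radialMeasure (ballWeight R), 0 < r ∧ r ≤ R := by
  rw [ae_radialMeasure_iff (measurable_ballWeight R)]
  refine Eventually.of_forall fun r h0 h1 => ⟨h0, ?_⟩
  by_contra h
  exact h1 (by simp [ballWeight, h])

/-- A zero of first order at the origin suffices for a test profile. The profiles met in
`hasWeakCurl_mode` vanish at 0 but not near 0. -/
theorem RadialDivFree.integral_eq_zero {N : ℂ} {R : ℝ} {e₁ e₂ : ℝ → ℂ}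
    (h : RadialDivFree N R e₁ e₂) (he₁ : Integrable e₁ (radialMeasure (ballWeight R)))
    (he₂ : Integrable e₂ (radialMeasure (ballWeight R))) {β : ℝ → ℂ} (hβ : ContDiff ℝ ∞ β)
    (h0 : β 0 = 0) (hR : ∀ r > R, β r = 0) :
    ∫ r, (e₁ r * deriv β r + N * e₂ r * (β r / r)) ∂radialMeasure (ballWeight R) = 0 := by
  obtain ⟨χ, hχ, hχ0, hχ1, hχb, hχd, C, hC0, hC⟩ := exists_cutoff
  have hβd : Differentiable ℝ β := hβ.differentiable (by simp)
  obtain ⟨L, hL⟩ := ((isCompact_Icc (a := 0) (b := R)).image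
    (hβ.continuous_deriv (by simp))).isBounded.exists_norm_le
  have hL1 : ∀ r, 0 < r → r ≤ R → ‖deriv β r‖ ≤ L := fun r h1 h2 => hL _ ⟨r, ⟨h1.le, h2⟩, rfl⟩
  have hL2 : ∀ r, 0 < r → r ≤ R → ‖β r‖ ≤ L * r := fun r h1 h2 => by
    have := (convex_Icc (0 : ℝ) R).norm_image_sub_le_of_norm_deriv_le (f := β) (C := L)
      (fun x _ => hβd x) (fun x hx => hL _ ⟨x, hx, rfl⟩) (x := 0) (y := r)
      ⟨le_rfl, h1.le.trans h2⟩ ⟨h1.le, h2⟩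
    simpa [h0, abs_of_pos h1] using this
  -- Profiles cut off at radius `1 / (k + 1)`, to which the hypothesis applies.
  set b : ℕ → ℝ → ℂ := fun k r => (χ ((k + 1) * r) : ℂ) * β r with hb
  have hbs : ∀ k, ContDiff ℝ ∞ (b k) := fun k =>
    (Complex.ofRealCLM.contDiff.comp (hχ.comp (contDiff_const.mul contDiff_id))).mul hβ
  have hbd : ∀ k r, deriv (b k) r = ((k + 1 : ℝ) * deriv χ ((k + 1) * r) : ℝ) * β r +
      (χ ((k + 1) * r) : ℂ) * deriv β r := fun k r => by
    have h1 : HasDerivAt (fun r : ℝ => χ ((k + 1) * r)) (deriv χ ((k + 1) * r) * ((k + 1) * 1)) r :=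
      ((hχ.differentiable (by simp) _).hasDerivAt).comp r ((hasDerivAt_id r).const_mul _)
    have h2 := (h1.ofReal_comp.mul (hβd r).hasDerivAt).deriv
    have h3 : deriv (b k) r = _ := h2
    rw [h3, mul_one, mul_comm (deriv χ _)]
  have hz : ∀ k, ∫ r, (e₁ r * deriv (b k) r + N * e₂ r * (b k r / r))
      ∂radialMeasure (ballWeight R) = 0 := fun k => by
    have hk : (0 : ℝ) < k + 1 := by positivity
    refine h _ (hbs k) (1 / (k + 1)) (by positivity) (fun r hr => ?_) fun r hr => ?_
    · rw [hb]
      dsimp only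
      rw [hχ0 _ (by rw [le_div_iff₀ hk] at hr; linarith), Complex.ofReal_zero, zero_mul]
    · rw [hb]
      dsimp only
      rw [hR r hr, mul_zero]
  have hlim := tendsto_integral_of_dominated_convergence
    (μ := radialMeasure (ballWeight R))
    (F := fun k r => e₁ r * deriv (b k) r + N * e₂ r * (b k r / r))
    (f := fun r => e₁ r * deriv β r + N * e₂ r * (β r / r))
    (fun r => (2 * C * L + L) * ‖e₁ r‖ + ‖N‖ * L * ‖e₂ r‖) (fun k => ?_)
    ((he₁.norm.const_mul _).add (he₂.norm.const_mul _)) (fun k => ?_) ?_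
  · simp only [hz] at hlim
    exact tendsto_nhds_unique hlim tendsto_const_nhds
  · refine (he₁.1.mul ((hbs k).continuous_deriv (by simp)).aestronglyMeasurable).add
      ((he₂.1.const_mul N).mul (Measurable.aestronglyMeasurable ?_))
    exact (hbs k).continuous.measurable.div Complex.measurable_ofReal
  · filter_upwards [ae_radialMeasure_ballWeight R] with r hr
    have hk : (0 : ℝ) < k + 1 := by positivity
    have hβr := hL2 r hr.1 hr.2
    have hL0 : 0 ≤ L := (norm_nonneg _).trans (hL1 r hr.1 hr.2)
    have h1 : ‖b k r‖ ≤ L * r := by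
      rw [hb]
      dsimp only
      rw [norm_mul, Complex.norm_real, Real.norm_eq_abs]
      exact (mul_le_of_le_one_left (norm_nonneg _) (hχb _)).trans hβr
    have h2 : ‖b k r / r‖ ≤ L := by
      rw [norm_div, Complex.norm_real, Real.norm_of_nonneg hr.1.le, div_le_iff₀ hr.1]
      exact h1
    have h3 : ‖deriv (b k) r‖ ≤ 2 * C * L + L := by
      rw [hbd]
      refine (norm_add_le _ _).trans (add_le_add ?_ ?_)
      · rw [norm_mul, Complex.norm_real, norm_mul, Real.norm_of_nonneg hk.le, Real.norm_eq_abs]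
        -- The factor `k + 1` from differentiating the cutoff is harmless: where the derivative of
        -- `χ` is nonzero, `(k + 1) r ≤ 2`, and `|β| ≤ L r`.
        rcases le_or_gt ((k + 1) * r) 2 with h' | h'
        · calc (k + 1) * |deriv χ ((k + 1) * r)| * ‖β r‖ ≤ (k + 1) * C * (L * r) := by
                gcongr
                exact hC _
            _ = ((k + 1) * r) * (C * L) := by ring
            _ ≤ 2 * (C * L) := by gcongr
            _ = 2 * C * L := by ring
        · rw [hχd _ h']
          simp only [abs_zero, mul_zero, zero_mul]
          positivity
      · rw [norm_mul, Complex.norm_real, Real.norm_eq_abs]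
        exact (mul_le_of_le_one_left (norm_nonneg _) (hχb _)).trans (hL1 r hr.1 hr.2)
    refine (norm_add_le _ _).trans (add_le_add ?_ ?_)
    · rw [norm_mul, mul_comm]
      gcongr
    · rw [norm_mul, norm_mul, mul_right_comm]
      gcongr
  · filter_upwards [ae_radialMeasure_ballWeight R] with r hr
    refine tendsto_nhds_of_eventually_eq ?_
    filter_upwards [eventually_gt_atTop ⌈2 / r⌉₊] with k hk
    have h1 : 2 < ((k : ℝ) + 1) * r := by
      have : 2 / r < k := (Nat.le_ceil _).trans_lt (by exact_mod_cast hk)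
      rw [div_lt_iff₀ hr.1] at this
      nlinarith [hr.1]
    rw [hbd, hb]
    simp [hχd _ h1, hχ1 _ h1.le]

end

/-! ### Poloidal modes as weak curls of toroidal modes -/

section
theorem integrable_radial_mul {R : ℝ} {e g : ℝ → ℂ}
    (he : Integrable e (radialMeasure (ballWeight R))) (hg : Continuous g) :
    Integrable (fun r => e r * g r) (radialMeasure (ballWeight R)) := by
  obtain ⟨C, hC⟩ := ((isCompact_Icc (a := 0) (b := R)).image hg).isBounded.exists_norm_le
  refine he.mul_bdd (c := C) hg.aestronglyMeasurable ?_
  filter_upwards [ae_radialMeasure_ballWeight R] with r hr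
  exact hC _ ⟨r, ⟨hr.1.le, hr.2⟩, rfl⟩

theorem integrable_dot_continuous {ν : Measure R3} {R : ℝ} (hR : ∀ᵐ x ∂ν, ‖x‖ ≤ R)
    {G Φ : R3 → C3} (hG : Integrable G ν) (hΦ : Continuous Φ) :
    Integrable (fun x => dot (G x) (Φ x)) ν := by
  simp only [dot, mul_comm (G _ _)]
  exact integrable_finsetSum _ fun i _ => integrable_continuous_mul hR
    (((EuclideanSpace.proj (𝕜 := ℂ) i).continuous).comp hΦ) (integrable_apply hG i)

theorem contDiff_apply_C3 {Ψ : R3 → C3} {k : ℕ∞ω} (h : ContDiff ℝ k Ψ) (j : Fin 3) :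
    ContDiff ℝ k fun y => Ψ y j :=
  ((EuclideanSpace.proj (𝕜 := ℂ) j : C3 →L[ℂ] ℂ).restrictScalars ℝ).contDiff.comp h

theorem curl_eq_zero_of_notMem_tsupport {Ψ : R3 → C3} {x : R3} (hx : x ∉ tsupport Ψ) :
    curl Ψ x = 0 := by
  have h : ∀ i j, pd i (fun y => Ψ y j) x = 0 := fun i j => by
    have : x ∉ tsupport fun y => Ψ y j := fun h =>
      hx (closure_mono (fun y (hy : Ψ y j ≠ 0) (h0 : Ψ y = 0) => hy (by rw [h0]; rfl)) h)
    rw [pd, fderiv_eq_zero_of_notMem_tsupport this]; rfl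
  ext i
  fin_cases i <;> simp [curl, h]

theorem continuous_curl {Ψ : R3 → C3} (h : ∀ j, ContDiff ℝ 1 fun y => Ψ y j) :
    Continuous (curl Ψ) := by
  refine (PiLp.continuous_toLp 2 _).comp (continuous_pi fun i => ?_)
  have h' := fun i j => continuous_pd (h j) i
  fin_cases i
  · exact (h' _ _).sub (h' _ _)
  · exact (h' _ _).sub (h' _ _)
  · exact (h' _ _).sub (h' _ _)

variable {Ω : Set R3} {p : MvPolynomial (Fin 3) ℝ} {n : ℕ}

/-- After slicing, both sides contain `∫ e₁ A`, the pairing with the first kind. Their difference is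
`1 / (n(n+1))` times the weak radial equation, tested with `t ↦ t Y²(s) · Ψ(t s)` and integrated
over the directions `s`. -/
theorem hasWeakCurl_mode (hΩ : IsBallDomain Ω) (hn : 1 ≤ n) (hp : p ∈ solidHarmonic n)
    {e₁ e₂ : ℝ → ℂ}
    (he₁ : ∀ R, Metric.closedBall 0 R ⊆ Ω → Integrable e₁ (radialMeasure (ballWeight R)))
    (he₂ : ∀ R, Metric.closedBall 0 R ⊆ Ω → Integrable e₂ (radialMeasure (ballWeight R)))
    (h : ∀ R, Metric.closedBall 0 R ⊆ Ω → RadialDivFree (n * (n + 1)) R e₁ e₂) :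
    HasWeakCurl Ω (toroidalMode p fun r => -(1 / ((n : ℂ) * (n + 1))) * r * e₁ r)
      (poloidalMode p e₁ e₂) := by
  have hN := degree_factor_ne_zero hn
  have he₃ : ∀ R, Metric.closedBall 0 R ⊆ Ω → Integrable
      (fun r : ℝ => -(1 / ((n : ℂ) * (n + 1))) * r * e₁ r) (radialMeasure (ballWeight R)) :=
    fun R hR => by
      have := integrable_radial_mul (he₁ R hR)
        (g := fun r : ℝ => -(1 / ((n : ℂ) * (n + 1))) * r) (by fun_prop)
      simpa only [mul_comm (e₁ _)] using this
  refine ⟨locallyIntegrableOn_toroidalMode hΩ he₃ hp.1, hΩ.locallyIntegrableOn fun R hR =>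
    memLp_one_iff_integrable.1 ((isPolar_restrict_closedBall R).memLp_poloidalMode
      (memLp_one_iff_integrable.2 (he₁ R hR)) (memLp_one_iff_integrable.2 (he₂ R hR)) hp.1),
    fun Ψ hΨ => ?_⟩
  obtain ⟨R, hR0, h1, h2⟩ := hΩ.exists_closedBall _ hΨ.2.2 hΨ.2.1
  have hP := isPolar_restrict_closedBall R
  have := hP.sfinite
  have hΨj := contDiff_apply_C3 hΨ.1
  have hΨ1 : ∀ j, ContDiff ℝ 1 fun y => Ψ y j := fun j => (hΨj j).of_le (by simp)
  have hΨd : ∀ j, Differentiable ℝ fun y => Ψ y j := fun j => (hΨ1 j).differentiable (by norm_num)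
  have hz : ∀ x ∉ Metric.closedBall (0 : R3) R, Ψ x = 0 := fun x hx =>
    image_eq_zero_of_notMem_tsupport fun h => hx (h1 h)
  have hcm : Continuous fun q : ℝ × Metric.sphere (0 : R3) 1 => q.1 • q.2.1 := by fun_prop
  have hcd : ∀ (P : Fin 3 → MvPolynomial (Fin 3) ℝ) {Φ : R3 → C3}, Continuous Φ →
      Continuous fun q : ℝ × Metric.sphere (0 : R3) 1 => dot (evV P q.2.1) (Φ (q.1 • q.2.1)) :=
    fun P Φ hΦ => continuous_dot.comp
      (((continuous_evV P).comp (continuous_subtype_val.comp continuous_snd)).prodMk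
        (hΦ.comp hcm))
  have hcs : ∀ {f : ℝ × Metric.sphere (0 : R3) 1 → ℂ}, Continuous f → ∀ r,
      Integrable (fun s => f (r, s)) sphereMeasure := fun hf r =>
    continuous_integrable_sphere (hf.comp (by fun_prop))
  set N : ℂ := (n : ℂ) * (n + 1) with hNdef
  set A : ℝ → ℂ := fun r => ∫ s, dot (evV (vshPoly1 p) s.1) (Ψ (r • s.1)) ∂sphereMeasure with hA
  set B : ℝ → ℂ := fun r => ∫ s, dot (evV (vshPoly2 n p) s.1) (Ψ (r • s.1)) ∂sphereMeasure with hB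
  set b : Metric.sphere (0 : R3) 1 → ℝ → ℂ :=
    fun s t => (t : ℂ) * dot (evV (vshPoly2 n p) s.1) (Ψ (t • s.1)) with hb
  set D : ℝ → ℂ := fun r => ∫ s, deriv (b s) r ∂sphereMeasure with hD
  have hAc : Continuous A := continuous_sphere_integral (hcd _ hΨ.1.continuous)
  have hBc : Continuous B := continuous_sphere_integral (hcd _ hΨ.1.continuous)
  have hbc : Continuous fun q : ℝ × Metric.sphere (0 : R3) 1 => deriv (b q.2) q.1 := by
    have : (fun q : ℝ × Metric.sphere (0 : R3) 1 => deriv (b q.2) q.1) = fun q =>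
        dot (evV (vshPoly2 n p) q.2.1) (Ψ (q.1 • q.2.1)) +
          q.1 * ∑ j, evC (vshPoly2 n p j) q.2.1 *
            fderiv ℝ (fun y => Ψ y j) (q.1 • q.2.1) q.2.1 :=
      funext fun q => (hasDerivAt_mul_dot hΨd _ q.2 q.1).deriv
    rw [this]
    refine (hcd _ hΨ.1.continuous).add (Continuous.mul (by fun_prop)
      (continuous_finsetSum _ fun j _ => Continuous.mul
        ((continuous_evC _).comp (continuous_subtype_val.comp continuous_snd)) ?_))
    exact (((hΨ1 j).continuous_fderiv (by norm_num)).comp hcm).clm_apply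
      (continuous_subtype_val.comp continuous_snd)
  have hDc : Continuous D := continuous_sphere_integral hbc
  have hE1 := he₁ R h2
  have hE2 := he₂ R h2
  have hL : ∫ x in Ω, dot (poloidalMode p e₁ e₂ x) (Ψ x) =
      ∫ r, (e₁ r * A r + e₂ r * B r) ∂radialMeasure (ballWeight R) := by
    rw [integral_eq_closedBall h2 fun x hx => by rw [hz x hx, dot_zero_right],
      hP.integral (integrable_dot_continuous (ae_closedBall_norm_le R)
        (memLp_one_iff_integrable.1 (hP.memLp_poloidalMode
          (memLp_one_iff_integrable.2 hE1) (memLp_one_iff_integrable.2 hE2) hp.1))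
        hΨ.1.continuous)]
    refine integral_congr_ae ?_
    filter_upwards [hP.pos] with r hr
    simp only [poloidalMode_smul hr _ hp.1, dot_add_left, dot_smul_left]
    rw [integral_add ((hcs (hcd _ hΨ.1.continuous) r).const_mul _)
      ((hcs (hcd _ hΨ.1.continuous) r).const_mul _), integral_const_mul, integral_const_mul]
  have hRt : ∫ x in Ω, dot (toroidalMode p (fun r => -(1 / N) * r * e₁ r) x) (curl Ψ x) =
      ∫ r, (e₁ r * A r - N⁻¹ * (e₁ r * D r)) ∂radialMeasure (ballWeight R) := by
    rw [integral_eq_closedBall h2 fun x hx => by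
        rw [curl_eq_zero_of_notMem_tsupport fun h => hx (h1 h), dot_zero_right],
      hP.integral (integrable_dot_continuous (ae_closedBall_norm_le R)
        (memLp_one_iff_integrable.1 (hP.memLp_toroidalMode
          (memLp_one_iff_integrable.2 (he₃ R h2)) hp.1)) (continuous_curl hΨ1))]
    refine integral_congr_ae ?_
    filter_upwards [hP.pos] with r hr
    simp only [toroidalMode_smul hr _ hp.1, dot_smul_left, integral_const_mul]
    have key : (r : ℂ) * ∫ s, dot (evV (vshPoly3 p) s.1) (curl Ψ (r • s.1)) ∂sphereMeasure =
      D r - N * A r := sphere_integral_vsh3_curl_smul hp hΨ1 r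
    field_simp
    linear_combination -e₁ r * key
  have hswap : ∫ r, (e₁ r * D r + N * (e₂ r * B r)) ∂radialMeasure (ballWeight R) = 0 := by
    have hbd : ∀ {e : ℝ → ℂ} {f : ℝ × Metric.sphere (0 : R3) 1 → ℂ},
        Integrable e (radialMeasure (ballWeight R)) → Continuous f →
        Integrable (fun q : ℝ × Metric.sphere (0 : R3) 1 => e q.1 * f q)
          ((radialMeasure (ballWeight R)).prod sphereMeasure) := fun he hf => by
      obtain ⟨C, hC⟩ := (((isCompact_Icc (a := 0) (b := R)).prod isCompact_univ).image
        hf).isBounded.exists_norm_le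
      refine (he.comp_fst _).mul_bdd (c := C) hf.aestronglyMeasurable ?_
      filter_upwards [Measure.quasiMeasurePreserving_fst.ae (ae_radialMeasure_ballWeight R)]
        with q hq
      exact hC _ ⟨q, ⟨⟨hq.1.le, hq.2⟩, trivial⟩, rfl⟩
    have hi1 := hbd hE1 hbc
    have hi2 := (hbd hE2 (hcd (vshPoly2 n p) hΨ.1.continuous)).const_mul N
    calc ∫ r, (e₁ r * D r + N * (e₂ r * B r)) ∂radialMeasure (ballWeight R)
        = ∫ r, ∫ s, (e₁ r * deriv (b s) r +
            N * (e₂ r * dot (evV (vshPoly2 n p) s.1) (Ψ (r • s.1)))) ∂sphereMeasure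
              ∂radialMeasure (ballWeight R) := by
          refine integral_congr_ae (Eventually.of_forall fun r => ?_)
          dsimp only
          rw [integral_add ((hcs hbc r).const_mul _)
            (((hcs (hcd _ hΨ.1.continuous) r).const_mul _).const_mul _), integral_const_mul,
            integral_const_mul, integral_const_mul]
      _ = ∫ s, ∫ r, (e₁ r * deriv (b s) r +
            N * (e₂ r * dot (evV (vshPoly2 n p) s.1) (Ψ (r • s.1))))
              ∂radialMeasure (ballWeight R) ∂sphereMeasure :=
          integral_integral_swap (hi1.add hi2)
      _ = 0 := by
          -- With the direction `s` fixed, `b s` is an admissible radial profile: smooth, zero at `t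
          -- = 0`, and zero beyond `R` by the support of `Ψ`.
          refine integral_eq_zero_of_ae (Eventually.of_forall fun s => ?_)
          have hbs : ContDiff ℝ ∞ (b s) := by
            refine Complex.ofRealCLM.contDiff.mul (ContDiff.sum fun j _ => contDiff_const.mul ?_)
            exact (hΨj j).comp (contDiff_id.smul contDiff_const)
          have := (h R h2).integral_eq_zero hE1 hE2 hbs (by simp [hb]) fun r hr => by
            have : r • s.1 ∉ Metric.closedBall (0 : R3) R := by
              simp [norm_smul, abs_of_pos (hR0.trans hr), hr]
            simp [hb, hz _ this, dot_zero_right]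
          rw [Pi.zero_apply, ← this]
          refine integral_congr_ae ?_
          filter_upwards [hP.pos] with r hr
          have hr' : (r : ℂ) ≠ 0 := by exact_mod_cast hr.ne'
          simp only [hb]
          rw [mul_div_cancel_left₀ _ hr', mul_assoc N]
  have hi1 : Integrable (fun r => e₁ r * A r + e₂ r * B r) (radialMeasure (ballWeight R)) :=
    (integrable_radial_mul hE1 hAc).add (integrable_radial_mul hE2 hBc)
  have hi2 : Integrable (fun r => e₁ r * A r - N⁻¹ * (e₁ r * D r))
      (radialMeasure (ballWeight R)) :=
    (integrable_radial_mul hE1 hAc).sub ((integrable_radial_mul hE1 hDc).const_mul _)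
  rw [hL, hRt, ← sub_eq_zero, ← integral_sub hi1 hi2, ← mul_zero N⁻¹, ← hswap,
    ← integral_const_mul]
  refine integral_congr_ae (Eventually.of_forall fun r => ?_)
  field_simp
  ring

/-- The distributional operators determine their values. -/
theorem HasWeakCurlXGrad.ae_eq_zero (hΩ : IsOpen Ω) {g : R3 → ℂ} {H : R3 → C3}
    (h : HasWeakCurlXGrad Ω g H) (hg : ∀ᵐ x ∂volume.restrict Ω, g x = 0) :
    ∀ᵐ x ∂volume.restrict Ω, H x = 0 := by
  obtain ⟨G, hG, hH⟩ := h
  have key : ∀ F : R3 → C3, LocallyIntegrableOn F Ω →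
      (∀ i, ∀ ψ : R3 → ℂ, IsTest Ω ψ → ∫ x in Ω, F x i * ψ x = 0) →
      ∀ᵐ x ∂volume.restrict Ω, F x = 0 := by
    intro F hF h
    rw [ae_restrict_iff' hΩ.measurableSet]
    have : ∀ i, ∀ᵐ x, x ∈ Ω → F x i = 0 := fun i => by
      have hFi : LocallyIntegrableOn (fun x => F x i) Ω := fun x hx => by
        obtain ⟨U, hU, hi⟩ := hF x hx
        exact ⟨U, hU, integrable_apply hi i⟩
      refine hΩ.ae_eq_zero_of_integral_contDiff_smul_eq_zero hFi fun γ hγ hγc hs => ?_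
      have hs0 : tsupport (fun x => (γ x : ℂ)) ⊆ tsupport γ :=
        closure_mono fun x hx h0 => hx (by simp [h0])
      have h1 := h i (fun x => (γ x : ℂ)) ⟨Complex.ofRealCLM.contDiff.comp hγ,
        hγc.comp_left (g := fun r : ℝ => (r : ℂ)) Complex.ofReal_zero, hs0.trans hs⟩
      rw [← h1, setIntegral_eq_integral_of_forall_compl_eq_zero]
      · refine integral_congr_ae (Eventually.of_forall fun x => ?_)
        simp [mul_comm]
      · intro x hx
        rw [image_eq_zero_of_notMem_tsupport fun h => hx (hs (hs0 h)), mul_zero]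
    filter_upwards [this 0, this 1, this 2] with x h0 h1 h2 hx
    ext i
    fin_cases i
    · exact h0 hx
    · exact h1 hx
    · exact h2 hx
  have hG0 : ∀ᵐ x ∂volume.restrict Ω, G x = 0 := by
    refine key G hG.2.1 fun i ψ hψ => ?_
    rw [hG.2.2 ψ hψ i, neg_eq_zero]
    refine integral_eq_zero_of_ae ?_
    filter_upwards [hg] with x hx
    simp [hx]
  refine key H hH.2.1 fun i ψ hψ => ?_
  have hT : IsTest Ω fun x => (EuclideanSpace.single i (ψ x) : C3) := by
    have hs : tsupport (fun x => (EuclideanSpace.single i (ψ x) : C3)) ⊆ tsupport ψ :=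
      closure_mono fun x hx h0 => hx (by simp [h0])
    refine ⟨?_, HasCompactSupport.comp_left (g := fun z : ℂ => (EuclideanSpace.single i z : C3))
      hψ.2.1 (by simp), hs.trans hψ.2.2⟩
    rw [contDiff_piLp]
    intro j
    rcases eq_or_ne j i with rfl | hj
    · simpa using hψ.1
    · simpa [hj] using contDiff_const
  have h1 := hH.2.2 _ hT
  have h2 : ∫ x in Ω, dot (G x) (curl (fun x => (EuclideanSpace.single i (ψ x) : C3)) x) = 0 := by
    refine integral_eq_zero_of_ae ?_
    filter_upwards [hG0] with x hx
    simp [hx, dot]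
  rw [h2] at h1
  rw [← h1]
  simp [dot]

end

section
/-! ### The finite Fourier transform -/

section
open VectorFourier

/-- The kernel `exp (-i c ⟨x, τ⟩)`. -/
def fourierKernel (c : ℝ) (x τ : R3) : ℂ := Complex.exp (-(Complex.I * c * (inner ℝ x τ : ℝ)))

/-- The bilinear form `(c / 2π) ⟨τ, x⟩`. -/
def fourierForm (c : ℝ) : R3 →L[ℝ] R3 →L[ℝ] ℝ := (c / (2 * Real.pi)) • innerSL ℝ

variable {V : Type*} [NormedAddCommGroup V] [NormedSpace ℂ V] {c α : ℝ}

theorem finiteFourier_eq (c α : ℝ) (φ : R3 → V) (x : R3) :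
    finiteFourier c α φ x = ∫ τ, fourierKernel c x τ • φ τ ∂ballMeasure α := by
  rw [ballMeasure, integral_withDensity_eq_integral_toReal_smul (by fun_prop) (by simp),
    finiteFourier]
  have hm : MeasurableSet unitBall := Metric.isClosed_closedBall.measurableSet
  refine setIntegral_congr_fun hm fun τ hτ => ?_
  have h1 : ‖τ‖ ≤ 1 := by simpa [unitBall] using hτ
  have h2 : 0 ≤ (1 - ‖τ‖ ^ 2) ^ α := Real.rpow_nonneg (by nlinarith [norm_nonneg τ]) _
  rw [ENNReal.toReal_ofReal h2, ← Complex.coe_smul, smul_smul, mul_comm]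
  rfl

theorem fourierForm_apply (c : ℝ) (τ x : R3) :
    fourierForm c τ x = c / (2 * Real.pi) * inner ℝ x τ := by
  rw [real_inner_comm]; rfl

/-- The factor `c / 2π` in `fourierForm` absorbs the `2π` of the standard character, so the general
theory of Fourier integrals applies. -/
theorem fourierChar_eq (c : ℝ) (x τ : R3) (v : V) :
    Real.fourierChar (-(fourierForm c).toLinearMap₁₂ τ x) • v = fourierKernel c x τ • v := by
  have hπ : (Real.pi : ℂ) ≠ 0 := by exact_mod_cast Real.pi_ne_zero
  rw [Circle.smul_def, Real.fourierChar_apply, fourierKernel]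
  congr 2
  simp only [ContinuousLinearMap.toLinearMap₁₂_apply_apply_apply, fourierForm_apply]
  push_cast
  field_simp

theorem finiteFourier_eq_fourierIntegral (c α : ℝ) (φ : R3 → V) :
    finiteFourier c α φ =
      fourierIntegral Real.fourierChar (ballMeasure α) (fourierForm c).toLinearMap₁₂ φ := by
  ext x
  rw [finiteFourier_eq, fourierIntegral]
  simp only [fourierChar_eq]

theorem continuous_fourierKernel (c : ℝ) (x : R3) : Continuous (fourierKernel c x) := by
  unfold fourierKernel; fun_prop

theorem norm_fourierKernel (c : ℝ) (x τ : R3) : ‖fourierKernel c x τ‖ = 1 := by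
  rw [fourierKernel, Complex.norm_exp]
  simp

theorem integrable_fourierKernel_smul {μ : Measure R3} {φ : R3 → V} (hφ : Integrable φ μ)
    (c : ℝ) (x : R3) : Integrable (fun τ => fourierKernel c x τ • φ τ) μ :=
  hφ.bdd_smul 1 (continuous_fourierKernel c x).aestronglyMeasurable
    (Eventually.of_forall fun τ => (norm_fourierKernel c x τ).le)

theorem integrable_pow_mul_norm {V : Type*} [NormedAddCommGroup V] {φ : R3 → V} (hφ : Integrable φ (ballMeasure α)) (n : ℕ) :
    Integrable (fun τ => ‖τ‖ ^ n * ‖φ τ‖) (ballMeasure α) := by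
  refine hφ.norm.bdd_mul (c := 1) (by fun_prop) ?_
  filter_upwards [ae_ballMeasure_norm_le α] with τ hτ
  rw [norm_pow, norm_norm]
  exact pow_le_one₀ (norm_nonneg _) hτ

/-- The measure lives on the unit ball, so all moments are finite and one may differentiate under
the integral indefinitely. -/
theorem contDiff_finiteFourier {φ : R3 → V} (hφ : Integrable φ (ballMeasure α)) :
    ContDiff ℝ ∞ (finiteFourier c α φ) := by
  rw [finiteFourier_eq_fourierIntegral]
  exact contDiff_fourierIntegral _ fun n _ => integrable_pow_mul_norm hφ n

theorem fderiv_finiteFourier [CompleteSpace V] {φ : R3 → V} (hφ : Integrable φ (ballMeasure α))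
    (x v : R3) : fderiv ℝ (finiteFourier c α φ) x v =
      -(Complex.I * c) • ∫ τ, ((inner ℝ v τ : ℝ) * fourierKernel c x τ) • φ τ ∂ballMeasure α := by
  have h1 : Integrable (fun τ => ‖τ‖ * ‖φ τ‖) (ballMeasure α) := by
    simpa using integrable_pow_mul_norm hφ 1
  have h := hasFDerivAt_fourierIntegral (fourierForm c) hφ h1 x
  have hπ : (Real.pi : ℂ) ≠ 0 := by exact_mod_cast Real.pi_ne_zero
  have hint : Integrable (fun τ => fourierKernel c x τ • fourierSMulRight (fourierForm c) φ τ)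
      (ballMeasure α) := by
    refine integrable_fourierKernel_smul ?_ c x
    refine (h1.const_mul (2 * Real.pi * ‖fourierForm c‖)).mono'
      hφ.1.fourierSMulRight (Eventually.of_forall fun τ => ?_)
    simpa only [mul_assoc] using norm_fourierSMulRight_le (fourierForm c) φ τ
  rw [finiteFourier_eq_fourierIntegral, h.fderiv, fourierIntegral]
  simp only [fourierChar_eq]
  rw [ContinuousLinearMap.integral_apply hint, ← integral_smul]
  refine integral_congr_ae (Eventually.of_forall fun τ => ?_)
  simp only [smul_apply, fourierSMulRight_apply]
  rw [← Complex.coe_smul (_ : ℝ) (φ τ), smul_smul, smul_smul, smul_smul]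
  congr 1
  simp only [fourierForm_apply]
  push_cast
  field_simp

theorem pd_finiteFourier {φ : R3 → ℂ} (hφ : Integrable φ (ballMeasure α)) (i : Fin 3) (x : R3) :
    pd i (finiteFourier c α φ) x =
      -(Complex.I * c) * finiteFourier c α (fun τ => (τ i : ℂ) * φ τ) x := by
  rw [pd, fderiv_finiteFourier hφ, finiteFourier_eq, smul_eq_mul]
  congr 1
  refine integral_congr_ae (Eventually.of_forall fun τ => ?_)
  simp [EuclideanSpace.inner_single_left]
  ring

theorem finiteFourier_apply {W : R3 → C3} (hW : Integrable W (ballMeasure α)) (x : R3)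
    (i : Fin 3) : finiteFourier c α W x i = finiteFourier c α (fun τ => W τ i) x := by
  rw [finiteFourier_eq, finiteFourier_eq]
  exact ((EuclideanSpace.proj (𝕜 := ℂ) i : C3 →L[ℂ] ℂ).integral_comp_comm
    (integrable_fourierKernel_smul hW c x)).symm

theorem finiteFourier_smul (z : ℂ) (φ : R3 → V) (x : R3) :
    finiteFourier c α (fun τ => z • φ τ) x = z • finiteFourier c α φ x := by
  simp only [finiteFourier_eq, smul_comm _ z, integral_smul]

theorem finiteFourier_congr {φ ψ : R3 → V} (h : ∀ᵐ τ ∂ballMeasure α, φ τ = ψ τ) (x : R3) :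
    finiteFourier c α φ x = finiteFourier c α ψ x := by
  rw [finiteFourier_eq, finiteFourier_eq]
  refine integral_congr_ae ?_
  filter_upwards [h] with τ hτ
  rw [hτ]

theorem integrable_continuous_mul_ballMeasure {f g : R3 → ℂ} (hf : Continuous f)
    (hg : Integrable g (ballMeasure α)) : Integrable (fun x => f x * g x) (ballMeasure α) :=
  integrable_continuous_mul (ae_ballMeasure_norm_le α) hf hg

/-- Each `∂ᵢ` brings down `-i c τᵢ`. The divergence of the transform therefore sees only the radial
component of `W`. -/
theorem divergence_finiteFourier {W : R3 → C3} (hW : Integrable W (ballMeasure α)) (x : R3) :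
    divergence (finiteFourier c α W) x =
      -(Complex.I * c) * finiteFourier c α (fun τ => ∑ i, (τ i : ℂ) * W τ i) x := by
  have h1 := integrable_apply hW
  have h2 : ∀ i : Fin 3, Integrable (fun τ : R3 => (τ i : ℂ) * W τ i) (ballMeasure α) := fun i =>
    integrable_continuous_mul_ballMeasure (by fun_prop) (h1 i)
  simp only [divergence, finiteFourier_apply hW]
  have h3 : ∀ i, pd i (fun y => finiteFourier c α (fun τ => W τ i) y) x = _ :=
    fun i => pd_finiteFourier (h1 i) i x
  simp only [h3]
  simp only [finiteFourier_eq, smul_eq_mul, Finset.mul_sum]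
  rw [integral_finsetSum _ fun i _ => by
    simpa using integrable_fourierKernel_smul (h2 i) c x, Finset.mul_sum]

/-- Differentiating in the open ball shows that the transform of `p φ` vanishes there for every
polynomial `p`. At the origin this says that all moments of `φ` are zero. -/
theorem ae_eq_zero_of_finiteFourier (hc : c ≠ 0) {φ : R3 → ℂ} (hφ : Integrable φ (ballMeasure α))
    (h : ∀ x ∈ Metric.ball (0 : R3) 1, finiteFourier c α φ x = 0) :
    ∀ᵐ x ∂ballMeasure α, φ x = 0 := by
  have hp : ∀ p, Integrable (fun τ => evC p τ * φ τ) (ballMeasure α) := fun p =>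
    integrable_continuous_mul_ballMeasure (continuous_evC p) hφ
  have key : ∀ p, ∀ x ∈ Metric.ball (0 : R3) 1,
      finiteFourier c α (fun τ => evC p τ * φ τ) x = 0 := by
    intro p
    induction p using MvPolynomial.induction_on with
    | C a =>
      intro x hx
      have := finiteFourier_smul (c := c) (α := α) (a : ℂ) φ x
      simp only [evC_C]
      rw [h x hx, smul_zero] at this
      exact this
    | add p q h1 h2 =>
      intro x hx
      have e1 := h1 x hx
      have e2 := h2 x hx
      rw [finiteFourier_eq] at e1 e2 ⊢
      simp only [evC_add, add_mul, smul_add]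
      rw [integral_add (integrable_fourierKernel_smul (hp p) c x)
        (integrable_fourierKernel_smul (hp q) c x), e1, e2, add_zero]
    | mul_X p i ih =>
      intro x hx
      have h1 := pd_finiteFourier (c := c) (hp p) i x
      have h2 : finiteFourier c α (fun τ => evC p τ * φ τ) =ᶠ[𝓝 x] fun _ => 0 := by
        filter_upwards [Metric.isOpen_ball.mem_nhds hx] with y hy using ih y hy
      rw [pd, h2.fderiv_eq] at h1
      simp only [fderiv_fun_const, Pi.zero_apply, zero_apply] at h1
      have h3 : -(Complex.I * (c : ℂ)) ≠ 0 := by simp [hc]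
      have h4 := (mul_eq_zero.1 h1.symm).resolve_left h3
      rw [← h4]
      congr 1
      ext τ
      simp only [evC_mul, evC_X]
      ring
  refine ae_eq_zero_of_integral_eval_smul (isCompact_closedBall (0 : R3) 1)
    (ballMeasure_compl_unitBall α) hφ fun p => ?_
  have := key p 0 (by simp)
  rw [finiteFourier_eq] at this
  simpa [fourierKernel, evC, Complex.real_smul] using this

theorem contDiff_fourierKernel (c : ℝ) (x : R3) : ContDiff ℝ ∞ (fourierKernel c x) := by
  have : ContDiff ℝ ∞ fun τ : R3 => (inner ℝ x τ : ℝ) := contDiff_const.inner ℝ contDiff_id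
  exact (contDiff_const.mul (Complex.ofRealCLM.contDiff.comp this)).neg.cexp

theorem xGrad_fourierKernel (c : ℝ) (x τ : R3) (i : Fin 3) :
    xGrad (fourierKernel c x) τ i =
      Complex.I * c * ((inner ℝ (rotGen i x) τ : ℝ) * fourierKernel c x τ) := by
  have h1 : HasFDerivAt (fun τ : R3 => (inner ℝ x τ : ℝ)) (innerSL ℝ x) τ :=
    (innerSL ℝ x).hasFDerivAt
  have h2 := (((Complex.ofRealCLM.hasFDerivAt.comp τ h1).const_mul (Complex.I * c)).neg).cexp
  have h3 : fderiv ℝ (fourierKernel c x) τ = _ := h2.fderiv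
  rw [xGrad_apply, h3]
  simp [fourierKernel, inner_rotGen]
  ring

/-- On the kernel, `x × ∇` in `τ` is minus the same operator in `x`, because `⟨x, τ⟩` is invariant
under a common rotation. This sign cancels the one from integration by parts. `G` is only required
to be `x × ∇ g` weakly. -/
theorem finiteFourier_eq_xGrad {g : R3 → ℂ} {G : R3 → C3} (hg : Integrable g (ballMeasure α))
    (hG : Integrable G (ballMeasure α))
    (h : ∀ f : R3 → ℂ, ContDiff ℝ 1 f → ∀ i,
      ∫ x, f x * G x i ∂ballMeasure α = -∫ x, xGrad f x i * g x ∂ballMeasure α) (x : R3) :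
    finiteFourier c α G x = xGrad (finiteFourier c α g) x := by
  ext i
  rw [finiteFourier_apply hG, finiteFourier_eq, xGrad_apply, fderiv_finiteFourier hg]
  simp only [smul_eq_mul]
  rw [h _ ((contDiff_fourierKernel c x).of_le (by simp)) i]
  simp only [xGrad_fourierKernel, mul_assoc, integral_const_mul]
  ring

end

end

section
/-! ### Expansion of divergence-free fields -/

section
variable {Ω : Set R3} {Y : (n : ℕ) → Fin (2 * n + 1) → MvPolynomial (Fin 3) ℝ}
  {p : MvPolynomial (Fin 3) ℝ} {n : ℕ} {E : R3 → C3} {R α : ℝ}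

theorem memLp_one_closedBall (hE : LocallyIntegrableOn E Ω) (hR : Metric.closedBall 0 R ⊆ Ω) :
    MemLp E 1 (volume.restrict (Metric.closedBall 0 R)) :=
  memLp_one_iff_integrable.2 (hE.integrableOn_compact_subset hR (isCompact_closedBall _ _))

theorem integrable_coeff1 (hE : LocallyIntegrableOn E Ω) (hR : Metric.closedBall 0 R ⊆ Ω)
    (p : MvPolynomial (Fin 3) ℝ) :
    Integrable (coeff1 p E) (radialMeasure (ballWeight R)) :=
  memLp_one_iff_integrable.1 ((isPolar_restrict_closedBall R).memLp_coeff1 le_rfl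
    ENNReal.one_ne_top (memLp_one_closedBall hE hR) p)

theorem integrable_coeff2 (hE : LocallyIntegrableOn E Ω) (hR : Metric.closedBall 0 R ⊆ Ω)
    (hp : p.IsHomogeneous n) : Integrable (coeff2 n p E) (radialMeasure (ballWeight R)) :=
  memLp_one_iff_integrable.1 ((isPolar_restrict_closedBall R).memLp_coeff2 le_rfl
    ENNReal.one_ne_top (memLp_one_closedBall hE hR) hp)

theorem integrable_coeff3 (hE : LocallyIntegrableOn E Ω) (hR : Metric.closedBall 0 R ⊆ Ω)
    (hp : p.IsHomogeneous n) : Integrable (coeff3 n p E) (radialMeasure (ballWeight R)) :=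
  memLp_one_iff_integrable.1 ((isPolar_restrict_closedBall R).memLp_coeff3 le_rfl
    ENNReal.one_ne_top (memLp_one_closedBall hE hR) hp)

theorem hasWeakCurlXGrad_of_weakDivFree (hΩ : IsBallDomain Ω) (hE : WeakDivFree Ω E)
    (hn : 1 ≤ n) (hp : p ∈ solidHarmonic n) :
    HasWeakCurlXGrad Ω (poloidalPotential n p (coeff1 p E))
      (poloidalMode p (coeff1 p E) (coeff2 n p E)) := by
  refine ⟨_, hasWeakXGrad_mode hΩ (fun R hR => ?_) hp.1,
    hasWeakCurl_mode hΩ hn hp (fun R hR => integrable_coeff1 hE.1 hR p)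
      (fun R hR => integrable_coeff2 hE.1 hR hp.1)
      fun R hR => radialDivFree_of_weakDivFree hE hR hn hp.1⟩
  have := integrable_radial_mul (integrable_coeff1 hE.1 hR p)
    (g := fun r : ℝ => -(1 / ((n : ℂ) * (n + 1))) * r) (by fun_prop)
  simpa only [mul_comm (coeff1 p E _)] using this

theorem coeff2_zero (p : MvPolynomial (Fin 3) ℝ) (E : R3 → C3) (r : ℝ) : coeff2 0 p E r = 0 := by
  simp [coeff2, radialCoeff]

theorem coeff3_zero (p : MvPolynomial (Fin 3) ℝ) (E : R3 → C3) (r : ℝ) : coeff3 0 p E r = 0 := by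
  simp [coeff3, radialCoeff]

theorem sum_range_succ_eq_sum_Icc {M : Type*} [AddCommMonoid M] (f : ℕ → M) (N : ℕ) :
    ∑ n ∈ Finset.range (N + 1), f n = f 0 + ∑ n ∈ Finset.Icc 1 N, f n := by
  rw [Finset.range_eq_Ico, Finset.sum_eq_sum_Ico_succ_bot (by omega)]
  rfl

/-- The divergence condition is used only to drop the term of degree 0. The hypothesis `hρ` is the
exhaustion of `Ω` by closed balls, which treats the whole space and the ball together. -/
theorem tendsto_expansion_of_weakDivFree {ν : Measure R3} {ρ : Measure ℝ} (hP : IsPolar ν ρ)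
    (hρ : ∀ P : ℝ → Prop, (∀ R, Metric.closedBall 0 R ⊆ Ω → ∀ᵐ r : ℝ, r ∈ Set.Ioo 0 R → P r) →
      ∀ᵐ r ∂ρ, P r)
    (hY : IsSphericalHarmonicSystem Y) (hE2 : MemLp E 2 ν) (hE : WeakDivFree Ω E) :
    Tendsto (fun N : ℕ => eLpNorm (fun x => E x - ∑ n ∈ Finset.Icc 1 N, vshTerm Y E n x) 2 ν)
      atTop (𝓝 0) := by
  have h0 : ∀ᵐ x ∂ν, vshTerm Y E 0 x = 0 := by
    have h1 : ∀ᵐ r ∂ρ, ∀ ℓ, coeff1 (Y 0 ℓ) E r = 0 := ae_all_iff.2 fun ℓ =>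
      hρ _ fun R hR => ae_coeff1_eq_zero_of_weakDivFree hE hR (hY.homogeneous 0 ℓ)
    filter_upwards [hP.ae_norm h1] with x hx
    simp [vshTerm, toroidalMode, poloidalMode, coeff2_zero, coeff3_zero, hx]
  refine (hP.vsh_expansion hY hE2).congr fun N => eLpNorm_congr_ae ?_
  filter_upwards [h0] with x hx
  rw [sum_range_succ_eq_sum_Icc, hx, zero_add]

theorem ae_radialMeasure_one {P : ℝ → Prop}
    (h : ∀ R, Metric.closedBall (0 : R3) R ⊆ Set.univ → ∀ᵐ r : ℝ, r ∈ Set.Ioo 0 R → P r) :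
    ∀ᵐ r ∂radialMeasure 1, P r := by
  rw [ae_radialMeasure_iff measurable_one]
  have h1 : ∀ᵐ r : ℝ, ∀ k : ℕ, r ∈ Set.Ioo (0 : ℝ) k → P r :=
    ae_all_iff.2 fun k => h k (Set.subset_univ _)
  filter_upwards [h1] with r hr h0 _
  obtain ⟨k, hk⟩ := exists_nat_gt r
  exact hr k ⟨h0, hk⟩

theorem ae_radialMeasure_jacobi {P : ℝ → Prop}
    (h : ∀ R, Metric.closedBall (0 : R3) R ⊆ Metric.ball 0 1 → ∀ᵐ r : ℝ, r ∈ Set.Ioo 0 R → P r) :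
    ∀ᵐ r ∂radialMeasure (jacobiWeight α), P r := by
  rw [ae_jacobi_iff]
  have h1 : ∀ᵐ r : ℝ, ∀ k : ℕ, r ∈ Set.Ioo (0 : ℝ) (1 - 1 / (k + 1)) → P r :=
    ae_all_iff.2 fun k => h _ (Metric.closedBall_subset_ball (by
      have : (0 : ℝ) < 1 / (k + 1) := by positivity
      linarith))
  filter_upwards [h1] with r hr h0
  obtain ⟨k, hk⟩ := exists_nat_one_div_lt (sub_pos.2 h0.2)
  exact hr k ⟨h0.1, by linarith⟩

/-! ### Fields with vanishing radial part -/

theorem ae_coeff1_eq_zero (h : ∀ᵐ x ∂ballMeasure α, ∑ i, (x i : ℂ) * E x i = 0)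
    (p : MvPolynomial (Fin 3) ℝ) :
    ∀ᵐ r ∂radialMeasure (jacobiWeight α), coeff1 p E r = 0 := by
  have hP := isPolar_ballMeasure α
  filter_upwards [hP.ae h, hP.pos] with r hr h0
  rw [coeff1_eq, sphereCoeff, inv_one, one_mul]
  refine integral_eq_zero_of_ae ?_
  filter_upwards [hr] with s hs
  have hr' : (r : ℂ) ≠ 0 := by exact_mod_cast h0.ne'
  have h2 : (r : ℂ) * ∑ i, (s.1 i : ℂ) * E (r • s.1) i = 0 := by
    rw [← hs, Finset.mul_sum]
    exact Finset.sum_congr rfl fun i _ => by simp [mul_assoc]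
  have h3 := (mul_eq_zero.1 h2).resolve_left hr'
  rw [Pi.zero_apply, dot_evV, ← mul_zero (evC p s.1), ← h3, Finset.mul_sum]
  exact Finset.sum_congr rfl fun i _ => by simp [vshPoly1]; ring

theorem ae_coeff2_eq_zero (h : ∀ᵐ x ∂ballMeasure α, E x = 0) (hp : p.IsHomogeneous n) :
    ∀ᵐ r ∂radialMeasure (jacobiWeight α), coeff2 n p E r = 0 := by
  have hP := isPolar_ballMeasure α
  filter_upwards [hP.ae h] with r hr
  rw [coeff2_eq hp, sphereCoeff, integral_eq_zero_of_ae, mul_zero]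
  filter_upwards [hr] with s hs
  simp [hs, dot]

theorem ae_eq_zero_of_hasWeakCurlXGrad {e₁ e₂ : ℝ → ℂ}
    (h : HasWeakCurlXGrad (Metric.ball 0 1) (poloidalPotential n p e₁) (poloidalMode p e₁ e₂))
    (he : ∀ᵐ r ∂radialMeasure (jacobiWeight α), e₁ r = 0) :
    ∀ᵐ x ∂ballMeasure α, poloidalMode p e₁ e₂ x = 0 := by
  rw [← ae_restrict_unitBall_iff, ← ae_restrict_ball_iff]
  refine h.ae_eq_zero Metric.isOpen_ball ?_
  rw [ae_restrict_ball_iff, ae_restrict_unitBall_iff (α := α)]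
  filter_upwards [(isPolar_ballMeasure α).ae_norm he] with x hx
  simp [poloidalPotential, scalarMode, hx]

/-- The potential contains only `e₁`. If `e₁` vanishes, so do the potential and the whole mode, and
orthogonality reads off `e₂ = 0`. -/
theorem ae_coeff2_of_hasWeakCurlXGrad (hY : IsSphericalHarmonicSystem Y) (hn : 1 ≤ n)
    (ℓ : Fin (2 * n + 1)) {e₁ e₂ : ℝ → ℂ}
    (h : HasWeakCurlXGrad (Metric.ball 0 1) (poloidalPotential n (Y n ℓ) e₁)
      (poloidalMode (Y n ℓ) e₁ e₂))
    (he : ∀ᵐ r ∂radialMeasure (jacobiWeight α), e₁ r = 0) :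
    ∀ᵐ r ∂radialMeasure (jacobiWeight α), e₂ r = 0 := by
  filter_upwards [ae_coeff2_eq_zero (ae_eq_zero_of_hasWeakCurlXGrad h he) (hY.homogeneous n ℓ),
    (isPolar_ballMeasure α).pos] with r hr h0
  rw [← hr, coeff2_poloidalMode hY hn ℓ e₁ e₂ h0]

theorem integrable_ballMeasure {V : Type*} [NormedAddCommGroup V] (hα : -1 < α) {f : R3 → V}
    (hf : MemLp f 2 (ballMeasure α)) : Integrable f (ballMeasure α) :=
  have := isFiniteMeasure_ballMeasure hα
  hf.integrable (by norm_num)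

/-- The divergence is `-i c` times the transform of `x · W`, and the transform is injective even
when known only on the open ball. -/
theorem ae_radial_eq_zero_of_divergence {c : ℝ} (hc : 0 < c) {W : R3 → C3}
    (hW : Integrable W (ballMeasure α))
    (h : ∀ x ∈ Metric.ball (0 : R3) 1, divergence (finiteFourier c α W) x = 0) :
    ∀ᵐ x ∂ballMeasure α, ∑ i, (x i : ℂ) * W x i = 0 := by
  refine ae_eq_zero_of_finiteFourier hc.ne' (integrable_finsetSum _ fun i _ =>
    integrable_continuous_mul_ballMeasure (by fun_prop) (integrable_apply hW i)) fun x hx => ?_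
  have h1 := h x hx
  rw [divergence_finiteFourier hW] at h1
  refine (mul_eq_zero.1 h1).resolve_left ?_
  simp [hc.ne']

theorem sum_mul_xGrad (f : R3 → ℂ) (x : R3) : ∑ i, (x i : ℂ) * xGrad f x i = 0 := by
  simp only [Fin.sum_univ_three, xGrad, Matrix.cons_val]
  ring

theorem divergence_finiteFourier_toroidalMode {c : ℝ} {e : ℝ → ℂ}
    (h : Integrable (toroidalMode p e) (ballMeasure α)) (x : R3) :
    divergence (finiteFourier c α (toroidalMode p e)) x = 0 := by
  rw [divergence_finiteFourier h]
  have : ∀ τ : R3, ∑ i, (τ i : ℂ) * toroidalMode p e τ i = 0 := fun τ => by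
    rw [← mul_zero (e ‖τ‖), ← sum_mul_xGrad (angular p) τ, Finset.mul_sum]
    exact Finset.sum_congr rfl fun i _ => by simp [toroidalMode, vsh3]; ring
  simp [this, finiteFourier_eq]

end

/-! ### Eigenfunctions -/

section
variable {V : Type*} [NormedAddCommGroup V] {c α : ℝ} {z : ℂ}

theorem eqOn_ball_of_ae {f g : R3 → V} (hf : Continuous f) (hg : Continuous g)
    (h : ∀ᵐ x ∂volume.restrict unitBall, f x = g x) : ∀ x ∈ Metric.ball (0 : R3) 1, f x = g x :=
  Measure.eqOn_open_of_ae_eq (ae_restrict_ball_iff.2 h) Metric.isOpen_ball hf.continuousOn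
    hg.continuousOn

/-- Injectivity of the transform. Dividing by the eigenvalue is what makes eigenfunctions smooth. -/
theorem IsEigenfunction.scalar_ne_zero (hc : 0 < c) (hα : -1 < α) {φ : R3 → ℂ}
    (h : IsEigenfunction c α z φ) : z ≠ 0 := by
  rintro rfl
  have hi := integrable_ballMeasure hα h.memLp
  refine h.ne_zero (ae_restrict_unitBall_iff.2 (ae_eq_zero_of_finiteFourier hc.ne' hi ?_))
  refine eqOn_ball_of_ae (contDiff_finiteFourier hi).continuous continuous_const ?_
  simpa using h.eigen

theorem IsEigenfunction.vector_ne_zero (hc : 0 < c) (hα : -1 < α) {E : R3 → C3}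
    (h : IsEigenfunction c α z E) : z ≠ 0 := by
  rintro rfl
  have hi := integrable_ballMeasure hα h.memLp
  have h0 : ∀ x ∈ Metric.ball (0 : R3) 1, finiteFourier c α E x = 0 := by
    refine eqOn_ball_of_ae (contDiff_finiteFourier hi).continuous continuous_const ?_
    simpa using h.eigen
  refine h.ne_zero ((ae_restrict_unitBall_iff (α := α)).2 ?_)
  have h1 : ∀ᵐ x ∂ballMeasure α, ∀ i, E x i = 0 := ae_all_iff.2 fun i =>
    ae_eq_zero_of_finiteFourier hc.ne' (integrable_apply hi i) fun x hx => by
      rw [← finiteFourier_apply hi, h0 x hx]; rfl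
  filter_upwards [h1] with x hx
  ext i
  exact hx i

theorem memLp_ballMeasure_of_continuous (hα : -1 < α) {f : R3 → V}
    (hf : Continuous f) [SecondCountableTopology V] : MemLp f 2 (ballMeasure α) := by
  have := isFiniteMeasure_ballMeasure hα
  borelize V
  obtain ⟨C, hC⟩ := ((isCompact_closedBall (0 : R3) 1).image hf).isBounded.exists_norm_le
  refine MemLp.of_bound hf.measurable.aestronglyMeasurable C ?_
  filter_upwards [ae_ballMeasure_norm_le α] with x hx
  exact hC _ ⟨x, by simpa using hx, rfl⟩

theorem IsPolar.integral_mul_xGrad {ν : Measure R3} {ρ : Measure ℝ} (h : IsPolar ν ρ)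
    {f g : R3 → ℂ} (hf : ContDiff ℝ 1 f) (hg : ContDiff ℝ 1 g) (i : Fin 3)
    (h1 : Integrable (fun x => f x * xGrad g x i) ν)
    (h2 : Integrable (fun x => xGrad f x i * g x) ν) :
    ∫ x, f x * xGrad g x i ∂ν = -∫ x, xGrad f x i * g x ∂ν := by
  rw [h.integral h1, h.integral h2, ← integral_neg]
  refine integral_congr_ae (Eventually.of_forall fun r => ?_)
  have hs : ContDiff ℝ 1 fun y : R3 => r • y := contDiff_const_smul r
  have := sphere_integral_mul_xGrad (hf.comp hs) (hg.comp hs) i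
  simp only [Function.comp_def, xGrad_comp_smul (hf.differentiable (by norm_num)),
    xGrad_comp_smul (hg.differentiable (by norm_num))] at this
  exact this

/-- The operator is tangential to the boundary sphere, so there is no boundary term, even where the
weight is singular. -/
theorem integral_ballMeasure_mul_xGrad (hα : -1 < α) {f g : R3 → ℂ} (hf : ContDiff ℝ 1 f)
    (hg : ContDiff ℝ 1 g) (i : Fin 3) :
    ∫ x, f x * xGrad g x i ∂ballMeasure α = -∫ x, xGrad f x i * g x ∂ballMeasure α :=
  (isPolar_ballMeasure α).integral_mul_xGrad hf hg i
    (integrable_ballMeasure hα (memLp_ballMeasure_of_continuous hα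
      (hf.continuous.mul (continuous_xGrad hg i))))
    (integrable_ballMeasure hα (memLp_ballMeasure_of_continuous hα
      ((continuous_xGrad hf i).mul hg.continuous)))

theorem contDiff_pd {f : R3 → ℂ} (hf : ContDiff ℝ ∞ f) (i : Fin 3) : ContDiff ℝ ∞ (pd i f) :=
  (hf.fderiv_right (m := ∞) (by simp)).clm_apply contDiff_const

theorem contDiff_xGrad_apply {f : R3 → ℂ} (hf : ContDiff ℝ ∞ f) (i : Fin 3) :
    ContDiff ℝ ∞ fun x => xGrad f x i := by
  simp only [xGrad_apply]
  exact (hf.fderiv_right (m := ∞) (by simp)).clm_apply (rotGen i).contDiff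

theorem continuous_xGrad_C3 {f : R3 → ℂ} (hf : ContDiff ℝ 1 f) : Continuous (xGrad f) := by
  have : xGrad f = fun x => WithLp.toLp 2 fun i => xGrad f x i := rfl
  rw [this]
  exact (PiLp.continuous_toLp 2 _).comp (continuous_pi fun i => continuous_xGrad hf i)

theorem pd_pd_comm {f : R3 → ℂ} (hf : ContDiff ℝ ∞ f) (i j : Fin 3) (x : R3) :
    pd i (pd j f) x = pd j (pd i f) x := by
  have hd : Differentiable ℝ (fderiv ℝ f) :=
    (hf.fderiv_right (m := ∞) (by simp)).differentiable (by simp)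
  have h : ∀ a b : Fin 3, pd a (pd b f) x =
      fderiv ℝ (fderiv ℝ f) x (EuclideanSpace.single a 1) (EuclideanSpace.single b 1) :=
    fun a b => by
      have h1 := (hd x).hasFDerivAt.clm_apply
        (hasFDerivAt_const (EuclideanSpace.single b (1 : ℝ) : R3) x)
      have h2 : fderiv ℝ (pd b f) x = _ := h1.fderiv
      rw [pd, h2]
      simp
  rw [h, h]
  exact (hf.contDiffAt.isSymmSndFDerivAt (by
    simpa using (WithTop.coe_le_coe.2 (le_top : (2 : ℕ∞) ≤ ⊤)))) _ _

theorem divergence_xGrad {f : R3 → ℂ} (hf : ContDiff ℝ ∞ f) (x : R3) :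
    divergence (xGrad f) x = 0 := by
  have hX : ∀ a b : Fin 3, ∀ i, pd i (fun y => (y a : ℂ) * pd b f y) x =
      (if a = i then 1 else 0) * pd b f x + x a * pd i (pd b f) x := fun a b i => by
    have h1 : DifferentiableAt ℝ (pd b f) x := (contDiff_pd hf b).differentiable (by simp) x
    have h2 := fderiv_fun_mul (differentiable_evC (MvPolynomial.X a) x) h1
    simp only [evC_X] at h2
    rw [pd, h2]
    have h3 : pd i (evC (MvPolynomial.X a)) x = if a = i then 1 else 0 := by
      rw [pd_evC, MvPolynomial.pderiv_X, Pi.single_apply]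
      split_ifs <;> simp_all
    rw [pd] at h3
    simp only [add_apply, smul_apply, h3, smul_eq_mul]
    rw [show fderiv ℝ (pd b f) x (EuclideanSpace.single i 1) = pd i (pd b f) x from rfl]
    ring
  have hd : ∀ a b : Fin 3, DifferentiableAt ℝ (fun y : R3 => (y a : ℂ) * pd b f y) x :=
    fun a b => by
      have h1 : DifferentiableAt ℝ (pd b f) x := (contDiff_pd hf b).differentiable (by simp) x
      have h2 := (differentiable_evC (MvPolynomial.X a) x).mul h1
      simpa [Pi.mul_def] using h2
  have h : ∀ i, pd i (fun y => xGrad f y i) x =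
      (x (i + 1) : ℂ) * pd i (pd (i + 2) f) x - x (i + 2) * pd i (pd (i + 1) f) x := fun i => by
    simp only [xGrad_apply']
    rw [pd, fderiv_fun_sub (hd _ _) (hd _ _), sub_apply]
    have e1 := hX (i + 1) (i + 2) i
    have e2 := hX (i + 2) (i + 1) i
    rw [pd] at e1 e2
    rw [e1, e2, if_neg (by fin_cases i <;> decide), if_neg (by fin_cases i <;> decide)]
    ring
  simp only [divergence, h, Fin.sum_univ_three, zero_add, show (1 : Fin 3) + 1 = 2 from rfl,
    show (1 : Fin 3) + 2 = 0 from rfl, show (2 : Fin 3) + 1 = 0 from rfl,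
    show (2 : Fin 3) + 2 = 1 from rfl]
  rw [pd_pd_comm hf 0 2, pd_pd_comm hf 1 0, pd_pd_comm hf 2 1]
  ring

theorem integral_dot_grad {Ω : Set R3} {G : R3 → C3} (hG : ∀ i, ContDiff ℝ 1 fun y => G y i)
    {ψ : R3 → ℂ} (hψ : IsTest Ω ψ) :
    ∫ x in Ω, dot (G x) (grad ψ x) = -∫ x in Ω, divergence G x * ψ x := by
  have hψ1 : ContDiff ℝ 1 ψ := hψ.1.of_le (by simp)
  rw [setIntegral_eq_integral_of_forall_compl_eq_zero fun x hx => by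
      rw [grad_eq_zero_of_notMem_tsupport fun h => hx (hψ.2.2 h), dot_zero_right],
    setIntegral_eq_integral_of_forall_compl_eq_zero fun x hx => by
      rw [image_eq_zero_of_notMem_tsupport fun h => hx (hψ.2.2 h), mul_zero]]
  simp only [dot, grad_apply, divergence, Finset.sum_mul]
  have hc : ∀ i, HasCompactSupport (pd i ψ) := fun i => hψ.2.1.fderiv_apply ℝ _
  have h1 : ∀ i, Integrable fun x => G x i * pd i ψ x := fun i =>
    ((hG i).continuous.mul (continuous_pd hψ1 i)).integrable_of_hasCompactSupport (hc i).mul_left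
  have h2 : ∀ i, Integrable fun x => pd i (fun y => G y i) x * ψ x := fun i =>
    ((continuous_pd (hG i) i).mul hψ1.continuous).integrable_of_hasCompactSupport hψ.2.1.mul_left
  rw [integral_finsetSum _ fun i _ => h1 i, integral_finsetSum _ fun i _ => h2 i, ← Finset.sum_neg_distrib]
  exact Finset.sum_congr rfl fun i _ => integral_pd_mul (hG i) hψ1 hψ.2.1 i

theorem weakDivFree_xGrad {f : R3 → ℂ} (hf : ContDiff ℝ ∞ f) (Ω : Set R3) :
    WeakDivFree Ω (xGrad f) := by
  refine ⟨(continuous_xGrad_C3 (hf.of_le (by simp))).locallyIntegrable.locallyIntegrableOn _,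
    fun ψ hψ => ?_⟩
  rw [integral_dot_grad (fun i => (contDiff_xGrad_apply hf i).of_le (by simp)) hψ]
  simp [divergence_xGrad hf]

theorem xGrad_const_smul {f : R3 → ℂ} (a : ℂ) (hf : Differentiable ℝ f) (x : R3) :
    xGrad (fun y => a • f y) x = a • xGrad f x := by
  ext i
  rw [xGrad_apply, fderiv_fun_const_smul (hf x), PiLp.smul_apply, xGrad_apply]
  rfl

/-- A smooth solution of the scalar eigenproblem gives an eigenfield. -/
theorem finiteFourier_xGrad (hα : -1 < α) {φ : R3 → ℂ} (hφ : ContDiff ℝ ∞ φ)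
    (h : ∀ x, finiteFourier c α φ x = z • φ x) (x : R3) :
    finiteFourier c α (xGrad φ) x = z • xGrad φ x := by
  have hφ1 : ContDiff ℝ 1 φ := hφ.of_le (by simp)
  rw [finiteFourier_eq_xGrad
    (integrable_ballMeasure hα (memLp_ballMeasure_of_continuous hα hφ.continuous))
    (integrable_ballMeasure hα (memLp_ballMeasure_of_continuous hα (continuous_xGrad_C3 hφ1)))
    fun f hf i => integral_ballMeasure_mul_xGrad hα hf hφ1 i,
    ← xGrad_const_smul z (hφ.differentiable (by simp)), funext h]

end

end

section
/-! ### The scalar potential of a toroidal field -/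

section
open scoped ENNReal

variable {Y : (n : ℕ) → Fin (2 * n + 1) → MvPolynomial (Fin 3) ℝ} {c α : ℝ} {z : ℂ}
  {E : R3 → C3}

theorem integral_norm_sq_sum {H ι : Type*} [NormedAddCommGroup H] [InnerProductSpace ℂ H]
    [DecidableEq ι] (F : ι → Metric.sphere (0 : R3) 1 → H) (hF : ∀ i, Continuous (F i)) (N : ι → ℝ)
    (ho : ∀ i j, ∫ s, inner ℂ (F i s) (F j s) ∂sphereMeasure = if i = j then (N i : ℂ) else 0)
    (t : Finset ι) (a : ι → ℂ) :
    ∫ s, ‖∑ i ∈ t, a i • F i s‖ ^ 2 ∂sphereMeasure = ∑ i ∈ t, N i * ‖a i‖ ^ 2 := by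
  have hi : ∀ i j, Integrable (fun s => (starRingEnd ℂ) (a i) * (a j * inner ℂ (F i s) (F j s)))
      sphereMeasure := fun i j =>
    ((continuous_integrable_sphere ((hF i).inner (hF j))).const_mul _).const_mul _
  have h : ∀ s, ((‖∑ i ∈ t, a i • F i s‖ ^ 2 : ℝ) : ℂ) =
      ∑ i ∈ t, ∑ j ∈ t, (starRingEnd ℂ) (a i) * (a j * inner ℂ (F i s) (F j s)) := fun s => by
    rw [Complex.ofReal_pow]
    erw [← inner_self_eq_norm_sq_to_K (𝕜 := ℂ) (∑ i ∈ t, a i • F i s)]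
    rw [sum_inner]
    refine Finset.sum_congr rfl fun i _ => ?_
    rw [inner_sum]
    refine Finset.sum_congr rfl fun j _ => ?_
    rw [inner_smul_left, inner_smul_right]
  have key : ((∫ s, ‖∑ i ∈ t, a i • F i s‖ ^ 2 ∂sphereMeasure : ℝ) : ℂ) =
      ((∑ i ∈ t, N i * ‖a i‖ ^ 2 : ℝ) : ℂ) := by
    rw [← integral_complex_ofReal]
    simp only [h]
    rw [integral_finsetSum _ fun i _ => integrable_finsetSum _ fun j _ => hi i j]
    push_cast
    refine Finset.sum_congr rfl fun i hit => ?_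
    rw [integral_finsetSum _ fun j _ => hi i j]
    simp only [integral_const_mul, ho]
    rw [Finset.sum_eq_single_of_mem i hit fun j _ hj => by simp [hj.symm]]
    have := Complex.conj_mul' (a i)
    simp only [if_true]
    linear_combination (N i : ℂ) * this
  exact_mod_cast key

theorem eLpNorm_le_of_integral_norm_sq_le {H H' : Type*} [NormedAddCommGroup H]
    [NormedAddCommGroup H'] {f : Metric.sphere (0 : R3) 1 → H} {g : Metric.sphere (0 : R3) 1 → H'}
    (hf : MemLp f 2 sphereMeasure) (hg : MemLp g 2 sphereMeasure)
    (h : ∫ s, ‖f s‖ ^ 2 ∂sphereMeasure ≤ ∫ s, ‖g s‖ ^ 2 ∂sphereMeasure) :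
    eLpNorm f 2 sphereMeasure ≤ eLpNorm g 2 sphereMeasure := by
  rw [hf.eLpNorm_eq_integral_rpow_norm (by norm_num) (by norm_num),
    hg.eLpNorm_eq_integral_rpow_norm (by norm_num) (by norm_num)]
  refine ENNReal.ofReal_le_ofReal (Real.rpow_le_rpow (by positivity) ?_ (by simp))
  simpa using h

/-- Parseval on both sides: the same coefficients appear with weights `1` and `n(n+1) ≥ 1`.
Excluding degree 0 is essential. -/
theorem eLpNorm_sphere_scalar_le (hY : IsSphericalHarmonicSystem Y)
    (a : (n : ℕ) → Fin (2 * n + 1) → ℂ) {t : Finset ℕ} (ht : ∀ n ∈ t, 1 ≤ n) :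
    eLpNorm (fun s : Metric.sphere (0 : R3) 1 => ∑ n ∈ t, ∑ ℓ, a n ℓ * evC (Y n ℓ) s.1) 2
      sphereMeasure ≤
    eLpNorm (fun s : Metric.sphere (0 : R3) 1 => ∑ n ∈ t, ∑ ℓ, a n ℓ • evV (vshPoly3 (Y n ℓ)) s.1) 2
      sphereMeasure := by
  have h1 : ∀ p : MvPolynomial (Fin 3) ℝ,
      Continuous fun s : Metric.sphere (0 : R3) 1 => evC p s.1 := fun p =>
    (continuous_evC p).comp continuous_subtype_val
  have h2 : ∀ P : Fin 3 → MvPolynomial (Fin 3) ℝ,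
      Continuous fun s : Metric.sphere (0 : R3) 1 => evV P s.1 := fun P =>
    (continuous_evV P).comp continuous_subtype_val
  have h3 : ∀ (w : ℂ) (P : Fin 3 → MvPolynomial (Fin 3) ℝ),
      Continuous fun s : Metric.sphere (0 : R3) 1 => w • evV P s.1 := fun w P => (h2 P).const_smul w
  refine eLpNorm_le_of_integral_norm_sq_le ?_ ?_ ?_
  · exact Continuous.memLp_of_hasCompactSupport (continuous_finsetSum _ fun n _ =>
      continuous_finsetSum _ fun ℓ _ => continuous_const.mul (h1 _))
      (HasCompactSupport.of_compactSpace _)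
  · exact Continuous.memLp_of_hasCompactSupport (continuous_finsetSum _ fun n _ =>
      continuous_finsetSum _ fun ℓ _ => h3 _ _) (HasCompactSupport.of_compactSpace _)
  have e1 := integral_norm_sq_sum
    (fun (i : Σ n : ℕ, Fin (2 * n + 1)) (s : Metric.sphere (0 : R3) 1) => evC (Y i.1 i.2) s.1)
    (fun i => h1 _) (fun _ => 1) (fun i j => by
      have : ∀ s : Metric.sphere (0 : R3) 1, inner ℂ (evC (Y i.1 i.2) s.1) (evC (Y j.1 j.2) s.1) =
          evC (Y i.1 i.2 * Y j.1 j.2) s.1 := fun s => by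
        rw [RCLike.inner_apply, star_evC, evC_mul, mul_comm]
      simp only [this]
      rw [Complex.ofReal_one]
      exact hY.sphereInt_mul _ _ _ _) (t.sigma fun _ => Finset.univ) (fun i => a i.1 i.2)
  have e2 := integral_norm_sq_sum
    (fun (i : Σ n : ℕ, Fin (2 * n + 1)) (s : Metric.sphere (0 : R3) 1) =>
      evV (vshPoly3 (Y i.1 i.2)) s.1)
    (fun i => h2 _) (fun i => i.1 * (i.1 + 1)) (fun i j => by
      simp only [inner_eq_dot_of_real (conj_evV _ _)]
      rw [integral_dot_evV_evV, vshPoly_three_three (hY.mem _ _), hY.sphereInt_mul]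
      by_cases hij : i = j
      · subst hij
        simp
      · rw [if_neg fun h => hij h.symm, if_neg hij, mul_zero]) (t.sigma fun _ => Finset.univ) (fun i => a i.1 i.2)
  simp only [Finset.sum_sigma, smul_eq_mul] at e1 e2
  rw [e1, e2]
  refine Finset.sum_le_sum fun n hn => Finset.sum_le_sum fun ℓ _ => ?_
  have : (1 : ℝ) ≤ n := by exact_mod_cast ht n hn
  gcongr
  nlinarith

/-- The terms of degree `n` of the scalar potential. -/
def scalarTerm (Y : (n : ℕ) → Fin (2 * n + 1) → MvPolynomial (Fin 3) ℝ) (E : R3 → C3) (n : ℕ)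
    (x : R3) : ℂ :=
  ∑ ℓ, scalarMode (Y n ℓ) (coeff3 n (Y n ℓ) E) x

/-- The terms of degree `n` of the toroidal part. -/
def toroidalTerm (Y : (n : ℕ) → Fin (2 * n + 1) → MvPolynomial (Fin 3) ℝ) (E : R3 → C3) (n : ℕ)
    (x : R3) : C3 :=
  ∑ ℓ, toroidalMode (Y n ℓ) (coeff3 n (Y n ℓ) E) x

variable {ν : Measure R3} {ρ : Measure ℝ}

theorem IsPolar.memLp_scalarTerm (h : IsPolar ν ρ) (hY : IsSphericalHarmonicSystem Y)
    (hE : MemLp E 2 ν) (n : ℕ) : MemLp (scalarTerm Y E n) 2 ν :=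
  memLp_finsetSum _ fun ℓ _ => h.memLp_scalarMode (h.memLp_coeff3 (by norm_num) (by norm_num) hE
    (hY.homogeneous n ℓ)) _

theorem IsPolar.memLp_toroidalTerm (h : IsPolar ν ρ) (hY : IsSphericalHarmonicSystem Y)
    (hE : MemLp E 2 ν) (n : ℕ) : MemLp (toroidalTerm Y E n) 2 ν :=
  memLp_finsetSum _ fun ℓ _ => h.memLp_toroidalMode (h.memLp_coeff3 (by norm_num) (by norm_num) hE
    (hY.homogeneous n ℓ)) (hY.homogeneous n ℓ)

theorem IsPolar.eLpNorm_scalarTerm_le (h : IsPolar ν ρ) (hY : IsSphericalHarmonicSystem Y)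
    (hE : MemLp E 2 ν) {t : Finset ℕ} (ht : ∀ n ∈ t, 1 ≤ n) :
    eLpNorm (fun x => ∑ n ∈ t, scalarTerm Y E n x) 2 ν ≤
      eLpNorm (fun x => ∑ n ∈ t, toroidalTerm Y E n x) 2 ν := by
  have h0 : (2 : ℝ≥0∞) ≠ 0 := by norm_num
  have ht2 : (2 : ℝ≥0∞) ≠ ⊤ := by norm_num
  have h1 := h.eLpNorm_rpow (memLp_finsetSum t fun n _ => h.memLp_scalarTerm hY hE n).1 h0 ht2
  have h2 := h.eLpNorm_rpow (memLp_finsetSum t fun n _ => h.memLp_toroidalTerm hY hE n).1 h0 ht2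
  rw [← ENNReal.rpow_le_rpow_iff (z := (2 : ℝ≥0∞).toReal) (by norm_num), h1, h2]
  refine lintegral_mono_ae ?_
  filter_upwards [h.pos] with r hr
  refine ENNReal.rpow_le_rpow ?_ (by norm_num)
  simp only [scalarTerm, toroidalTerm, scalarMode_smul hr,
    toroidalMode_smul hr _ (hY.homogeneous _ _)]
  exact eLpNorm_sphere_scalar_le hY _ ht

/-- Differences of partial sums of the scalar series are dominated by those of the toroidal series,
so they are Cauchy in `L²`. -/
theorem IsPolar.exists_scalar_limit (h : IsPolar ν ρ) (hY : IsSphericalHarmonicSystem Y)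
    (hE : MemLp E 2 ν)
    (hT : Tendsto (fun N : ℕ => eLpNorm (fun x => E x - ∑ n ∈ Finset.Icc 1 N, toroidalTerm Y E n x)
      2 ν) atTop (𝓝 0)) :
    ∃ φ : R3 → ℂ, MemLp φ 2 ν ∧
      Tendsto (fun N : ℕ => eLpNorm (fun x => φ x - ∑ n ∈ Finset.Icc 1 N, scalarTerm Y E n x) 2 ν)
        atTop (𝓝 0) := by
  have hs : ∀ t : Finset ℕ, MemLp (fun x => ∑ n ∈ t, scalarTerm Y E n x) 2 ν := fun t =>
    memLp_finsetSum t fun n _ => h.memLp_scalarTerm hY hE n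
  have hv : ∀ t : Finset ℕ, MemLp (fun x => ∑ n ∈ t, toroidalTerm Y E n x) 2 ν := fun t =>
    memLp_finsetSum t fun n _ => h.memLp_toroidalTerm hY hE n
  set u : ℕ → Lp ℂ 2 ν := fun N => (hs (Finset.Icc 1 N)).toLp with hu
  set v : ℕ → Lp C3 2 ν := fun N => (hv (Finset.Icc 1 N)).toLp with hv'
  have hdiff : ∀ {V : Type} [AddCommGroup V] (f : ℕ → V) {N M : ℕ}, M ≤ N →
      ∑ n ∈ Finset.Icc 1 N, f n - ∑ n ∈ Finset.Icc 1 M, f n = ∑ n ∈ Finset.Ioc M N, f n := by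
    intro V _ f N M hMN
    rw [sub_eq_iff_eq_add, add_comm]
    exact (Finset.sum_Ioc_consecutive f (Nat.zero_le M) hMN).symm
  have hle : ∀ {N M : ℕ}, M ≤ N → edist (u N) (u M) ≤ edist (v N) (v M) := fun {N M} hMN => by
    rw [Lp.edist_toLp_toLp, Lp.edist_toLp_toLp]
    have e1 : ((fun x => ∑ n ∈ Finset.Icc 1 N, scalarTerm Y E n x) -
        fun x => ∑ n ∈ Finset.Icc 1 M, scalarTerm Y E n x) =
        fun x => ∑ n ∈ Finset.Ioc M N, scalarTerm Y E n x :=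
      funext fun x => hdiff (fun n => scalarTerm Y E n x) hMN
    have e2 : ((fun x => ∑ n ∈ Finset.Icc 1 N, toroidalTerm Y E n x) -
        fun x => ∑ n ∈ Finset.Icc 1 M, toroidalTerm Y E n x) =
        fun x => ∑ n ∈ Finset.Ioc M N, toroidalTerm Y E n x :=
      funext fun x => hdiff (fun n => toroidalTerm Y E n x) hMN
    rw [e1, e2]
    exact h.eLpNorm_scalarTerm_le hY hE fun n hn => by
      have := (Finset.mem_Ioc.1 hn).1
      omega
  have hvl : Tendsto v atTop (𝓝 hE.toLp) := by
    rw [tendsto_iff_edist_tendsto_0]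
    refine hT.congr fun N => ?_
    rw [edist_comm, Lp.edist_toLp_toLp]
    rfl
  have huc : CauchySeq u := by
    have hvc := hvl.cauchySeq
    rw [EMetric.cauchySeq_iff'] at hvc ⊢
    intro ε hε
    obtain ⟨M, hM⟩ := hvc ε hε
    exact ⟨M, fun N hN => (hle hN).trans_lt (hM N hN)⟩
  have : Fact ((1 : ℝ≥0∞) ≤ 2) := ⟨by norm_num⟩
  obtain ⟨φ, hφ⟩ := cauchySeq_tendsto_of_complete huc
  refine ⟨φ, Lp.memLp φ, ?_⟩
  rw [tendsto_iff_edist_tendsto_0] at hφ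
  refine hφ.congr fun N => ?_
  rw [edist_comm]
  conv_lhs => rw [← Lp.toLp_coeFn φ (Lp.memLp φ)]
  rw [Lp.edist_toLp_toLp]
  rfl

theorem tendsto_integral_continuous_mul (hα : -1 < α) {f : R3 → ℂ} (hf : Continuous f)
    {g : R3 → ℂ} {G : ℕ → R3 → ℂ} (hg : MemLp g 2 (ballMeasure α))
    (hG : ∀ N, MemLp (G N) 2 (ballMeasure α))
    (h : Tendsto (fun N => eLpNorm (fun x => g x - G N x) 2 (ballMeasure α)) atTop (𝓝 0)) :
    Tendsto (fun N => ∫ x, f x * G N x ∂ballMeasure α) atTop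
      (𝓝 (∫ x, f x * g x ∂ballMeasure α)) := by
  have := isFiniteMeasure_ballMeasure hα
  obtain ⟨C, hC⟩ := ((isCompact_closedBall (0 : R3) 1).image hf).isBounded.exists_norm_le
  refine tendsto_integral_of_L1' _
    (integrable_continuous_mul_ballMeasure hf (integrable_ballMeasure hα hg)).1
    (Eventually.of_forall fun N =>
      integrable_continuous_mul_ballMeasure hf (integrable_ballMeasure hα (hG N))) ?_
  set K : ℝ≥0∞ := ENNReal.ofReal C *
    ballMeasure α Set.univ ^ (1 / (1 : ℝ≥0∞).toReal - 1 / (2 : ℝ≥0∞).toReal) with hK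
  have hK' : K ≠ ⊤ := ENNReal.mul_ne_top ENNReal.ofReal_ne_top
    (ENNReal.rpow_ne_top_of_nonneg (by norm_num) (measure_ne_top _ _))
  have hlim := ENNReal.Tendsto.const_mul (a := K) h (Or.inr hK')
  rw [mul_zero] at hlim
  refine tendsto_of_tendsto_of_tendsto_of_le_of_le tendsto_const_nhds hlim (fun _ => zero_le)
    fun N => ?_
  have h1 : eLpNorm ((fun x => f x * G N x) - fun x => f x * g x) 1 (ballMeasure α) ≤
      ENNReal.ofReal C * eLpNorm (fun x => g x - G N x) 1 (ballMeasure α) := by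
    refine eLpNorm_le_mul_eLpNorm_of_ae_le_mul ?_ 1
    filter_upwards [ae_ballMeasure_norm_le α] with x hx
    rw [Pi.sub_apply, ← mul_sub, norm_mul, norm_sub_rev]
    gcongr
    exact hC _ ⟨x, by simpa using hx, rfl⟩
  have h2 := eLpNorm_le_eLpNorm_mul_rpow_measure_univ (p := 1) (q := 2) (by norm_num)
    (hg.sub (hG N)).1
  refine h1.trans ?_
  rw [hK, mul_assoc, mul_comm (ballMeasure α _ ^ _)]
  gcongr
  exact h2

/-- Fields constant on spheres are orthogonal to the harmonics of positive degree. -/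
theorem IsPolar.integral_mul_scalarMode_eq_zero (h : IsPolar ν ρ) {R : ℝ}
    (hR : ∀ᵐ x ∂ν, ‖x‖ ≤ R) {e : ℝ → ℂ} (he : Integrable e ρ) {p : MvPolynomial (Fin 3) ℝ} {n : ℕ}
    (hn : 1 ≤ n) (hp : p ∈ solidHarmonic n) {f : R3 → ℂ} (hf : ContDiff ℝ 1 f)
    (h0 : ∀ x i, xGrad f x i = 0) : ∫ x, f x * scalarMode p e x ∂ν = 0 := by
  have h2 := memLp_one_iff_integrable.1
    (h.memLp_scalarMode (memLp_one_iff_integrable.2 he) p)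
  rw [h.integral (integrable_continuous_mul hR hf.continuous h2)]
  refine integral_eq_zero_of_ae ?_
  filter_upwards [h.pos] with r hr
  have hi : ∀ q : MvPolynomial (Fin 3) ℝ, Integrable (fun s : Metric.sphere (0 : R3) 1 =>
      evC q s.1 * f (r • s.1)) sphereMeasure := fun q =>
    continuous_integrable_sphere (((continuous_evC q).comp continuous_subtype_val).mul
      (hf.continuous.comp (continuous_subtype_val.const_smul r)))
  -- Up to sign `n(n+1) p` is the sum of these squares, and one factor can be moved onto `f`, where
  -- it vanishes.
  have h3 : ∀ i, ∫ s, evC (rotPoly i (rotPoly i p)) s.1 * f (r • s.1) ∂sphereMeasure = 0 :=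
    fun i => by
      have := sphere_integral_evC_mul_xGrad (rotPoly i p) hf r i
      simp only [h0, mul_zero, integral_zero] at this
      exact neg_eq_zero.1 this.symm
  have h4 : ∫ s, evC (∑ i, rotPoly i (rotPoly i p)) s.1 * f (r • s.1) ∂sphereMeasure = 0 := by
    simp only [evC_sum, Finset.sum_mul]
    rw [integral_finsetSum _ fun i _ => hi _]
    exact Finset.sum_eq_zero fun i _ => h3 i
  have hl : lapPoly p = 0 := hp.2
  simp only [sum_rotPoly_rotPoly hp.1, hl, mul_zero, zero_sub, evC_neg, evC_mul, evC_add,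
    evC_natCast, evC_one, neg_mul, integral_neg, mul_assoc, integral_const_mul] at h4
  have h5 : ∫ s, evC p s.1 * f (r • s.1) ∂sphereMeasure = 0 := by
    have := degree_factor_ne_zero hn
    rw [neg_eq_zero, ← mul_assoc] at h4
    exact (mul_eq_zero.1 h4).resolve_left this
  have e1 : ∀ s : Metric.sphere (0 : R3) 1, f (r • s.1) * (e r * evC p s.1) =
    e r * (evC p s.1 * f (r • s.1)) := fun s => by ring
  simp only [scalarMode_smul hr, e1, integral_const_mul, h5, mul_zero, Pi.zero_apply]

/-- Fubini and the symmetry of the kernel in its two variables; the pairing is bilinear, without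
conjugation. -/
theorem integral_mul_finiteFourier {f g : R3 → ℂ} (hf : Integrable f (ballMeasure α))
    (hg : Integrable g (ballMeasure α)) :
    ∫ x, f x * finiteFourier c α g x ∂ballMeasure α =
      ∫ x, finiteFourier c α f x * g x ∂ballMeasure α := by
  have hs := (isPolar_ballMeasure α).sfinite
  have : SFinite (ballMeasure α) := by unfold ballMeasure; infer_instance
  simp only [finiteFourier_eq, smul_eq_mul, ← integral_const_mul, ← integral_mul_const]
  rw [integral_integral_swap]
  · refine integral_congr_ae (Eventually.of_forall fun x => integral_congr_ae
      (Eventually.of_forall fun y => ?_))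
    simp only [fourierKernel, real_inner_comm x y]
    ring
  · have hk : Continuous fun q : R3 × R3 => fourierKernel c q.1 q.2 := by
      unfold fourierKernel; fun_prop
    have := (hf.mul_prod hg).bdd_mul (c := 1) hk.aestronglyMeasurable
      (Eventually.of_forall fun q => (norm_fourierKernel c q.1 q.2).le)
    refine this.congr (Eventually.of_forall fun q => ?_)
    simp only [Function.uncurry]
    ring

end

end

/-! ### Identification of the potential with its transform -/

section
section

variable {Y : (n : ℕ) → Fin (2 * n + 1) → MvPolynomial (Fin 3) ℝ} {c α : ℝ} {z : ℂ}
  {E : R3 → C3}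

theorem rotPoly_normSqPoly (i : Fin 3) : rotPoly i normSqPoly = 0 := by
  fin_cases i <;> simp [rotPoly, normSqPoly, MvPolynomial.pderiv_X] <;> ring

theorem rotPoly_normSqPoly_pow (i : Fin 3) (k : ℕ) : rotPoly i (normSqPoly ^ k) = 0 := by
  induction k with
  | zero => simp [rotPoly]
  | succ k ih => rw [pow_succ, rotPoly_mul, ih, rotPoly_normSqPoly]; ring

theorem sum_rotPoly_rotPoly_normSqPoly_pow_mul {p : MvPolynomial (Fin 3) ℝ} {n : ℕ}
    (hp : p ∈ solidHarmonic n) (k : ℕ) :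
    ∑ i, rotPoly i (rotPoly i (normSqPoly ^ k * p)) =
      -((n * (n + 1) : MvPolynomial (Fin 3) ℝ) * (normSqPoly ^ k * p)) := by
  have hl : lapPoly p = 0 := hp.2
  simp only [rotPoly_mul, rotPoly_normSqPoly_pow, zero_mul, zero_add]
  rw [← Finset.mul_sum, sum_rotPoly_rotPoly hp.1, hl]
  ring

/-- A field killed by `x × ∇` and orthogonal to the fields constant on spheres vanishes. -/
theorem ae_eq_zero_of_integral_xGrad_mul (hY : IsSphericalHarmonicSystem Y) {D : R3 → ℂ}
    (hD : Integrable D (ballMeasure α))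
    (h : ∀ f : R3 → ℂ, ContDiff ℝ 1 f → ∀ i, ∫ x, xGrad f x i * D x ∂ballMeasure α = 0)
    (h0 : ∀ k, ∫ x, evC (normSqPoly ^ k) x * D x ∂ballMeasure α = 0) :
    ∀ᵐ x ∂ballMeasure α, D x = 0 := by
  have hi : ∀ p, Integrable (fun x => evC p x * D x) (ballMeasure α) := fun p =>
    integrable_continuous_mul_ballMeasure (continuous_evC p) hD
  -- Inside the ball `|x|²` is not 1, so the power `k` is carried through the induction: multiplying
  -- by `|x|²` only raises `k`.
  have key : ∀ p : MvPolynomial (Fin 3) ℝ, ∀ k : ℕ,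
      ∫ x, evC (normSqPoly ^ k * p) x * D x ∂ballMeasure α = 0 := by
    refine hY.induction (fun n ℓ k => ?_) (fun k => by simp) (fun p q hp hq k => ?_)
      (fun a p hp k => ?_) fun p hp k => ?_
    · rcases Nat.eq_zero_or_pos n with rfl | hn
      · have hc : ∀ x, evC (normSqPoly ^ k * Y 0 ℓ) x * D x =
            evC (Y 0 ℓ) 0 * (evC (normSqPoly ^ k) x * D x) := fun x => by
          rw [evC_mul, evC_eq_of_isHomogeneous_zero (hY.homogeneous 0 ℓ) x]
          ring
        simp only [hc, integral_const_mul, h0, mul_zero]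
      · have h1 : ∀ i, ∫ x, evC (rotPoly i (rotPoly i (normSqPoly ^ k * Y n ℓ))) x * D x
            ∂ballMeasure α = 0 := fun i => by
          simpa only [xGrad_evC] using h _ (contDiff_evC (rotPoly i (normSqPoly ^ k * Y n ℓ))) i
        have h2 : ∫ x, evC (∑ i, rotPoly i (rotPoly i (normSqPoly ^ k * Y n ℓ))) x * D x
            ∂ballMeasure α = 0 := by
          simp only [evC_sum, Finset.sum_mul]
          rw [integral_finsetSum _ fun i _ => hi _]
          exact Finset.sum_eq_zero fun i _ => h1 i
        have h3 : ∀ x, evC (-((n * (n + 1) : MvPolynomial (Fin 3) ℝ) *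
            (normSqPoly ^ k * Y n ℓ))) x * D x =
            -((n : ℂ) * (n + 1)) * (evC (normSqPoly ^ k * Y n ℓ) x * D x) := fun x => by
          rw [evC_neg, evC_mul (_ * _)]
          simp only [evC_mul (n : MvPolynomial (Fin 3) ℝ), evC_add, evC_natCast, evC_one]
          ring
        rw [sum_rotPoly_rotPoly_normSqPoly_pow_mul (hY.mem n ℓ)] at h2
        simp only [h3, integral_const_mul] at h2
        exact (mul_eq_zero.1 h2).resolve_left (neg_ne_zero.2 (degree_factor_ne_zero hn))
    · simp only [mul_add, evC_add, add_mul]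
      rw [integral_add (hi _) (hi _), hp, hq, add_zero]
    · simp only [MvPolynomial.smul_eq_C_mul, mul_left_comm _ (MvPolynomial.C a)]
      simp only [evC_mul (MvPolynomial.C a), evC_C, mul_assoc, integral_const_mul, hp, mul_zero]
    · rw [← mul_assoc, ← pow_succ]
      exact hp (k + 1)
  refine ae_eq_zero_of_integral_eval_smul (isCompact_closedBall (0 : R3) 1)
    (ballMeasure_compl_unitBall α) hD fun p => ?_
  simpa [evC, Complex.real_smul] using key p 0

theorem memLp_apply_C3 {X : Type*} [MeasurableSpace X] {μ : Measure X} {v : X → C3}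
    {q : ENNReal} (hv : MemLp v q μ) (i : Fin 3) : MemLp (fun x => v x i) q μ :=
  (EuclideanSpace.proj (𝕜 := ℂ) i : C3 →L[ℂ] ℂ).comp_memLp' hv

theorem exists_eigenpotential (hc : 0 < c) (hα : -1 < α) (hY : IsSphericalHarmonicSystem Y)
    (h : IsEigenfunction c α z E)
    (hT : Tendsto (fun N : ℕ => eLpNorm (fun x => E x - ∑ n ∈ Finset.Icc 1 N, toroidalTerm Y E n x)
      2 (ballMeasure α)) atTop (𝓝 0)) :
    ∃ φ : R3 → ℂ, ContDiff ℝ ∞ φ ∧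
      Tendsto (fun N : ℕ => eLpNorm (fun x => φ x - ∑ n ∈ Finset.Icc 1 N, scalarTerm Y E n x) 2
        (ballMeasure α)) atTop (𝓝 0) ∧
      (∀ᵐ x ∂volume.restrict unitBall, E x = xGrad φ x) ∧ IsEigenfunction c α z φ := by
  have hP := isPolar_ballMeasure α
  have hz := h.vector_ne_zero hc hα
  have hR := ae_ballMeasure_norm_le α
  have := isFiniteMeasure_radialMeasure_jacobi hα
  have hE := h.memLp
  have hEi := integrable_ballMeasure hα hE
  have he : ∀ n ℓ, Integrable (coeff3 n (Y n ℓ) E) (radialMeasure (jacobiWeight α)) := fun n ℓ =>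
    (hP.memLp_coeff3 (by norm_num) (by norm_num) hE (hY.homogeneous n ℓ)).integrable (by norm_num)
  obtain ⟨φ₀, hφ₀, hlim⟩ := hP.exists_scalar_limit hY hE hT
  have hφ₀i := integrable_ballMeasure hα hφ₀
  have hS : ∀ N, MemLp (fun x => ∑ n ∈ Finset.Icc 1 N, scalarTerm Y E n x) 2 (ballMeasure α) :=
    fun N => memLp_finsetSum _ fun n _ => hP.memLp_scalarTerm hY hE n
  have hTm : ∀ N, MemLp (fun x => ∑ n ∈ Finset.Icc 1 N, toroidalTerm Y E n x) 2 (ballMeasure α) :=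
    fun N => memLp_finsetSum _ fun n _ => hP.memLp_toroidalTerm hY hE n

  -- `E = x × ∇ φ₀` weakly with respect to the weighted measure: true for each mode, and both sides
  -- pass to the `L²` limit.
  have hrel : ∀ f : R3 → ℂ, ContDiff ℝ 1 f → ∀ i,
      ∫ x, f x * E x i ∂ballMeasure α = -∫ x, xGrad f x i * φ₀ x ∂ballMeasure α := by
    intro f hf i
    have h1 := tendsto_integral_continuous_mul hα hf.continuous (g := fun x => E x i)
      (G := fun N x => (∑ n ∈ Finset.Icc 1 N, toroidalTerm Y E n x) i)
      (memLp_apply_C3 hE i) (fun N => memLp_apply_C3 (hTm N) i)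
      (tendsto_of_tendsto_of_tendsto_of_le_of_le tendsto_const_nhds hT (fun _ => zero_le)
        fun N => eLpNorm_mono fun x => PiLp.norm_apply_le (E x - _) i)
    have h2 := (tendsto_integral_continuous_mul hα (continuous_xGrad hf i) hφ₀ hS hlim).neg
    refine tendsto_nhds_unique (h1.congr fun N => ?_) h2
    have e1 : ∀ x, f x * (∑ n ∈ Finset.Icc 1 N, toroidalTerm Y E n x) i =
        ∑ n ∈ Finset.Icc 1 N, ∑ ℓ, f x * toroidalMode (Y n ℓ) (coeff3 n (Y n ℓ) E) x i := fun x => by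
      simp [toroidalTerm, Finset.mul_sum]
    have e2 : ∀ x, xGrad f x i * (∑ n ∈ Finset.Icc 1 N, scalarTerm Y E n x) =
        ∑ n ∈ Finset.Icc 1 N, ∑ ℓ, xGrad f x i * scalarMode (Y n ℓ) (coeff3 n (Y n ℓ) E) x :=
      fun x => by simp [scalarTerm, Finset.mul_sum]
    have i1 : ∀ n ℓ, Integrable (fun x => f x * toroidalMode (Y n ℓ) (coeff3 n (Y n ℓ) E) x i)
        (ballMeasure α) := fun n ℓ => integrable_continuous_mul hR hf.continuous
      (integrable_apply (memLp_one_iff_integrable.1 (hP.memLp_toroidalMode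
        (memLp_one_iff_integrable.2 (he n ℓ)) (hY.homogeneous n ℓ))) i)
    have i2 : ∀ n ℓ, Integrable (fun x => xGrad f x i * scalarMode (Y n ℓ) (coeff3 n (Y n ℓ) E) x)
        (ballMeasure α) := fun n ℓ => integrable_continuous_mul hR (continuous_xGrad hf i)
      (memLp_one_iff_integrable.1 (hP.memLp_scalarMode
        (memLp_one_iff_integrable.2 (he n ℓ)) _))
    simp only [e1, e2]
    rw [integral_finsetSum _ fun n _ => integrable_finsetSum _ fun ℓ _ => i1 n ℓ,
      integral_finsetSum _ fun n _ => integrable_finsetSum _ fun ℓ _ => i2 n ℓ,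
      ← Finset.sum_neg_distrib]
    refine Finset.sum_congr rfl fun n _ => ?_
    rw [integral_finsetSum _ fun ℓ _ => i1 n ℓ, integral_finsetSum _ fun ℓ _ => i2 n ℓ,
      ← Finset.sum_neg_distrib]
    exact Finset.sum_congr rfl fun ℓ _ =>
      hP.integral_mul_toroidalMode hR (he n ℓ) (hY.homogeneous n ℓ) hf i

  -- `φ₀` has no component of degree 0; this normalisation removes the freedom of adding radial
  -- functions to a potential.
  have horth : ∀ f : R3 → ℂ, ContDiff ℝ 1 f → (∀ x i, xGrad f x i = 0) →
      ∫ x, f x * φ₀ x ∂ballMeasure α = 0 := by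
    intro f hf hf0
    refine tendsto_nhds_unique (tendsto_integral_continuous_mul hα hf.continuous hφ₀ hS hlim)
      (tendsto_const_nhds.congr fun N => ?_)
    have e2 : ∀ x, f x * (∑ n ∈ Finset.Icc 1 N, scalarTerm Y E n x) =
        ∑ n ∈ Finset.Icc 1 N, ∑ ℓ, f x * scalarMode (Y n ℓ) (coeff3 n (Y n ℓ) E) x :=
      fun x => by simp [scalarTerm, Finset.mul_sum]
    have i2 : ∀ n ℓ, Integrable (fun x => f x * scalarMode (Y n ℓ) (coeff3 n (Y n ℓ) E) x)
        (ballMeasure α) := fun n ℓ => integrable_continuous_mul hR hf.continuous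
      (memLp_one_iff_integrable.1 (hP.memLp_scalarMode
        (memLp_one_iff_integrable.2 (he n ℓ)) _))
    simp only [e2]
    rw [integral_finsetSum _ fun n _ => integrable_finsetSum _ fun ℓ _ => i2 n ℓ]
    refine (Finset.sum_eq_zero fun n hn => ?_).symm
    rw [integral_finsetSum _ fun ℓ _ => i2 n ℓ]
    exact Finset.sum_eq_zero fun ℓ _ => hP.integral_mul_scalarMode_eq_zero hR (he n ℓ)
      (Finset.mem_Icc.1 hn).1 (hY.mem n ℓ) hf hf0

  -- The smooth representative that `φ₀` must have if it is to be an eigenfunction.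
  set ψ : R3 → ℂ := fun x => z⁻¹ • finiteFourier c α φ₀ x with hψ
  have hF := contDiff_finiteFourier (c := c) hφ₀i
  have hψs : ContDiff ℝ ∞ ψ := hF.const_smul z⁻¹
  have hψ1 : ContDiff ℝ 1 ψ := hψs.of_le (by simp)
  have hψi := integrable_ballMeasure hα (memLp_ballMeasure_of_continuous hα hψs.continuous)
  have hEψ : ∀ᵐ x ∂volume.restrict unitBall, E x = xGrad ψ x := by
    filter_upwards [h.eigen] with x hx
    rw [hψ, xGrad_const_smul _ (hF.differentiable (by simp)),
      ← finiteFourier_eq_xGrad hφ₀i hEi hrel, hx, inv_smul_smul₀ hz]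
  have hEψ' := (ae_restrict_unitBall_iff (α := α)).1 hEψ
  -- Both functions are potentials of `E`, so their difference is weakly killed by `x × ∇`; it
  -- remains to see that it is orthogonal to the powers of `|x|²`.
  have hD : ∀ᵐ x ∂ballMeasure α, ψ x - φ₀ x = 0 := by
    refine ae_eq_zero_of_integral_xGrad_mul hY (hψi.sub hφ₀i) (fun f hf i => ?_) fun k => ?_
    · have h1 := integral_ballMeasure_mul_xGrad hα hf hψ1 i
      have h2 := hrel f hf i
      have h3 : ∫ x, f x * E x i ∂ballMeasure α = ∫ x, f x * xGrad ψ x i ∂ballMeasure α := by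
        refine integral_congr_ae ?_
        filter_upwards [hEψ'] with x hx
        rw [hx]
      simp only [mul_sub]
      rw [integral_sub (integrable_continuous_mul_ballMeasure (continuous_xGrad hf i) hψi)
        (integrable_continuous_mul_ballMeasure (continuous_xGrad hf i) hφ₀i)]
      linear_combination h1 - h2 + h3
    · have hk := contDiff_evC (normSqPoly ^ k) (k := 1)
      have hk0 : ∀ x i, xGrad (evC (normSqPoly ^ k)) x i = 0 := fun x i => by
        rw [xGrad_evC, rotPoly_normSqPoly_pow, evC_zero]
      have hki := integrable_ballMeasure hα (memLp_ballMeasure_of_continuous hα hk.continuous)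
      -- The transform of a radial function is again killed by `x × ∇`. By symmetry of the
      -- transform, `ψ` inherits the orthogonality of `φ₀`.
      have h1 : ∀ x i, xGrad (finiteFourier c α (evC (normSqPoly ^ k))) x i = 0 := fun x i => by
        have := finiteFourier_eq_xGrad (c := c) (α := α) (G := fun _ => 0) hki
          (integrable_zero _ _ _) (fun f hf i => by
            rw [← integral_ballMeasure_mul_xGrad hα hf hk i]
            simp [hk0]) x
        rw [← this]
        simp [finiteFourier_eq]
      have h2 := horth _ ((contDiff_finiteFourier hki).of_le (by simp)) h1
      rw [← integral_mul_finiteFourier hki hφ₀i] at h2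
      simp only [mul_sub]
      rw [integral_sub (integrable_continuous_mul_ballMeasure hk.continuous hψi)
        (integrable_continuous_mul_ballMeasure hk.continuous hφ₀i), horth _ hk hk0, sub_zero]
      simp only [hψ, smul_eq_mul, mul_left_comm _ z⁻¹, integral_const_mul, h2, mul_zero]
  have hψφ : ∀ᵐ x ∂ballMeasure α, ψ x = φ₀ x := hD.mono fun x hx => sub_eq_zero.1 hx
  refine ⟨ψ, hψs, hlim.congr fun N => eLpNorm_congr_ae ?_, hEψ,
    memLp_ballMeasure_of_continuous hα hψs.continuous, fun h0 => ?_,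
    Eventually.of_forall fun x => ?_⟩
  · filter_upwards [hψφ] with x hx
    rw [hx]
  · have h1 : ∀ᵐ x ∂ballMeasure α, φ₀ x = 0 := by
      filter_upwards [hψφ, ae_restrict_unitBall_iff.1 h0] with x hx hx0
      rw [← hx, hx0]
    have h2 : ψ = fun _ => 0 := by
      ext x
      rw [hψ]
      dsimp only
      rw [finiteFourier_congr h1]
      simp [finiteFourier_eq]
    refine h.ne_zero ?_
    filter_upwards [hEψ] with x hx
    rw [hx, h2]
    ext i
    simp [xGrad_apply]
  · rw [finiteFourier_congr hψφ, hψ, smul_inv_smul₀ hz]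

end

end

/-! ### Classical divergence of the transform of an eigenfield -/

section
-- The transform equals `z E` almost everywhere, so it is weakly divergence free. Being smooth, it
-- is divergence free at every point of the open ball.
theorem divergence_finiteFourier_eq_zero {c α : ℝ} {z : ℂ} {E : R3 → C3}
    (hE : Integrable E (ballMeasure α))
    (h : ∀ᵐ x ∂volume.restrict unitBall, finiteFourier c α E x = z • E x)
    (hdiv : WeakDivFree (Metric.ball 0 1) E) :
    ∀ x ∈ Metric.ball (0 : R3) 1, divergence (finiteFourier c α E) x = 0 := by
  have hs := contDiff_apply_C3 (contDiff_finiteFourier (c := c) hE)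
  have hc : Continuous (divergence (finiteFourier c α E)) :=
    continuous_finsetSum _ fun i _ => continuous_pd ((hs i).of_le (by simp)) i
  refine eqOn_ball_of_ae hc continuous_const ?_
  rw [← ae_restrict_ball_iff, ae_restrict_iff' Metric.isOpen_ball.measurableSet]
  refine Metric.isOpen_ball.ae_eq_zero_of_integral_contDiff_smul_eq_zero
    (hc.locallyIntegrable.locallyIntegrableOn _) fun γ hγ hγc hγs => ?_
  have hs0 : tsupport (fun x => (γ x : ℂ)) ⊆ tsupport γ :=
    closure_mono fun x hx h0 => hx (by simp [h0])
  have hT : IsTest (Metric.ball (0 : R3) 1) fun x => (γ x : ℂ) :=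
    ⟨Complex.ofRealCLM.contDiff.comp hγ,
      hγc.comp_left (g := fun r : ℝ => (r : ℂ)) Complex.ofReal_zero, hs0.trans hγs⟩
  have h1 := integral_dot_grad (fun i => (hs i).of_le (by simp)) hT
  have h2 : ∫ x in Metric.ball (0 : R3) 1,
      dot (finiteFourier c α E x) (grad (fun x => (γ x : ℂ)) x) = 0 := by
    rw [← mul_zero z, ← hdiv.2 _ hT, ← integral_const_mul]
    refine integral_congr_ae ?_
    filter_upwards [ae_restrict_ball_iff.2 h] with x hx
    rw [hx, dot_smul_left]
  rw [h2, zero_eq_neg, setIntegral_eq_integral_of_forall_compl_eq_zero fun x hx => by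
    rw [image_eq_zero_of_notMem_tsupport fun h => hx (hγs (hs0 h)), mul_zero]] at h1
  rw [← h1]
  refine integral_congr_ae (Eventually.of_forall fun x => ?_)
  simp [mul_comm]

end

end

/-! ### The main theorem -/

theorem mainTheorem3 :
    (∃ Y, IsSphericalHarmonicSystem Y) ∧
    ∀ Y : (n : ℕ) → Fin (2 * n + 1) → MvPolynomial (Fin 3) ℝ, IsSphericalHarmonicSystem Y →
    -- decomposition of divergence-free fields, on `ℝ³` and on the (weighted) unit ball
    (∀ (Ω : Set R3) (ν : Measure R3),
      ((Ω = Set.univ ∧ ν = volume) ∨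
        (Ω = Metric.ball 0 1 ∧ ∃ α : ℝ, -1 < α ∧ ν = ballMeasure α)) →
      ∀ E : R3 → C3, MemLp E 2 ν → WeakDivFree Ω E →
        (∀ (n : ℕ) (ℓ : Fin (2 * n + 1)), 1 ≤ n →
          HasWeakXGrad Ω (scalarMode (Y n ℓ) (coeff3 n (Y n ℓ) E))
            (toroidalMode (Y n ℓ) (coeff3 n (Y n ℓ) E)) ∧
          HasWeakCurlXGrad Ω (poloidalPotential n (Y n ℓ) (coeff1 (Y n ℓ) E))
            (poloidalMode (Y n ℓ) (coeff1 (Y n ℓ) E) (coeff2 n (Y n ℓ) E))) ∧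
        Tendsto (fun N : ℕ => eLpNorm (fun x => E x - ∑ n ∈ Finset.Icc 1 N, ∑ ℓ,
            (toroidalMode (Y n ℓ) (coeff3 n (Y n ℓ) E) x +
              poloidalMode (Y n ℓ) (coeff1 (Y n ℓ) E) (coeff2 n (Y n ℓ) E) x)) 2 ν)
          atTop (𝓝 0)) ∧
    ∀ c α : ℝ, 0 < c → -1 < α →
    -- the transform of a mode `(x × ∇)(e₃ Y)` is divergence free
    (∀ (n : ℕ) (ℓ : Fin (2 * n + 1)), 1 ≤ n → ∀ e₃ : ℝ → ℂ,
      MemLp (toroidalMode (Y n ℓ) e₃) 2 (ballMeasure α) →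
        HasWeakXGrad (Metric.ball 0 1) (scalarMode (Y n ℓ) e₃) (toroidalMode (Y n ℓ) e₃) ∧
        Differentiable ℝ (finiteFourier c α (toroidalMode (Y n ℓ) e₃)) ∧
        ∀ x, divergence (finiteFourier c α (toroidalMode (Y n ℓ) e₃)) x = 0) ∧
    -- the transform of a mode `∇ × (x × ∇)(…)` is divergence free only if the mode vanishes
    (∀ (n : ℕ) (ℓ : Fin (2 * n + 1)), 1 ≤ n → ∀ e₁ e₂ : ℝ → ℂ,
      MemLp (poloidalMode (Y n ℓ) e₁ e₂) 2 (ballMeasure α) →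
      HasWeakCurlXGrad (Metric.ball 0 1) (poloidalPotential n (Y n ℓ) e₁)
        (poloidalMode (Y n ℓ) e₁ e₂) →
        Differentiable ℝ (finiteFourier c α (poloidalMode (Y n ℓ) e₁ e₂)) ∧
        ((∀ x ∈ unitBall, divergence (finiteFourier c α (poloidalMode (Y n ℓ) e₁ e₂)) x = 0) ↔
          ∀ᵐ r : ℝ, r ∈ Set.Ioo 0 1 → e₁ r = 0 ∧ e₂ r = 0)) ∧
    -- divergence-free eigenfields: two families of modes vanish, the field is `x × ∇ φ`, and the
    -- potential `φ` solves the scalar eigenproblem with the same eigenvalue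
    (∀ (μ : ℂ) (E : R3 → C3), IsEigenfunction c α μ E → WeakDivFree (Metric.ball 0 1) E →
      (∀ (n : ℕ) (ℓ : Fin (2 * n + 1)), ∀ᵐ r : ℝ, r ∈ Set.Ioo 0 1 →
        coeff1 (Y n ℓ) E r = 0 ∧ coeff2 n (Y n ℓ) E r = 0) ∧
      Tendsto (fun N : ℕ => eLpNorm (fun x => E x - ∑ n ∈ Finset.Icc 1 N, ∑ ℓ,
          toroidalMode (Y n ℓ) (coeff3 n (Y n ℓ) E) x) 2 (ballMeasure α)) atTop (𝓝 0) ∧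
      ∃ φ : R3 → ℂ, ContDiff ℝ ∞ φ ∧
        Tendsto (fun N : ℕ => eLpNorm (fun x => φ x - ∑ n ∈ Finset.Icc 1 N, ∑ ℓ,
          scalarMode (Y n ℓ) (coeff3 n (Y n ℓ) E) x) 2 (ballMeasure α)) atTop (𝓝 0) ∧
        (∀ᵐ x ∂volume.restrict unitBall, E x = xGrad φ x) ∧
        IsEigenfunction c α μ φ) ∧
    -- conversely, scalar eigenfunctions give divergence-free eigenfields
    (∀ (μ : ℂ) (φ : R3 → ℂ), IsEigenfunction c α μ φ →
      ∃ φ' : R3 → ℂ, ContDiff ℝ ∞ φ' ∧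
        (∀ᵐ x ∂volume.restrict unitBall, φ x = φ' x) ∧
        (∀ x, divergence (xGrad φ') x = 0) ∧
        WeakDivFree (Metric.ball 0 1) (xGrad φ') ∧
        ((¬ ∀ᵐ x ∂volume.restrict unitBall, xGrad φ' x = 0) →
          IsEigenfunction c α μ (xGrad φ'))) := by
  have hdec : ∀ (Y : (n : ℕ) → Fin (2 * n + 1) → MvPolynomial (Fin 3) ℝ),
      IsSphericalHarmonicSystem Y → ∀ (Ω : Set R3) (ν : Measure R3),
      ((Ω = Set.univ ∧ ν = volume) ∨
        (Ω = Metric.ball 0 1 ∧ ∃ α : ℝ, -1 < α ∧ ν = ballMeasure α)) →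
      ∀ E : R3 → C3, MemLp E 2 ν → WeakDivFree Ω E → IsBallDomain Ω ∧
        Tendsto (fun N : ℕ => eLpNorm (fun x => E x - ∑ n ∈ Finset.Icc 1 N, vshTerm Y E n x) 2 ν)
          atTop (𝓝 0) := by
    rintro Y hY Ω ν (⟨rfl, rfl⟩ | ⟨rfl, α, -, rfl⟩) E hE hdiv
    · exact ⟨isBallDomain_univ, tendsto_expansion_of_weakDivFree isPolar_volume
        (fun P => ae_radialMeasure_one) hY hE hdiv⟩
    · exact ⟨isBallDomain_ball, tendsto_expansion_of_weakDivFree (isPolar_ballMeasure α)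
        (fun P => ae_radialMeasure_jacobi) hY hE hdiv⟩
  refine ⟨exists_isSphericalHarmonicSystem, fun Y hY => ⟨fun Ω ν hΩν E hE hdiv => ?_,
    fun c α hc hα => ⟨fun n ℓ hn e₃ he => ?_, fun n ℓ hn e₁ e₂ hW hcurl => ?_,
      fun μ E hE hdiv => ?_, fun μ φ hφ => ?_⟩⟩⟩
  · obtain ⟨hΩ, hlim⟩ := hdec Y hY Ω ν hΩν E hE hdiv
    exact ⟨fun n ℓ hn => ⟨hasWeakXGrad_mode hΩ
      (fun R hR => integrable_coeff3 hdiv.1 hR (hY.homogeneous n ℓ)) (hY.homogeneous n ℓ),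
      hasWeakCurlXGrad_of_weakDivFree hΩ hdiv hn (hY.mem n ℓ)⟩, hlim⟩
  · have hi := integrable_ballMeasure hα he
    refine ⟨hasWeakXGrad_mode isBallDomain_ball (fun R hR => ?_) (hY.homogeneous n ℓ),
      (contDiff_finiteFourier hi).differentiable (by simp),
      divergence_finiteFourier_toroidalMode hi⟩
    -- Nothing is assumed about `e₃` itself; its local integrability follows because it is the
    -- coefficient of its own mode.
    refine (integrable_coeff3 (locallyIntegrableOn_of_memLp_ballMeasure he) hR
      (hY.homogeneous n ℓ)).congr ?_
    filter_upwards [(isPolar_restrict_closedBall R).pos] with r hr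
    exact coeff3_toroidalMode hY hn ℓ e₃ hr
  · have hi := integrable_ballMeasure hα hW
    refine ⟨(contDiff_finiteFourier hi).differentiable (by simp), fun h => ?_, fun h => ?_⟩
    · have h0 := ae_radial_eq_zero_of_divergence hc hi fun x hx =>
        h x (Metric.ball_subset_closedBall hx)
      have h1 : ∀ᵐ r ∂radialMeasure (jacobiWeight α), e₁ r = 0 := by
        filter_upwards [ae_coeff1_eq_zero h0 (Y n ℓ), (isPolar_ballMeasure α).pos] with r hr hr0
        rw [← hr, coeff1_poloidalMode hY n ℓ e₁ e₂ hr0]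
      exact ae_jacobi_iff.1 (h1.and (ae_coeff2_of_hasWeakCurlXGrad hY hn ℓ hcurl h1))
    · have h0 : ∀ᵐ x ∂ballMeasure α, poloidalMode (Y n ℓ) e₁ e₂ x = 0 := by
        filter_upwards [(isPolar_ballMeasure α).ae_norm (ae_jacobi_iff.2 h)] with x hx
        simp [poloidalMode, hx]
      have h1 : finiteFourier c α (poloidalMode (Y n ℓ) e₁ e₂) = fun _ => 0 := by
        ext1 x
        rw [finiteFourier_congr h0]
        simp [finiteFourier_eq]
      intro x _
      simp [h1, divergence, pd]
  · have hi := integrable_ballMeasure hα hE.memLp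
    obtain ⟨-, hlim⟩ := hdec Y hY _ _ (Or.inr ⟨rfl, α, hα, rfl⟩) E hE.memLp hdiv
    have h1 : ∀ (n : ℕ) (ℓ : Fin (2 * n + 1)), ∀ᵐ r ∂radialMeasure (jacobiWeight α),
        coeff1 (Y n ℓ) E r = 0 := fun n ℓ =>
      ae_coeff1_eq_zero (ae_radial_eq_zero_of_divergence hc hi
        (divergence_finiteFourier_eq_zero hi hE.eigen hdiv)) _
    have h2 : ∀ (n : ℕ) (ℓ : Fin (2 * n + 1)), ∀ᵐ r ∂radialMeasure (jacobiWeight α),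
        coeff2 n (Y n ℓ) E r = 0 := fun n ℓ => by
      rcases Nat.eq_zero_or_pos n with rfl | hn
      · exact Eventually.of_forall fun r => coeff2_zero _ _ _
      · exact ae_coeff2_of_hasWeakCurlXGrad hY hn ℓ
          (hasWeakCurlXGrad_of_weakDivFree isBallDomain_ball hdiv hn (hY.mem n ℓ)) (h1 n ℓ)
    have hT : Tendsto (fun N : ℕ => eLpNorm (fun x => E x - ∑ n ∈ Finset.Icc 1 N,
        toroidalTerm Y E n x) 2 (ballMeasure α)) atTop (𝓝 0) := by
      -- The poloidal coefficients vanish simultaneously for all `n` and `ℓ` off one null set of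
      -- radii, so the general expansion is already the toroidal one.
      refine hlim.congr fun N => eLpNorm_congr_ae ?_
      have h3 : ∀ᵐ r ∂radialMeasure (jacobiWeight α), ∀ (n : ℕ) (ℓ : Fin (2 * n + 1)),
          coeff1 (Y n ℓ) E r = 0 ∧ coeff2 n (Y n ℓ) E r = 0 :=
        ae_all_iff.2 fun n => ae_all_iff.2 fun ℓ => (h1 n ℓ).and (h2 n ℓ)
      filter_upwards [(isPolar_ballMeasure α).ae_norm h3] with x hx
      simp [vshTerm, toroidalTerm, poloidalMode, hx]
    exact ⟨fun n ℓ => ae_jacobi_iff.1 ((h1 n ℓ).and (h2 n ℓ)), hT,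
      exists_eigenpotential hc hα hY hE hT⟩
  · have hμ := hφ.scalar_ne_zero hc hα
    have hi := integrable_ballMeasure hα hφ.memLp
    -- This function is the smooth representative `φ'`: it agrees with `φ` almost everywhere in the
    -- ball, and the eigenvalue equation holds for it at every point of `ℝ³`.
    have hs : ContDiff ℝ ∞ fun x => μ⁻¹ • finiteFourier c α φ x :=
      (contDiff_finiteFourier hi).const_smul μ⁻¹
    have hae : ∀ᵐ x ∂volume.restrict unitBall, φ x = μ⁻¹ • finiteFourier c α φ x := by
      filter_upwards [hφ.eigen] with x hx
      rw [hx, inv_smul_smul₀ hμ]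
    refine ⟨_, hs, hae, divergence_xGrad hs, weakDivFree_xGrad hs _, fun h => ⟨?_, h, ?_⟩⟩
    · exact memLp_ballMeasure_of_continuous hα (continuous_xGrad_C3 (hs.of_le (by simp)))
    · refine Eventually.of_forall (finiteFourier_xGrad hα hs fun x => ?_)
      rw [smul_inv_smul₀ hμ]
      exact finiteFourier_congr ((ae_restrict_unitBall_iff.1 hae).mono fun y hy => hy.symm) x
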